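/- **Corollary (AVERAGE is subquadratic-equivalent to 3-SUM).** An instance of size $n$ of AVERAGE is a set $X\subseteq\{-n^3,\dots,n^3\}$ of $n$ integers; the question is whether there are distinct $x_1,x_2,x_3\in X$ with $x_1+x_2=2x_3$. An instance of size $n$ of 1-partite 3-SUM is a set $X\subseteq\{-n^3,\dots,n^3\}$ of $n$ integers; the question is whether there are distinct $x_1,x_2,x_3\in X$ with $x_1+x_2+x_3=0$. An instance of size $n$ of 3-partite 3-SUM consists of three sets $A_1,A_2,A_3\subseteq\{-n^3,\dots,n^3\}$ of $n$ integers each; the question is whether there are $x_i\in A_i$ ($i=1,2,3$) with $x_1+x_2+x_3=0$. For decision problems $A$ and $B$ with a size measure on their instances, a *subquadratic reduction* from $A$ to $B$ is a single deterministic algorithm $\mathcal A$ with oracle access to $B$, running on a word RAM with words of $O(\log m)$ bits on inputs of size $m$ (an oracle call being charged one step plus the number of words of the query), such that for every $\varepsilon>0$ there is $\delta>0$ with the following properties: 1. for every instance $x$ of $A$, $\mathcal A(x)$ halts with the correct answer; 2. $\mathcal A$ runs in $O(m^{2-\delta})$ time on instances of size $m$; 3. for every instance $x$ of $A$ of sufficiently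 large size $m$ (how large may depend on $\varepsilon$), if $m_i$ is the size of the $i$-th oracle call to $B$ in $\mathcal A(x)$, then $\sum_i m_i^{2-\varepsilon}\le m^{2-\delta}$. $A$ and $B$ are *subquadratic-equivalent* if there are subquadratic reductions from $A$ to $B$ and from $B$ to $A$. Then AVERAGE is subquadratic-equivalent to 1-partite 3-SUM, and AVERAGE is subquadratic-equivalent to 3-partite 3-SUM. -/

import Mathlib

namespace FineGrained

/-! ### Decision problems with a size measure -/

/-- A decision problem on integer data. `Inst n` are the instances of size `n`; an instance of
size `n` is stored in memory as an array of `words n` integers, and `Encodes l I` says that the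
array `l` is a legal listing of the instance `I` (an instance may have several listings, since
sets come in no particular order). -/
structure Problem where
  Inst : ℕ → Type
  words : ℕ → ℕ
  Encodes : {n : ℕ} → List ℤ → Inst n → Prop
  Yes : {n : ℕ} → Inst n → Prop

/-- A set of exactly `n` integers from the universe `{-n³, …, n³}`. -/
def IntSet (n : ℕ) : Type :=
  {X : Finset ℤ // X.card = n ∧ X ⊆ Finset.Icc (-(n : ℤ) ^ 3) ((n : ℤ) ^ 3)}

/-- `l` lists every element of `X` exactly once, in some order. -/
def IntSet.Lists {n : ℕ} (l : List ℤ) (X : IntSet n) : Prop :=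
  l.Nodup ∧ l.toFinset = X.1

/-- 1-partite 3-LDT with coefficients `α` and right-hand side `t`: does the given set contain
three distinct elements with `∑ i, α i * x i = t`? -/
def LDT1 (α : Fin 3 → ℤ) (t : ℤ) : Problem where
  Inst n := IntSet n
  words n := n
  Encodes l X := X.Lists l
  Yes X := ∃ x : Fin 3 → ℤ, Function.Injective x ∧ (∀ i, x i ∈ X.1) ∧ ∑ i, α i * x i = t

/-- 3-partite 3-LDT with coefficients `α` and right-hand side `t`: given sets `A 0, A 1, A 2` of
`n` integers each, are there `x i ∈ A i` with `∑ i, α i * x i = t`? The three sets are stored one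
after the other. -/
def LDT3 (α : Fin 3 → ℤ) (t : ℤ) : Problem where
  Inst n := Fin 3 → IntSet n
  words n := 3 * n
  Encodes l A := ∃ L : Fin 3 → List ℤ, l = L 0 ++ L 1 ++ L 2 ∧ ∀ i, (A i).Lists (L i)
  Yes A := ∃ x : Fin 3 → ℤ, (∀ i, x i ∈ (A i).1) ∧ ∑ i, α i * x i = t

/-- AVERAGE: are there distinct `x₁, x₂, x₃` in the set with `x₁ + x₂ - 2 x₃ = 0`? -/
def average : Problem := LDT1 ![1, 1, -2] 0

/-- 3-SUM on one set: are there distinct `x₁, x₂, x₃` in the set with `x₁ + x₂ + x₃ = 0`? -/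
def threeSum1 : Problem := LDT1 ![1, 1, 1] 0

/-- 3-SUM on three sets: are there `xᵢ ∈ Aᵢ` with `x₁ + x₂ + x₃ = 0`? -/
def threeSum3 : Problem := LDT3 ![1, 1, 1] 0

/-! ### The word RAM with an oracle -/

/-- The arithmetic and comparison operations on words. -/
inductive BinOp
  | add | sub | mul | div | mod | lt | eq

/-- Division and remainder are those of `ℤ` (with nonnegative remainder for nonzero divisor);
comparisons return `1` for true and `0` for false. -/
def BinOp.eval : BinOp → ℤ → ℤ → ℤ
  | .add, a, b => a + b
  | .sub, a, b => a - b
  | .mul, a, b => a * b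
  | .div, a, b => a / b
  | .mod, a, b => a % b
  | .lt, a, b => if a < b then 1 else 0
  | .eq, a, b => if a = b then 1 else 0

/-- Programs. Arguments of type `ℕ` name registers. -/
inductive Prog
  /-- `r_d := c` -/
  | const (d : ℕ) (c : ℤ)
  /-- `r_d := r_a o r_b` -/
  | op (d : ℕ) (o : BinOp) (a b : ℕ)
  /-- `r_d := mem[r_a]` -/
  | load (d a : ℕ)
  /-- `mem[r_a] := r_b` -/
  | store (a b : ℕ)
  /-- query the oracle on the instance of size `r_m` stored from address `r_a` on;
  the answer goes to `r_d` -/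
  | query (d a m : ℕ)
  | skip
  | seq (p q : Prog)
  /-- if `r_c ≠ 0` then `p` else `q` -/
  | ite (c : ℕ) (p q : Prog)
  /-- while `r_c ≠ 0` do `p` -/
  | loop (c : ℕ) (p : Prog)

/-- The configuration of the machine: registers and random access memory. -/
structure State where
  reg : ℕ → ℤ
  mem : ℕ → ℤ

def State.setReg (s : State) (d : ℕ) (v : ℤ) : State :=
  ⟨Function.update s.reg d v, s.mem⟩

def State.setMem (s : State) (a : ℕ) (v : ℤ) : State :=
  ⟨s.reg, Function.update s.mem a v⟩

/-- The contents of the `len` memory cells from address `a` on. -/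
def State.segment (s : State) (a len : ℕ) : List ℤ :=
  (List.range len).map fun i => s.mem (a + i)

/-- The machine starts with the input array in memory from address `0` on and with the input size
`n` in register `0`; everything else is `0`. -/
def State.init (n : ℕ) (l : List ℤ) : State :=
  ⟨Function.update (fun _ => 0) 0 (n : ℤ), fun i => l.getD i 0⟩

/-- `Exec B w p s s' T q`: with oracle `B` and words of `w` bits (and a sign), the program `p`,
started in `s`, halts in `s'` after `T` time steps, and `q` is the list of the sizes of its
oracle calls.

Every operation and every test takes one step; an oracle call takes one step plus one step per
word of the query. A computation gets stuck (so that there is no `s'`) when it produces a value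
that does not fit in a word, accesses a negative address, or makes an oracle call on something
that is not an instance of `B` of the announced size. -/
inductive Exec (B : Problem) (w : ℕ) : Prog → State → State → ℕ → List ℕ → Prop
  | const {d : ℕ} {c : ℤ} {s : State} (hc : |c| < 2 ^ w) :
      Exec B w (.const d c) s (s.setReg d c) 1 []
  | op {d : ℕ} {o : BinOp} {a b : ℕ} {s : State}
      (hv : |o.eval (s.reg a) (s.reg b)| < 2 ^ w) :
      Exec B w (.op d o a b) s (s.setReg d (o.eval (s.reg a) (s.reg b))) 1 []
  | load {d a : ℕ} {s : State} {x : ℕ} (hx : s.reg a = x) (hv : |s.mem x| < 2 ^ w) :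
      Exec B w (.load d a) s (s.setReg d (s.mem x)) 1 []
  | store {a b : ℕ} {s : State} {x : ℕ} (hx : s.reg a = x) :
      Exec B w (.store a b) s (s.setMem x (s.reg b)) 1 []
  | query_yes {d a m : ℕ} {s : State} {x n : ℕ} (hx : s.reg a = x) (hn : s.reg m = n)
      (hw : x + B.words n ≤ 2 ^ w) (I : B.Inst n) (hI : B.Encodes (s.segment x (B.words n)) I)
      (hyes : B.Yes I) (h1 : 0 < w) :
      Exec B w (.query d a m) s (s.setReg d 1) (1 + B.words n) [n]
  | query_no {d a m : ℕ} {s : State} {x n : ℕ} (hx : s.reg a = x) (hn : s.reg m = n)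
      (hw : x + B.words n ≤ 2 ^ w) (I : B.Inst n) (hI : B.Encodes (s.segment x (B.words n)) I)
      (hno : ¬ B.Yes I) :
      Exec B w (.query d a m) s (s.setReg d 0) (1 + B.words n) [n]
  | skip {s : State} : Exec B w .skip s s 1 []
  | seq {p p' : Prog} {s s' s'' : State} {T T' : ℕ} {q q' : List ℕ}
      (h : Exec B w p s s' T q) (h' : Exec B w p' s' s'' T' q') :
      Exec B w (.seq p p') s s'' (T + T') (q ++ q')
  | ite_true {c : ℕ} {p p' : Prog} {s s' : State} {T : ℕ} {q : List ℕ}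
      (hc : s.reg c ≠ 0) (h : Exec B w p s s' T q) :
      Exec B w (.ite c p p') s s' (1 + T) q
  | ite_false {c : ℕ} {p p' : Prog} {s s' : State} {T : ℕ} {q : List ℕ}
      (hc : s.reg c = 0) (h : Exec B w p' s s' T q) :
      Exec B w (.ite c p p') s s' (1 + T) q
  | loop_done {c : ℕ} {p : Prog} {s : State} (hc : s.reg c = 0) :
      Exec B w (.loop c p) s s 1 []
  | loop_step {c : ℕ} {p : Prog} {s s' s'' : State} {T T' : ℕ} {q q' : List ℕ}
      (hc : s.reg c ≠ 0) (h : Exec B w p s s' T q) (h' : Exec B w (.loop c p) s' s'' T' q') :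
      Exec B w (.loop c p) s s'' (1 + T + T') (q ++ q')

/-- Words of `O(log n)` bits: `k` times the number of binary digits of `n` (for `n ≥ 1`). -/
def wordSize (k n : ℕ) : ℕ := k * (Nat.log 2 n + 1)

/-! ### Subquadratic reductions -/

/-- There is a subquadratic reduction from `A` to `B`: one deterministic algorithm `p` for the word
RAM with words of `O(log m)` bits and oracle access to `B` such that for every `ε > 0` there is
`δ > 0` for which, on every instance of `A` (of any size `m`, listed in any order),
* `p` halts with the correct answer in register `0`,
* it does so in time `O(m ^ (2 - δ))`, and
* the sizes `mᵢ` of its oracle calls satisfy `∑ mᵢ ^ (2 - ε) ≤ m ^ (2 - δ)` once `m` is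
  sufficiently large. -/
def SubquadraticReduction (A B : Problem) : Prop :=
  ∃ (p : Prog) (k : ℕ), ∀ ε : ℝ, 0 < ε → ∃ δ : ℝ, 0 < δ ∧ ∃ (C : ℝ) (m₀ : ℕ),
    ∀ (m : ℕ) (I : A.Inst m) (l : List ℤ), A.Encodes l I →
      ∃ (s : State) (T : ℕ) (q : List ℕ),
        Exec B (wordSize k m) p (State.init m l) s T q ∧
        ((A.Yes I ∧ s.reg 0 = 1) ∨ (¬ A.Yes I ∧ s.reg 0 = 0)) ∧
        (m₀ ≤ m → (T : ℝ) ≤ C * (m : ℝ) ^ (2 - δ) ∧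
          (q.map fun n : ℕ => (n : ℝ) ^ (2 - ε)).sum ≤ (m : ℝ) ^ (2 - δ))

/-- `A` and `B` are subquadratic-equivalent. -/
def SubquadraticEquivalent (A B : Problem) : Prop :=
  SubquadraticReduction A B ∧ SubquadraticReduction B A

end FineGrained

/-! All four reductions are one program with different formulas for the entries of its queries. Let
`b = bits n`, roughly `√(3 log₂ n)`, `q = 2 ^ b` and `K = base n = 64 q ^ 4`. The program asks `K ^
7` queries of size `16 n` and accepts if some answer is yes. Since `K ^ 7 = 2 ^ O(√log n) = n ^
o(1)`, the running time is `n ^ (1 + o(1))` and `∑ mᵢ ^ (2 - ε)` is `n ^ (2 - ε + o(1))`; the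
program itself does not depend on `ε`.

Each query lets some source elements play each of three roles and merges them into one target
instance. The number of the query is read as seven digits in base `K`: a modulus `p`, three residues
modulo `p`, and three colours.

The residues handle distinctness. They are required to be pairwise different, and an element may
play role `a` only if it has the `a`-th residue, so elements in different roles are distinct.
Conversely, any three distinct numbers of absolute value at most `n ^ 3` are separated by some `p <
K` (`exists_separating_modulus`): otherwise the product of their differences would be divisible by a
central binomial coefficient that exceeds it.

The colours are needed when the target is AVERAGE, where elements of a single role could form a
progression. A Behrend-type colouring with at most `q ^ 4` colours has no nontrivial monochromatic
progression (`color_no_progression`). The number is written in base `2 q`; the colour records the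
half in which each digit lies, and the sum of the squares of the digits modulo `q`. Equal halves
rule out carries, so a progression is a progression in every digit; equal sums of squares make it
constant by strict convexity. In each query a role admits one colour only.

The roles are merged by affine maps for which the target equation forces one element of each role:
`32 x`, `32 y + 2`, `1 - 16 z` for AVERAGE and `7 x + 1`, `7 y + 2`, `-14 z - 3` for 3-SUM on one
set. An instance has a prescribed number of elements, so the remaining places are padded: for
AVERAGE by multiples of a progression-free sequence (`ternary`) in a residue class of their own, for
3-SUM by numbers too large to be cancelled (`query_average`, `query_threeSum1`, `query_threeSum3`).

On the machine, a weakest-precondition calculus tracks time and oracle calls, and overflow is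
excluded by degrees: all variables are at most `U ^ 200`, where `U > n` is a power of two and words
hold numbers below `U ^ 10000`. -/

set_option exponentiation.threshold 20000

namespace FineGrained

/-! ### Arithmetic expressions over registers -/

/-- Arithmetic expressions whose variables are registers. -/
inductive Expr
  | const (c : ℤ)
  | var (r : ℕ)
  | bin (o : BinOp) (a b : Expr)

namespace Expr

/-- The value of an expression. -/
def eval (ρ : ℕ → ℤ) : Expr → ℤ
  | const c => c
  | var r => ρ r
  | bin o a b => o.eval (a.eval ρ) (b.eval ρ)

/-- Code that evaluates an expression into register `d`, overwriting only registers `≥ d`. -/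
def compile : ℕ → Expr → Prog
  | d, const c => .const d c
  | d, var r => .seq (.const d 0) (.op d .add d r)
  | d, bin o a b => .seq (a.compile d) (.seq (b.compile (d + 1)) (.op d o d (d + 1)))

/-- The running time of the compiled expression. -/
def cost : Expr → ℕ
  | const _ => 1
  | var _ => 2
  | bin _ a b => a.cost + (b.cost + 1)

/-- If the variables are at most `U ^ D` in absolute value and `2 ≤ U`, then the expression and
all its subexpressions are at most `U ^ deg D`. -/
def deg (D : ℕ) : Expr → ℕ
  | const c => c.natAbs
  | var _ => D
  | bin .add a b => max (a.deg D) (b.deg D) + 1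
  | bin .sub a b => max (a.deg D) (b.deg D) + 1
  | bin .mul a b => a.deg D + b.deg D
  | bin .div a b => max (a.deg D) (b.deg D)
  | bin .mod a b => max (a.deg D) (b.deg D)
  | bin .lt a b => max (a.deg D) (b.deg D)
  | bin .eq a b => max (a.deg D) (b.deg D)

/-- All variables are registers with numbers below `R`. -/
def VarsBelow (R : ℕ) : Expr → Bool
  | const _ => true
  | var r => decide (r < R)
  | bin _ a b => a.VarsBelow R && b.VarsBelow R

theorem deg_le_left (D : ℕ) (o : BinOp) (a b : Expr) : a.deg D ≤ (bin o a b).deg D := by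
  cases o <;> (simp [deg]; try omega)

theorem deg_le_right (D : ℕ) (o : BinOp) (a b : Expr) : b.deg D ≤ (bin o a b).deg D := by
  cases o <;> (simp [deg]; try omega)

/-- A constant may count as degree `|c|` because `|c| < 2 ^ |c|`, and a sum costs one extra degree
because `2 * U ^ m ≤ U ^ (m + 1)`. This turns overflow checks into comparisons of exponents. -/
theorem abs_eval_le {U D R : ℕ} (hU : 2 ≤ U) {ρ : ℕ → ℤ} (hρ : ∀ r < R, |ρ r| ≤ (U : ℤ) ^ D) :
    ∀ e : Expr, e.VarsBelow R = true → |e.eval ρ| ≤ (U : ℤ) ^ e.deg D := by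
  have hU1 : (1 : ℤ) ≤ U := by omega
  intro e
  induction e with
  | const c =>
    intro _
    simp only [eval, deg]
    have h1 : (c.natAbs : ℤ) < (2 : ℤ) ^ c.natAbs := by exact_mod_cast Nat.lt_two_pow_self
    have h2 : (2 : ℤ) ^ c.natAbs ≤ (U : ℤ) ^ c.natAbs :=
      pow_le_pow_left₀ (by norm_num) (by exact_mod_cast hU) _
    rw [Int.abs_eq_natAbs]; omega
  | var r =>
    intro h
    exact hρ r (by simpa [VarsBelow] using h)
  | bin o a b iha ihb =>
    intro h
    simp only [VarsBelow, Bool.and_eq_true] at h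
    have ha := iha h.1
    have hb := ihb h.2
    set m := max (a.deg D) (b.deg D) with hm
    have ha' : |a.eval ρ| ≤ (U : ℤ) ^ m :=
      ha.trans (pow_le_pow_right₀ hU1 (le_max_left _ _))
    have hb' : |b.eval ρ| ≤ (U : ℤ) ^ m :=
      hb.trans (pow_le_pow_right₀ hU1 (le_max_right _ _))
    have h1m : (1 : ℤ) ≤ (U : ℤ) ^ m := one_le_pow₀ hU1
    have hs : 2 * (U : ℤ) ^ m ≤ (U : ℤ) ^ (m + 1) := by
      rw [pow_succ, mul_comm]
      exact mul_le_mul_of_nonneg_left (by exact_mod_cast hU) (by positivity)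
    cases o with
    | add => simp only [eval, deg, BinOp.eval]; exact (abs_add_le _ _).trans (by linarith)
    | sub => simp only [eval, deg, BinOp.eval]; exact (abs_sub _ _).trans (by linarith)
    | mul =>
      simp only [eval, deg, BinOp.eval, abs_mul, pow_add]
      exact mul_le_mul ha hb (abs_nonneg _) (by positivity)
    | div =>
      simp only [eval, deg, BinOp.eval]
      refine le_trans ?_ ha'
      rw [Int.abs_eq_natAbs, Int.abs_eq_natAbs]
      exact_mod_cast Int.natAbs_ediv_le_natAbs _ _
    | mod =>
      simp only [eval, deg, BinOp.eval]
      rcases eq_or_ne (b.eval ρ) 0 with h0 | h0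
      · simpa [h0] using ha'
      · rw [abs_of_nonneg (Int.emod_nonneg _ h0)]
        exact (Int.emod_lt_abs _ h0).le.trans hb'
    | lt => simp only [eval, deg, BinOp.eval]; split_ifs <;> simp [← hm, h1m]
    | eq => simp only [eval, deg, BinOp.eval]; split_ifs <;> simp [← hm, h1m]

theorem eval_congr {R : ℕ} {ρ ρ' : ℕ → ℤ} (h : ∀ r < R, ρ r = ρ' r) :
    ∀ e : Expr, e.VarsBelow R = true → e.eval ρ = e.eval ρ' := by
  intro e
  induction e with
  | const c => intro _; rfl
  | var r => intro hr; exact h r (by simpa [VarsBelow] using hr)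
  | bin o a b iha ihb =>
    intro hr
    simp only [VarsBelow, Bool.and_eq_true] at hr
    simp only [eval, iha hr.1, ihb hr.2]

/-- The registers from `d` on act as a stack: the left operand waits in `d` while the right one is
computed from `d + 1` upwards, and the variables are safe because `R ≤ d`. -/
theorem exec_compile {B : Problem} {w U D R : ℕ} (hU : 2 ≤ U) : ∀ (e : Expr) (d : ℕ) (s : State),
    R ≤ d → e.VarsBelow R = true → (∀ r < R, |s.reg r| ≤ (U : ℤ) ^ D) → U ^ e.deg D < 2 ^ w →
    ∃ s', Exec B w (e.compile d) s s' e.cost [] ∧ s'.reg d = e.eval s.reg ∧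
      (∀ r < d, s'.reg r = s.reg r) ∧ s'.mem = s.mem := by
  intro e
  induction e with
  | const c =>
    intro d s hd hv hb hdeg
    refine ⟨_, .const ?_, by simp [State.setReg, eval], ?_, rfl⟩
    · exact (abs_eval_le hU hb (const c) hv).trans_lt (by exact_mod_cast hdeg)
    · intro r hr; simp [State.setReg, hr.ne]
  | var r =>
    intro d s hd hv hb hdeg
    have hr : r < R := by simpa [VarsBelow] using hv
    have hne : r ≠ d := by omega
    -- The machine has no move instruction; a copy is zeroing followed by addition, which needs `r ≠
    -- d`.
    refine ⟨_, .seq (.const (by simp)) (.op ?_), ?_, ?_, rfl⟩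
    · simp only [State.setReg, BinOp.eval, Function.update_self, Function.update_of_ne hne, zero_add]
      exact (abs_eval_le hU hb (var r) hv).trans_lt (by exact_mod_cast hdeg)
    · simp [State.setReg, BinOp.eval, eval, hne]
    · intro r' hr'; simp [State.setReg, hr'.ne]
  | bin o a b iha ihb =>
    intro d s hd hv hb hdeg
    have hv' := hv
    simp only [VarsBelow, Bool.and_eq_true] at hv
    have hU0 : 0 < U := by omega
    obtain ⟨s1, e1, v1, f1, m1⟩ := iha d s hd hv.1 hb
      ((Nat.pow_le_pow_right hU0 (deg_le_left D o a b)).trans_lt hdeg)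
    have hs1 : ∀ r < R, s1.reg r = s.reg r := fun r hr => f1 r (by omega)
    obtain ⟨s2, e2, v2, f2, m2⟩ := ihb (d + 1) s1 (by omega) hv.2
      (fun r hr => by rw [hs1 r hr]; exact hb r hr)
      ((Nat.pow_le_pow_right hU0 (deg_le_right D o a b)).trans_lt hdeg)
    have hb2 : s2.reg (d + 1) = b.eval s.reg := by rw [v2]; exact eval_congr hs1 b hv.2
    have ha2 : s2.reg d = a.eval s.reg := by rw [f2 d (by omega), v1]
    refine ⟨_, .seq e1 (.seq e2 (.op ?_)), ?_, ?_, ?_⟩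
    · rw [ha2, hb2]
      exact (abs_eval_le hU hb (bin o a b) hv').trans_lt (by exact_mod_cast hdeg)
    · simp [State.setReg, ha2, hb2, eval]
    · intro r hr
      simp [State.setReg, hr.ne, f2 r (by omega), f1 r hr]
    · simp [State.setReg, m1, m2]

end Expr

/-! ### Structured commands

Registers below `16` hold the variables of a program; the others hold intermediate results. -/

/-- `v := e` -/
def assign (v : ℕ) (e : Expr) : Prog := .seq (e.compile 16) (.seq (.const v 0) (.op v .add v 16))

/-- `v := mem[e]` -/
def fetch (v : ℕ) (e : Expr) : Prog := .seq (e.compile 16) (.load v 16)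

/-- `mem[a] := e` -/
def put (a e : Expr) : Prog := .seq (a.compile 16) (.seq (e.compile 17) (.store 16 17))

/-- query the oracle on the instance of size `m` at address `a`; the answer goes to `v` -/
def ask (v : ℕ) (a m : Expr) : Prog := .seq (a.compile 16) (.seq (m.compile 17) (.query v 16 17))

/-- while `e ≠ 0` do `p` -/
def while_ (e : Expr) (p : Prog) : Prog :=
  .seq (e.compile 16) (.loop 16 (.seq p (e.compile 16)))

/-- Weakest precondition: started with variables `ρ` and memory `μ`, the program halts within `τ`
steps, having made the oracle calls `q`, with variables and memory satisfying `Q`. -/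
def WP (B : Problem) (w : ℕ) (p : Prog) (τ : ℕ) (q : List ℕ) (Q : (ℕ → ℤ) → (ℕ → ℤ) → Prop)
    (ρ μ : ℕ → ℤ) : Prop :=
  ∀ s : State, (∀ r < 16, s.reg r = ρ r) → s.mem = μ →
    ∃ s' T, Exec B w p s s' T q ∧ T ≤ τ ∧ ∃ ρ', (∀ r < 16, s'.reg r = ρ' r) ∧ Q ρ' s'.mem

/-- All variables are at most `U ^ D` in absolute value. -/
def Bounded (U D : ℕ) (ρ : ℕ → ℤ) : Prop := ∀ r < 16, |ρ r| ≤ (U : ℤ) ^ D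

theorem Bounded.update {U D : ℕ} {ρ : ℕ → ℤ} (h : Bounded U D ρ) {v : ℕ} {x : ℤ}
    (hx : |x| ≤ (U : ℤ) ^ D) : Bounded U D (Function.update ρ v x) := by
  intro r hr
  by_cases hrv : r = v
  · subst hrv; simpa using hx
  · simpa [hrv] using h r hr

/-- The expression only uses variables, and evaluates without overflow if these are bounded. -/
structure Expr.Safe (U D w : ℕ) (e : Expr) : Prop where
  vars : e.VarsBelow 16 = true
  deg : U ^ e.deg D < 2 ^ w

/-! ### Proof rules for structured commands, with time and oracle calls -/

section Rules

variable {B : Problem} {w U D τ : ℕ} {q : List ℕ} {Q : (ℕ → ℤ) → (ℕ → ℤ) → Prop}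
  {ρ μ : ℕ → ℤ}

theorem WP.seq {p p' : Prog} {τ' : ℕ} {q' : List ℕ}
    (h : WP B w p τ q (WP B w p' τ' q' Q) ρ μ) :
    WP B w (.seq p p') (τ + τ') (q ++ q') Q ρ μ := by
  intro s hs hm
  obtain ⟨s1, T1, e1, t1, ρ1, h1, h2⟩ := h s hs hm
  obtain ⟨s2, T2, e2, t2, ρ2, h3, h4⟩ := h2 s1 h1 rfl
  exact ⟨s2, T1 + T2, .seq e1 e2, by omega, ρ2, h3, h4⟩

theorem WP.mono {p : Prog} {τ' : ℕ} {q' : List ℕ} {Q' : (ℕ → ℤ) → (ℕ → ℤ) → Prop}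
    (h : WP B w p τ q Q ρ μ) (hτ : τ ≤ τ') (hq : q = q') (hQ : ∀ ρ μ, Q ρ μ → Q' ρ μ) :
    WP B w p τ' q' Q' ρ μ := by
  subst hq
  intro s hs hm
  obtain ⟨s1, T1, e1, t1, ρ1, h1, h2⟩ := h s hs hm
  exact ⟨s1, T1, e1, by omega, ρ1, h1, hQ _ _ h2⟩

/-- Form of `WP.seq` for a first command without oracle calls: the total budget `τ` is given from
outside and the continuation inherits what is left of it. -/
theorem WP.then {p p' : Prog} {τ' : ℕ}
    (h : WP B w p τ' [] (fun ρ' μ' => WP B w p' (τ - τ') q Q ρ' μ') ρ μ) (hτ : τ' ≤ τ) :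
    WP B w (.seq p p') τ q Q ρ μ :=
  h.seq.mono (by omega) rfl fun _ _ h => h

theorem exec_compile_of_agree (hU : 2 ≤ U) {e : Expr} (he : e.Safe U D w) (hρ : Bounded U D ρ)
    {d : ℕ} (hd : 16 ≤ d) {s : State} (hs : ∀ r < 16, s.reg r = ρ r) :
    ∃ s', Exec B w (e.compile d) s s' e.cost [] ∧ s'.reg d = e.eval ρ ∧
      (∀ r < d, s'.reg r = s.reg r) ∧ s'.mem = s.mem := by
  obtain ⟨s', h1, h2, h3, h4⟩ := e.exec_compile (B := B) hU d s hd he.vars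
    (fun r hr => by rw [hs r hr]; exact hρ r hr) he.deg
  exact ⟨s', h1, by rw [h2, e.eval_congr hs he.vars], h3, h4⟩

theorem WP.assign (hU : 2 ≤ U) {e : Expr} (he : e.Safe U D w) (hρ : Bounded U D ρ) {v : ℕ}
    (hv : v < 16) (hQ : Q (Function.update ρ v (e.eval ρ)) μ) :
    WP B w (assign v e) (e.cost + 2) [] Q ρ μ := by
  intro s hs hm
  obtain ⟨s1, e1, v1, f1, m1⟩ := exec_compile_of_agree (B := B) hU he hρ le_rfl hs
  have hne : (16 : ℕ) ≠ v := by omega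
  refine ⟨_, _, .seq e1 (.seq (.const (by simp)) (.op (o := .add) (a := v) (b := 16) ?_)), le_rfl,
    Function.update ρ v (e.eval ρ), ?_, ?_⟩
  · simp only [State.setReg, BinOp.eval, Function.update_self, Function.update_of_ne hne, zero_add,
      v1]
    exact (Expr.abs_eval_le hU hρ e he.vars).trans_lt (by exact_mod_cast he.deg)
  · intro r hr
    by_cases hrv : r = v
    · subst hrv; simp [State.setReg, BinOp.eval, v1, hne]
    · simp [State.setReg, hrv, f1 r hr, hs r hr]
  · simpa [State.setReg, m1, hm] using hQ

theorem WP.fetch (hU : 2 ≤ U) {e : Expr} (he : e.Safe U D w) (hρ : Bounded U D ρ) {v x : ℕ}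
    (hv : v < 16) (hx : e.eval ρ = x) (hb : |μ x| < 2 ^ w)
    (hQ : Q (Function.update ρ v (μ x)) μ) :
    WP B w (fetch v e) (e.cost + 1) [] Q ρ μ := by
  intro s hs hm
  obtain ⟨s1, e1, v1, f1, m1⟩ := exec_compile_of_agree (B := B) hU he hρ le_rfl hs
  refine ⟨_, _, .seq e1 (.load (x := x) (by rw [v1, hx]) (by rw [m1, hm]; exact hb)), le_rfl,
    Function.update ρ v (μ x), ?_, ?_⟩
  · intro r hr
    by_cases hrv : r = v
    · subst hrv; simp [State.setReg, m1, hm]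
    · simp [State.setReg, hrv, f1 r hr, hs r hr]
  · simpa [State.setReg, m1, hm] using hQ

theorem WP.put (hU : 2 ≤ U) {a e : Expr} (ha : a.Safe U D w) (he : e.Safe U D w)
    (hρ : Bounded U D ρ) {x : ℕ} (hx : a.eval ρ = x)
    (hQ : Q ρ (Function.update μ x (e.eval ρ))) :
    WP B w (put a e) (a.cost + (e.cost + 1)) [] Q ρ μ := by
  intro s hs hm
  obtain ⟨s1, e1, v1, f1, m1⟩ := exec_compile_of_agree (B := B) hU ha hρ le_rfl hs
  have hs1 : ∀ r < 16, s1.reg r = ρ r := fun r hr => by rw [f1 r hr, hs r hr]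
  obtain ⟨s2, e2, v2, f2, m2⟩ := exec_compile_of_agree (B := B) hU he hρ (d := 17) (by omega) hs1
  refine ⟨_, _, .seq e1 (.seq e2 (.store (x := x) (by rw [f2 16 (by omega), v1, hx]))), le_rfl,
    ρ, ?_, ?_⟩
  · intro r hr
    simp [State.setMem, f2 r (by omega), hs1 r hr]
  · simpa [State.setMem, m1, m2, hm, v2] using hQ

theorem WP.ask (hU : 2 ≤ U) {a m : Expr} (ha : a.Safe U D w) (he : m.Safe U D w)
    (hρ : Bounded U D ρ) {v x n : ℕ} (hv : v < 16) (hx : a.eval ρ = x) (hn : m.eval ρ = n)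
    (hw : x + B.words n ≤ 2 ^ w) (h1 : 0 < w) (I : B.Inst n)
    (hI : B.Encodes ((List.range (B.words n)).map fun i => μ (x + i)) I)
    (hyes : B.Yes I → Q (Function.update ρ v 1) μ)
    (hno : ¬ B.Yes I → Q (Function.update ρ v 0) μ) :
    WP B w (ask v a m) (a.cost + (m.cost + (1 + B.words n))) [n] Q ρ μ := by
  intro s hs hm
  obtain ⟨s1, e1, v1, f1, m1⟩ := exec_compile_of_agree (B := B) hU ha hρ le_rfl hs
  have hs1 : ∀ r < 16, s1.reg r = ρ r := fun r hr => by rw [f1 r hr, hs r hr]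
  obtain ⟨s2, e2, v2, f2, m2⟩ := exec_compile_of_agree (B := B) hU he hρ (d := 17) (by omega) hs1
  have hx2 : s2.reg 16 = x := by rw [f2 16 (by omega), v1, hx]
  have hn2 : s2.reg 17 = n := by rw [v2, hn]
  have hmem : s2.mem = μ := by rw [m2, m1, hm]
  have hI2 : B.Encodes (s2.segment x (B.words n)) I := by
    simpa [State.segment, hmem] using hI
  have hreg : ∀ c : ℤ, ∀ r < 16, (s2.setReg v c).reg r = Function.update ρ v c r := by
    intro c r hr
    by_cases hrv : r = v
    · subst hrv; simp [State.setReg]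
    · simp [State.setReg, hrv, f2 r (by omega), hs1 r hr]
  by_cases hY : B.Yes I
  · exact ⟨_, _, .seq e1 (.seq e2 (.query_yes hx2 hn2 hw I hI2 hY h1)), le_rfl, _, hreg 1,
      by simpa [State.setReg, hmem] using hyes hY⟩
  · exact ⟨_, _, .seq e1 (.seq e2 (.query_no hx2 hn2 hw I hI2 hY)), le_rfl, _, hreg 0,
      by simpa [State.setReg, hmem] using hno hY⟩

/-- The invariant is indexed by the number of completed iterations, so it fixes the exact number `N`
of rounds, and with it the list of oracle calls. -/
theorem WP.while_ (hU : 2 ≤ U) {e : Expr} (he : e.Safe U D w) {p : Prog}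
    (Inv : ℕ → (ℕ → ℤ) → (ℕ → ℤ) → Prop) (N : ℕ)
    (hbd : ∀ i ρ μ, Inv i ρ μ → Bounded U D ρ)
    (hcond : ∀ i < N, ∀ ρ μ, Inv i ρ μ → e.eval ρ ≠ 0)
    (hend : ∀ ρ μ, Inv N ρ μ → e.eval ρ = 0)
    (hbody : ∀ i < N, ∀ ρ μ, Inv i ρ μ → WP B w p τ q (Inv (i + 1)) ρ μ) (h0 : Inv 0 ρ μ) :
    WP B w (while_ e p) (e.cost + (N * (1 + (τ + e.cost)) + 1)) (List.replicate N q).flatten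
      (Inv N) ρ μ := by
  -- Induction on the number `k` of rounds left, keeping the current value of the condition in
  -- register `16`.
  have key : ∀ k i, i + k = N → ∀ ρ μ, Inv i ρ μ → ∀ s : State, (∀ r < 16, s.reg r = ρ r) →
      s.reg 16 = e.eval ρ → s.mem = μ →
      ∃ s' T, Exec B w (.loop 16 (.seq p (e.compile 16))) s s' T (List.replicate k q).flatten ∧
        T ≤ k * (1 + (τ + e.cost)) + 1 ∧ ∃ ρ', (∀ r < 16, s'.reg r = ρ' r) ∧ Inv N ρ' s'.mem := by
    intro k
    induction k with
    | zero =>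
      intro i hi ρ μ hInv s hs h16 hm
      obtain rfl : i = N := by omega
      exact ⟨s, 1, .loop_done (by rw [h16, hend _ _ hInv]), by omega, ρ, hs, by rw [hm]; exact hInv⟩
    | succ k ih =>
      intro i hi ρ μ hInv s hs h16 hm
      obtain ⟨s1, T1, e1, t1, ρ1, h1, h2⟩ := hbody i (by omega) ρ μ hInv s hs hm
      obtain ⟨s2, e2, v2, f2, m2⟩ :=
        exec_compile_of_agree (B := B) hU he (hbd _ _ _ h2) le_rfl h1
      obtain ⟨s3, T3, e3, t3, ρ3, h5, h6⟩ := ih (i + 1) (by omega) ρ1 s1.mem h2 s2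
        (fun r hr => by rw [f2 r hr, h1 r hr]) v2 m2
      refine ⟨s3, 1 + (T1 + e.cost) + T3, ?_, ?_, ρ3, h5, h6⟩
      · have := Exec.loop_step (c := 16) (by rw [h16]; exact hcond i (by omega) _ _ hInv)
          (Exec.seq e1 e2) e3
        simpa [List.replicate_succ] using this
      · have : (k + 1) * (1 + (τ + e.cost)) = k * (1 + (τ + e.cost)) + (1 + (τ + e.cost)) := by ring
        omega
  intro s hs hm
  obtain ⟨s1, e1, v1, f1, m1⟩ := exec_compile_of_agree (B := B) hU he (hbd _ _ _ h0) le_rfl hs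
  obtain ⟨s2, T2, e2, t2, ρ2, h3, h4⟩ := key N 0 (by omega) ρ μ h0 s1
    (fun r hr => by rw [f1 r hr, hs r hr]) v1 (by rw [m1, hm])
  exact ⟨s2, _, Exec.seq e1 e2, by omega, ρ2, h3, h4⟩

end Rules

/-! ### A colouring of the integers without monochromatic arithmetic progressions -/

/-- Split off the lowest digit in base `2 q`, recording in which half of the digits it is, and
adding the square of its remainder modulo `q` to a running sum. -/
def colorStep (q : ℤ) (z : ℤ × ℤ × ℤ) : ℤ × ℤ × ℤ :=
  (z.1 / (2 * q), 2 * z.2.1 + z.1 % (2 * q) / q, z.2.2 + (z.1 % (2 * q) % q) ^ 2)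

section Color

variable {q : ℤ}

theorem half_digit (hq : 0 < q) (y : ℤ) :
    (y % (2 * q) / q = 0 ∨ y % (2 * q) / q = 1) ∧ 0 ≤ y % (2 * q) % q ∧ y % (2 * q) % q < q ∧
      y = 2 * q * (y / (2 * q)) + q * (y % (2 * q) / q) + y % (2 * q) % q := by
  have h0 := Int.emod_nonneg y (b := 2 * q) (by omega)
  have h1 := Int.emod_lt_of_pos y (b := 2 * q) (by omega)
  have h2 : 0 ≤ y % (2 * q) / q := Int.ediv_nonneg h0 hq.le
  have h3 : y % (2 * q) / q < 2 := Int.ediv_lt_of_lt_mul hq (by linarith)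
  have h4 := Int.mul_ediv_add_emod y (2 * q)
  have h5 := Int.mul_ediv_add_emod (y % (2 * q)) q
  exact ⟨by omega, Int.emod_nonneg _ hq.ne', Int.emod_lt_of_pos _ hq, by linarith⟩

/-- Each step doubles the pattern and appends one bit, so nothing of the earlier pattern is lost. -/
theorem color_pattern_inj (hq : 0 < q) (k : ℕ) (z z' : ℤ × ℤ × ℤ)
    (h : ((colorStep q)^[k] z).2.1 = ((colorStep q)^[k] z').2.1) : z.2.1 = z'.2.1 := by
  induction k generalizing z z' with
  | zero => simpa using h
  | succ k ih =>
    have := ih _ _ h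
    have h1 := (half_digit hq z.1).1
    have h2 := (half_digit hq z'.1).1
    simp only [colorStep] at this
    omega

/-- Behrend's argument, digit by digit from the lowest. The excess of the square sums of `x` and `y`
over twice that of `z` starts nonnegative, never decreases along a progression, and is zero at the
end; so it is zero throughout and all digits agree. Arbitrary starting states make the induction go
through. -/
theorem color_progression (hq : 0 < q) (k : ℕ) (x y z : ℤ × ℤ × ℤ)
    (hx : 0 ≤ x.1 ∧ x.1 < (2 * q) ^ k) (hy : 0 ≤ y.1 ∧ y.1 < (2 * q) ^ k)
    (hz : 0 ≤ z.1 ∧ z.1 < (2 * q) ^ k) (hsum : x.1 + y.1 = 2 * z.1)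
    (hxz : ((colorStep q)^[k] x).2.1 = ((colorStep q)^[k] z).2.1)
    (hyz : ((colorStep q)^[k] y).2.1 = ((colorStep q)^[k] z).2.1)
    (hr : 2 * z.2.2 ≤ x.2.2 + y.2.2)
    (hr' : ((colorStep q)^[k] x).2.2 + ((colorStep q)^[k] y).2.2 =
      2 * ((colorStep q)^[k] z).2.2) :
    x.1 = y.1 ∧ x.2.2 + y.2.2 = 2 * z.2.2 := by
  induction k generalizing x y z with
  | zero => simp at *; omega
  | succ k ih =>
    have key : ∀ u : ℤ, 0 ≤ u ∧ u < (2 * q) ^ (k + 1) →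
        0 ≤ u / (2 * q) ∧ u / (2 * q) < (2 * q) ^ k := fun u hu =>
      ⟨Int.ediv_nonneg hu.1 (by omega), Int.ediv_lt_of_lt_mul (by omega) (by rw [← pow_succ]; exact hu.2)⟩
    have e1 := color_pattern_inj hq k _ _ hxz
    have e2 := color_pattern_inj hq k _ _ hyz
    have e1' := color_pattern_inj hq (k + 1) _ _ hxz
    have e2' := color_pattern_inj hq (k + 1) _ _ hyz
    simp only [colorStep] at e1 e2
    obtain ⟨-, ax, bx, cx⟩ := half_digit hq x.1
    obtain ⟨-, ay, bY, cy⟩ := half_digit hq y.1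
    obtain ⟨-, az, bz, cz⟩ := half_digit hq z.1
    -- The patterns agree both before and after this step, hence so do the appended bits.
    have hbx : x.1 % (2 * q) / q = z.1 % (2 * q) / q := by linarith
    have hby : y.1 % (2 * q) / q = z.1 % (2 * q) / q := by linarith
    rw [hbx] at cx
    rw [hby] at cy
    have hlin : 2 * q * (x.1 / (2 * q) + y.1 / (2 * q) - 2 * (z.1 / (2 * q))) =
        2 * (z.1 % (2 * q) % q) - x.1 % (2 * q) % q - y.1 % (2 * q) % q := by linarith
    -- No carry: the right-hand side of `hlin` is built from remainders in `[0, q)` and lies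
    -- strictly between `-2 q` and `2 q`, so as a multiple of `2 q` it vanishes.
    have hzero : x.1 / (2 * q) + y.1 / (2 * q) - 2 * (z.1 / (2 * q)) = 0 := by
      by_contra hne
      rcases lt_or_gt_of_ne hne with h | h
      · nlinarith
      · nlinarith
    rw [hzero, mul_zero] at hlin
    have hd : x.1 % (2 * q) % q + y.1 % (2 * q) % q = 2 * (z.1 % (2 * q) % q) := by linarith
    have hsq : (x.1 % (2 * q) % q) ^ 2 + (y.1 % (2 * q) % q) ^ 2 - 2 * (z.1 % (2 * q) % q) ^ 2 =
        2 * (x.1 % (2 * q) % q - z.1 % (2 * q) % q) ^ 2 := by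
      rw [show y.1 % (2 * q) % q = 2 * (z.1 % (2 * q) % q) - x.1 % (2 * q) % q by linarith]; ring
    obtain ⟨i1, i2⟩ := ih (colorStep q x) (colorStep q y) (colorStep q z) (key _ hx) (key _ hy)
      (key _ hz) (by simp only [colorStep]; linarith) hxz hyz
      (by simp only [colorStep]; nlinarith [sq_nonneg (x.1 % (2 * q) % q - z.1 % (2 * q) % q)]) hr'
    simp only [colorStep] at i1 i2
    -- The excess was nonnegative before the step, grew by twice this square, and is zero afterwards
    -- by induction.
    have hsq0 : (x.1 % (2 * q) % q - z.1 % (2 * q) % q) ^ 2 = 0 :=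
      le_antisymm (by linarith) (sq_nonneg _)
    have hxz0 : x.1 % (2 * q) % q = z.1 % (2 * q) % q := by
      have := pow_eq_zero_iff (two_ne_zero) |>.mp hsq0
      linarith
    exact ⟨by rw [cx, cy, i1]; linarith, by rw [hsq0] at hsq; linarith⟩

theorem color_bounds (hq : 0 < q) (k : ℕ) {y : ℤ} (hy : 0 ≤ y) :
    0 ≤ ((colorStep q)^[k] (y, 0, 0)).1 ∧ ((colorStep q)^[k] (y, 0, 0)).1 ≤ y ∧
    0 ≤ ((colorStep q)^[k] (y, 0, 0)).2.1 ∧ ((colorStep q)^[k] (y, 0, 0)).2.1 < 2 ^ k ∧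
    0 ≤ ((colorStep q)^[k] (y, 0, 0)).2.2 ∧
      ((colorStep q)^[k] (y, 0, 0)).2.2 ≤ k * (q - 1) ^ 2 := by
  induction k with
  | zero => simpa using hy
  | succ k ih =>
    rw [Function.iterate_succ_apply']
    set z := (colorStep q)^[k] (y, 0, 0)
    obtain ⟨h1, h2, h3, h4, h5, h6⟩ := ih
    obtain ⟨a1, a2, a3, -⟩ := half_digit hq z.1
    have hp : (2 : ℤ) ^ (k + 1) = 2 * 2 ^ k := by ring
    have hs : (z.1 % (2 * q) % q) ^ 2 ≤ (q - 1) ^ 2 := pow_le_pow_left₀ a2 (by omega) 2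
    have hd : z.1 / (2 * q) ≤ z.1 := Int.ediv_le_self _ h1
    refine ⟨Int.ediv_nonneg h1 (by omega), hd.trans h2, ?_, ?_, ?_, ?_⟩ <;> simp only [colorStep]
    · omega
    · omega
    · positivity
    · push_cast; linarith

end Color

/-- The colour of an integer `x ≥ -n ^ 3`. -/
def color (n b q : ℕ) (x : ℤ) : ℤ :=
  ((colorStep q)^[b] (x + (n : ℤ) ^ 3, 0, 0)).2.1 +
    q * ((colorStep q)^[b] (x + (n : ℤ) ^ 3, 0, 0)).2.2

/-- The least number of bits `b` with `2 n ^ 3 < 2 ^ (b ^ 2)`. -/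
def bits (n : ℕ) : ℕ := Nat.find (p := fun b => 2 * n ^ 3 < 2 ^ (b * b))
  ⟨2 * n ^ 3, Nat.lt_two_pow_self.trans_le (Nat.pow_le_pow_right two_pos (Nat.le_mul_self _))⟩

theorem lt_two_pow_bits (n : ℕ) : 2 * n ^ 3 < 2 ^ (bits n * bits n) :=
  Nat.find_spec (p := fun b => 2 * n ^ 3 < 2 ^ (b * b)) _

theorem two_pow_le_of_lt_bits {n i : ℕ} (h : i < bits n) : 2 ^ (i * i) ≤ 2 * n ^ 3 :=
  not_lt.mp (Nat.find_min (p := fun b => 2 * n ^ 3 < 2 ^ (b * b)) _ h)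

/-- A crude polynomial bound that suffices against overflow; the true, subpolynomial growth is in
`exists_two_pow_bits_le`. -/
theorem two_pow_bits_le (n : ℕ) : 2 ^ bits n ≤ 4 * n ^ 3 + 1 := by
  rcases Nat.eq_zero_or_pos (bits n) with h | h
  · simp [h]
  · obtain ⟨c, hc⟩ : ∃ c, bits n = c + 1 := ⟨bits n - 1, by omega⟩
    have h1 := two_pow_le_of_lt_bits (n := n) (i := c) (by omega)
    have h2 : 2 ^ (c + 1) ≤ 2 * 2 ^ (c * c) := by
      rw [← pow_succ']
      exact Nat.pow_le_pow_right two_pos (by nlinarith [Nat.le_mul_self c])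
    rw [hc]; omega

/-- The pattern is below `q = 2 ^ b`, and the sum of squares is at most `b (q - 1) ^ 2 < q ^ 3`
because `b < q`. -/
theorem color_mem (n : ℕ) {x : ℤ} (hx : |x| ≤ (n : ℤ) ^ 3) :
    0 ≤ color n (bits n) (2 ^ bits n) x ∧
      color n (bits n) (2 ^ bits n) x < ((2 ^ bits n) ^ 4 : ℕ) := by
  set b := bits n
  have hq : (0 : ℤ) < ((2 ^ b : ℕ) : ℤ) := by positivity
  obtain ⟨-, -, h3, h4, h5, h6⟩ := color_bounds hq b (y := x + (n : ℤ) ^ 3)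
    (by have := abs_le.mp hx; linarith)
  have hbq : (b : ℤ) + 1 ≤ (2 ^ b : ℕ) := by
    exact_mod_cast Nat.succ_le_of_lt Nat.lt_two_pow_self
  have h4' : ((colorStep (2 ^ b : ℕ))^[b] (x + (n : ℤ) ^ 3, 0, 0)).2.1 < ((2 ^ b : ℕ) : ℤ) := by
    exact_mod_cast h4
  unfold color
  push_cast at *
  generalize ((2 : ℤ) ^ b) = q at *
  refine ⟨by positivity, ?_⟩
  have : ((colorStep q)^[b] (x + (n : ℤ) ^ 3, 0, 0)).2.2 + 1 ≤ q ^ 3 := by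
    have hb0 : (0 : ℤ) ≤ b := by positivity
    nlinarith [mul_le_mul_of_nonneg_right hbq (sq_nonneg (q - 1))]
  nlinarith

/-- Shifting by `n ^ 3` preserves progressions and makes the numbers nonnegative; `b` digits in base
`2 q` then exhaust them, since `(2 q) ^ b ≥ 2 ^ (b * b) > 2 n ^ 3`. -/
theorem color_no_progression (n : ℕ) {x y z : ℤ} (hx : |x| ≤ (n : ℤ) ^ 3) (hy : |y| ≤ (n : ℤ) ^ 3)
    (hz : |z| ≤ (n : ℤ) ^ 3)
    (hxz : color n (bits n) (2 ^ bits n) x = color n (bits n) (2 ^ bits n) z)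
    (hyz : color n (bits n) (2 ^ bits n) y = color n (bits n) (2 ^ bits n) z)
    (h : x + y = 2 * z) : x = y := by
  set b := bits n with hb
  have hq : (0 : ℤ) < ((2 ^ b : ℕ) : ℤ) := by positivity
  have hrange : ∀ u : ℤ, |u| ≤ (n : ℤ) ^ 3 →
      0 ≤ u + (n : ℤ) ^ 3 ∧ u + (n : ℤ) ^ 3 < (2 * ((2 ^ b : ℕ) : ℤ)) ^ b := by
    intro u hu
    have hu' := abs_le.mp hu
    refine ⟨by linarith, ?_⟩
    have h1 : (2 * (n : ℤ) ^ 3) < 2 ^ (b * b) := by exact_mod_cast lt_two_pow_bits n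
    have h2 : (2 : ℤ) ^ (b * b) ≤ (2 * ((2 ^ b : ℕ) : ℤ)) ^ b := by
      rw [pow_mul]
      exact pow_le_pow_left₀ (by positivity) (by push_cast; linarith [show (0 : ℤ) < 2 ^ b by positivity]) b
    linarith
  have hsplit : ∀ u v : ℤ, |u| ≤ (n : ℤ) ^ 3 → |v| ≤ (n : ℤ) ^ 3 →
      color n b (2 ^ b) u = color n b (2 ^ b) v →
      ((colorStep (2 ^ b : ℕ))^[b] (u + (n : ℤ) ^ 3, 0, 0)).2.1 =
        ((colorStep (2 ^ b : ℕ))^[b] (v + (n : ℤ) ^ 3, 0, 0)).2.1 ∧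
      ((colorStep (2 ^ b : ℕ))^[b] (u + (n : ℤ) ^ 3, 0, 0)).2.2 =
        ((colorStep (2 ^ b : ℕ))^[b] (v + (n : ℤ) ^ 3, 0, 0)).2.2 := by
    intro u v hu hv huv
    obtain ⟨-, -, a3, a4, -, -⟩ := color_bounds hq b (hrange u hu).1
    obtain ⟨-, -, b3, b4, -, -⟩ := color_bounds hq b (hrange v hv).1
    have a4' : ((colorStep (2 ^ b : ℕ))^[b] (u + (n : ℤ) ^ 3, 0, 0)).2.1 < ((2 ^ b : ℕ) : ℤ) := by
      exact_mod_cast a4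
    have b4' : ((colorStep (2 ^ b : ℕ))^[b] (v + (n : ℤ) ^ 3, 0, 0)).2.1 < ((2 ^ b : ℕ) : ℤ) := by
      exact_mod_cast b4
    unfold color at huv
    -- Patterns lie in `[0, q)`, so different square sums would move the colour by more than the
    -- patterns can compensate.
    have e1 : ((colorStep (2 ^ b : ℕ))^[b] (u + (n : ℤ) ^ 3, 0, 0)).2.2 =
        ((colorStep (2 ^ b : ℕ))^[b] (v + (n : ℤ) ^ 3, 0, 0)).2.2 := by
      generalize ((2 ^ b : ℕ) : ℤ) = q at *
      by_contra hne
      rcases lt_or_gt_of_ne hne with h | h <;> nlinarith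
    rw [e1] at huv
    exact ⟨by linarith, e1⟩
  obtain ⟨p1, r1⟩ := hsplit x z hx hz hxz
  obtain ⟨p2, r2⟩ := hsplit y z hy hz hyz
  have := (color_progression hq b (x + (n : ℤ) ^ 3, 0, 0) (y + (n : ℤ) ^ 3, 0, 0)
    (z + (n : ℤ) ^ 3, 0, 0) (hrange x hx) (hrange y hy) (hrange z hz) (by simp only; linarith) p1 p2
    (by simp) (by rw [r1, r2]; ring)).1
  simpa using this

/-! ### A sparse set without arithmetic progressions -/

/-- The binary digits of `i`, read in base `3`. -/
def ternary (i : ℕ) : ℕ := if h : i = 0 then 0 else 3 * ternary (i / 2) + i % 2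
decreasing_by exact Nat.div_lt_self (Nat.pos_of_ne_zero h) one_lt_two

theorem ternary_eq (i : ℕ) : ternary i = 3 * ternary (i / 2) + i % 2 := by
  rcases eq_or_ne i 0 with rfl | h
  · simp [ternary]
  · rw [ternary, dif_neg h]

theorem ternary_zero : ternary 0 = 0 := by simp [ternary]

/-- With base-3 digits `0` and `1` neither side of the equation has a carry, and `a + b = 2 c` with
`a, b, c ∈ {0, 1}` forces `a = b = c`. -/
theorem ternary_no_progression (i j k : ℕ) (h : ternary i + ternary j = 2 * ternary k) :
    i = k ∧ j = k := by
  induction hm : i + j + k using Nat.strong_induction_on generalizing i j k with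
  | _ m ih =>
    have hi := ternary_eq i
    have hj := ternary_eq j
    have hk := ternary_eq k
    by_cases h0 : i + j + k = 0
    · omega
    · have := ih (i / 2 + j / 2 + k / 2) (by omega) (i / 2) (j / 2) (k / 2) (by omega) rfl
      omega

theorem ternary_injective : Function.Injective ternary := fun i j h =>
  (ternary_no_progression i j j (by omega)).1

/-- Halving the argument costs a factor `3` here and `4` in the square. Quadratic growth keeps the
padding inside the cubic universe. -/
theorem ternary_le (i : ℕ) : ternary i ≤ i ^ 2 := by
  induction i using Nat.strong_induction_on with
  | _ i ih =>
    rcases eq_or_ne i 0 with rfl | h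
    · simp [ternary]
    · have h1 := ih (i / 2) (by omega)
      rw [ternary_eq]
      obtain ⟨a, c, ha, hc, rfl⟩ : ∃ a c, i / 2 = a ∧ c < 2 ∧ i = 2 * a + c :=
        ⟨i / 2, i % 2, rfl, by omega, by omega⟩
      rw [ha] at h1 ⊢
      rw [show (2 * a + c) % 2 = c by omega]
      nlinarith

/-! ### Separating integers by residues -/

/-- Every prime power exactly dividing the central binomial coefficient is at most `2 m`, hence is
one of the `p` that divide `Z`. -/
theorem centralBinom_dvd_of_forall_dvd {m Z : ℕ} (hZ : Z ≠ 0)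
    (h : ∀ p, 1 ≤ p → p ≤ 2 * m → p ∣ Z) : m.centralBinom ∣ Z := by
  rw [← Nat.factorization_le_iff_dvd (Nat.centralBinom_ne_zero m) hZ]
  intro p
  by_cases hp : p.Prime
  · rcases Nat.eq_zero_or_pos m with rfl | hm
    · simp
    · have h1 : p ^ (m.centralBinom.factorization p) ≤ 2 * m := by
        rw [Nat.centralBinom_eq_two_mul_choose]
        exact Nat.pow_factorization_choose_le (by omega)
      exact (hp.pow_dvd_iff_le_factorization hZ).mp (h _ (Nat.pow_pos hp.pos) h1)
  · simp [Nat.factorization_eq_zero_of_not_prime _ hp]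

theorem two_pow_le_centralBinom (m : ℕ) : 2 ^ m ≤ m.centralBinom := by
  induction m with
  | zero => simp
  | succ m ih =>
    have h := Nat.succ_mul_centralBinom_succ m
    have h2 : (m + 1) * (2 * m.centralBinom) ≤ (m + 1) * (m + 1).centralBinom := by
      rw [h]; nlinarith [Nat.centralBinom_pos m]
    have := Nat.le_of_mul_le_mul_left h2 (Nat.succ_pos m)
    rw [pow_succ]; omega

/-- Let `Z` be the product of the three differences, so `0 < |Z| ≤ 2 ^ (3 b ^ 2)`. If every `p ≤ 2
m` divided `Z`, so would the central binomial coefficient of `m`, which is at least `2 ^ m`; this is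
absurd for `m = 16 q ^ 4 > 3 b ^ 2`. A `p` not dividing `Z` separates. -/
theorem exists_separating_modulus (n : ℕ) {x : Fin 3 → ℤ} (hx : Function.Injective x)
    (hb : ∀ i, |x i| ≤ (n : ℤ) ^ 3) :
    ∃ p : ℕ, 0 < p ∧ p < 64 * (2 ^ bits n) ^ 4 ∧ Function.Injective fun i => x i % (p : ℤ) := by
  set b := bits n
  set Z : ℤ := (x 0 - x 1) * (x 0 - x 2) * (x 1 - x 2) with hZ
  have hne : ∀ i j, i ≠ j → x i - x j ≠ 0 := fun i j hij => sub_ne_zero.mpr (hx.ne hij)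
  have hZ0 : Z ≠ 0 := mul_ne_zero (mul_ne_zero (hne _ _ (by decide)) (hne _ _ (by decide)))
    (hne _ _ (by decide))
  have hd : ∀ i j, |x i - x j| ≤ 2 ^ (b * b) := by
    intro i j
    have h1 : (2 * (n : ℤ) ^ 3) < 2 ^ (b * b) := by exact_mod_cast lt_two_pow_bits n
    have := abs_sub (x i) (x j)
    linarith [hb i, hb j]
  have hZle : |Z| ≤ 2 ^ (3 * (b * b)) := by
    rw [hZ, abs_mul, abs_mul, show 3 * (b * b) = b * b + b * b + b * b by ring, pow_add, pow_add]
    exact mul_le_mul (mul_le_mul (hd _ _) (hd _ _) (abs_nonneg _) (by positivity)) (hd _ _)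
      (abs_nonneg _) (by positivity)
  have hbq : b + 1 ≤ 2 ^ b := Nat.succ_le_of_lt Nat.lt_two_pow_self
  set m := 16 * (2 ^ b) ^ 4 with hm
  have hm3 : 3 * (b * b) < m := by
    have h1 : (b + 1) ^ 4 ≤ (2 ^ b) ^ 4 := Nat.pow_le_pow_left hbq 4
    have h2 : (b + 1) ^ 2 ≤ (b + 1) ^ 4 := Nat.pow_le_pow_right (by omega) (by omega)
    nlinarith
  obtain ⟨p, hp1, hp2, hp⟩ : ∃ p, 1 ≤ p ∧ p ≤ 2 * m ∧ ¬ p ∣ Z.natAbs := by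
    by_contra! hcon
    have h1 := Nat.le_of_dvd (Int.natAbs_pos.mpr hZ0)
      (centralBinom_dvd_of_forall_dvd (Int.natAbs_ne_zero.mpr hZ0) hcon)
    have h2 : Z.natAbs ≤ 2 ^ (3 * (b * b)) := by
      rw [Int.abs_eq_natAbs] at hZle; exact_mod_cast hZle
    have h3 := Nat.pow_lt_pow_right (a := 2) (by omega) hm3
    have h4 := two_pow_le_centralBinom m
    omega
  refine ⟨p, hp1, ?_, ?_⟩
  · have : 0 < (2 ^ b) ^ 4 := by positivity
    omega
  · have hdvd : ∀ i j, x i % (p : ℤ) = x j % (p : ℤ) → (p : ℤ) ∣ x i - x j := fun i j h =>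
      Int.dvd_of_emod_eq_zero (Int.emod_eq_emod_iff_emod_sub_eq_zero.mp h)
    have hnd : ¬ (p : ℤ) ∣ Z := fun h => hp (Int.natCast_dvd.mp h)
    have h01 : x 0 % (p : ℤ) ≠ x 1 % (p : ℤ) := fun h => hnd (((hdvd _ _ h).mul_right _).mul_right _)
    have h02 : x 0 % (p : ℤ) ≠ x 2 % (p : ℤ) := fun h => hnd (((hdvd _ _ h).mul_left _).mul_right _)
    have h12 : x 1 % (p : ℤ) ≠ x 2 % (p : ℤ) := fun h => hnd ((hdvd _ _ h).mul_left _)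
    intro i j hij
    fin_cases i <;> fin_cases j <;> simp_all

/-! ### Digits -/

/-- The digit number `e` of `t` in base `K`. -/
def digit (K : ℕ) : ℕ → ℕ → ℕ
  | 0, t => t % K
  | e + 1, t => digit K e (t / K)

theorem exists_digits {K : ℕ} (d : ℕ → ℕ) (hd : ∀ e, d e < K) (k : ℕ) :
    ∃ t < K ^ k, ∀ e < k, digit K e t = d e := by
  induction k generalizing d with
  | zero => exact ⟨0, by simp, by simp⟩
  | succ k ih =>
    obtain ⟨t, ht, h⟩ := ih (fun e => d (e + 1)) fun e => hd _
    have hK : 0 < K := (Nat.zero_le _).trans_lt (hd 0)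
    refine ⟨d 0 + K * t, ?_, ?_⟩
    · have := hd 0
      rw [pow_succ]; nlinarith
    · rintro (_ | e) he
      · simp [digit, Nat.mod_eq_of_lt (hd 0)]
      · simp only [digit]
        rw [Nat.add_mul_div_left _ _ hK, Nat.div_eq_of_lt (hd 0), zero_add]
        exact h e (by omega)

/-! ### Operator notation and evaluation rules for expressions -/

namespace Expr

instance : Add Expr := ⟨bin .add⟩
instance : Sub Expr := ⟨bin .sub⟩
instance : Mul Expr := ⟨bin .mul⟩
instance : Div Expr := ⟨bin .div⟩
instance : Mod Expr := ⟨bin .mod⟩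

section

variable (D R : ℕ) (ρ : ℕ → ℤ) (a b : Expr)

@[simp] theorem eval_const (c : ℤ) : (const c).eval ρ = c := rfl
@[simp] theorem eval_var (r : ℕ) : (var r).eval ρ = ρ r := rfl
@[simp] theorem eval_add : (a + b).eval ρ = a.eval ρ + b.eval ρ := rfl
@[simp] theorem eval_sub : (a - b).eval ρ = a.eval ρ - b.eval ρ := rfl
@[simp] theorem eval_mul : (a * b).eval ρ = a.eval ρ * b.eval ρ := rfl
@[simp] theorem eval_div : (a / b).eval ρ = a.eval ρ / b.eval ρ := rfl
@[simp] theorem eval_mod : (a % b).eval ρ = a.eval ρ % b.eval ρ := rfl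
@[simp] theorem eval_lt : (bin .lt a b).eval ρ = if a.eval ρ < b.eval ρ then 1 else 0 := rfl
@[simp] theorem eval_eq : (bin .eq a b).eval ρ = if a.eval ρ = b.eval ρ then 1 else 0 := rfl

@[simp] theorem deg_const (c : ℤ) : (const c).deg D = c.natAbs := rfl
@[simp] theorem deg_var (r : ℕ) : (var r).deg D = D := rfl
@[simp] theorem deg_add : (a + b).deg D = max (a.deg D) (b.deg D) + 1 := rfl
@[simp] theorem deg_sub : (a - b).deg D = max (a.deg D) (b.deg D) + 1 := rfl
@[simp] theorem deg_mul : (a * b).deg D = a.deg D + b.deg D := rfl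
@[simp] theorem deg_div : (a / b).deg D = max (a.deg D) (b.deg D) := rfl
@[simp] theorem deg_mod : (a % b).deg D = max (a.deg D) (b.deg D) := rfl
@[simp] theorem deg_lt : (bin .lt a b).deg D = max (a.deg D) (b.deg D) := rfl
@[simp] theorem deg_eq : (bin .eq a b).deg D = max (a.deg D) (b.deg D) := rfl

@[simp] theorem varsBelow_const (c : ℤ) : (const c).VarsBelow R = true := rfl
@[simp] theorem varsBelow_var (r : ℕ) : (var r).VarsBelow R = decide (r < R) := rfl
@[simp] theorem varsBelow_bin (o : BinOp) :
    (bin o a b).VarsBelow R = (a.VarsBelow R && b.VarsBelow R) := rfl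
@[simp] theorem varsBelow_add : (a + b).VarsBelow R = (a.VarsBelow R && b.VarsBelow R) := rfl
@[simp] theorem varsBelow_sub : (a - b).VarsBelow R = (a.VarsBelow R && b.VarsBelow R) := rfl
@[simp] theorem varsBelow_mul : (a * b).VarsBelow R = (a.VarsBelow R && b.VarsBelow R) := rfl
@[simp] theorem varsBelow_div : (a / b).VarsBelow R = (a.VarsBelow R && b.VarsBelow R) := rfl
@[simp] theorem varsBelow_mod : (a % b).VarsBelow R = (a.VarsBelow R && b.VarsBelow R) := rfl

@[simp] theorem cost_const (c : ℤ) : (const c).cost = 1 := rfl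
@[simp] theorem cost_var (r : ℕ) : (var r).cost = 2 := rfl
@[simp] theorem cost_bin (o : BinOp) : (bin o a b).cost = a.cost + (b.cost + 1) := rfl
@[simp] theorem cost_add : (a + b).cost = a.cost + (b.cost + 1) := rfl
@[simp] theorem cost_sub : (a - b).cost = a.cost + (b.cost + 1) := rfl
@[simp] theorem cost_mul : (a * b).cost = a.cost + (b.cost + 1) := rfl
@[simp] theorem cost_div : (a / b).cost = a.cost + (b.cost + 1) := rfl
@[simp] theorem cost_mod : (a % b).cost = a.cost + (b.cost + 1) := rfl

end

end Expr

open FineGrained.Expr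

/-! ### The common program of the reductions

Variables: `0` is `n`, `1` is `bits n`, `2` is `q = 2 ^ bits n`, `3` a power of two, `4` the number
of the query, `5` an index, `6` an input element, `7` a counter, `8, 9, 10` the state of the
colouring, `11` the answer so far, `12` the last answer of the oracle, `13` is `K = 64 q ^ 4`, `14`
the number `K ^ 7` of queries, `15` an entry of the table of `ternary`. The input occupies at most
`3 n` cells; the table follows, with `48 n + 1` entries, and then the query. -/

/-- Compute `bits n` and the quantities that depend on it. -/
def setup : Prog :=
  .seq (assign 2 (const 1)) <| .seq (assign 3 (const 1)) <|
  .seq (while_ (const 1 - bin .lt (const 2 * (var 0 * (var 0 * var 0))) (var 3))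
    (.seq (assign 3 (const 2 * (var 3 * (var 2 * var 2)))) <|
      .seq (assign 2 (const 2 * var 2)) (assign 1 (var 1 + const 1)))) <|
  .seq (assign 13 (const 64 * (var 2 * (var 2 * (var 2 * var 2)))))
    (assign 14 (var 13 * (var 13 * (var 13 * (var 13 * (var 13 * (var 13 * var 13)))))))

/-- Fill the table of `ternary`. -/
def fillTable : Prog :=
  while_ (bin .lt (var 5) (const 48 * var 0))
    (.seq (fetch 15 (const 3 * var 0 + (var 5 + const 1) / const 2)) <|
      .seq (put (const 3 * var 0 + (var 5 + const 1))
        (const 3 * var 15 + (var 5 + const 1) % const 2))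
        (assign 5 (var 5 + const 1)))

/-- Compute the colour of the element in register `6`. -/
def computeColor : Prog :=
  .seq (assign 7 (var 1)) <| .seq (assign 8 (var 6 + var 0 * (var 0 * var 0))) <|
  .seq (assign 9 (const 0)) <| .seq (assign 10 (const 0)) <|
  while_ (var 7)
    (.seq (assign 10 (var 10 + (var 8 % (const 2 * var 2) % var 2) *
        (var 8 % (const 2 * var 2) % var 2))) <|
      .seq (assign 9 (const 2 * var 9 + var 8 % (const 2 * var 2) / var 2)) <|
      .seq (assign 8 (var 8 / (const 2 * var 2))) (assign 7 (var 7 - const 1)))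

/-- Compute one entry of a query. -/
def writeEntry (src : ℕ) (E : Expr) : Prog :=
  .seq (fetch 6 (var 5 % (const src * var 0))) <|
  .seq (fetch 15 (const 3 * var 0 + var 5)) <|
  .seq computeColor <|
  .seq (put (const 51 * var 0 + (const 1 + var 5)) E) (assign 5 (var 5 + const 1))

/-- Write and ask one query. -/
def oneQuery (src tgt : ℕ) (E : Expr) : Prog :=
  .seq (assign 5 (const 0)) <|
  .seq (while_ (bin .lt (var 5) (const tgt * var 0)) (writeEntry src E)) <|
  .seq (ask 12 (const 51 * var 0 + const 1) (const 16 * var 0)) <|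
  .seq (assign 11 (bin .lt (const 0) (var 11 + var 12))) (assign 4 (var 4 + const 1))

/-- Ask `K ^ 7` queries of `tgt * n` words each, where `E` computes the entries, and accept if one
of the answers is positive. -/
def manyQueries (src tgt : ℕ) (E : Expr) : Prog :=
  .seq setup <| .seq fillTable <|
  .seq (while_ (bin .lt (var 4) (var 14)) (oneQuery src tgt E)) (assign 0 (var 11))

/-- The base of the digits of the query numbers. -/
def base (n : ℕ) : ℕ := 64 * (2 ^ bits n) ^ 4

/-- The values of the constant registers, and a bound for all variables. -/
structure Regs (U n : ℕ) (ρ : ℕ → ℤ) : Prop where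
  bounded : Bounded U 200 ρ
  r0 : ρ 0 = n
  r1 : ρ 1 = bits n
  r2 : ρ 2 = ((2 ^ bits n : ℕ) : ℤ)
  r13 : ρ 13 = base n
  r14 : ρ 14 = ((base n ^ 7 : ℕ) : ℤ)

theorem Regs.update {U n : ℕ} {ρ : ℕ → ℤ} (h : Regs U n ρ) {v : ℕ} {x : ℤ}
    (hv : v ≠ 0 ∧ v ≠ 1 ∧ v ≠ 2 ∧ v ≠ 13 ∧ v ≠ 14) (hx : |x| ≤ (U : ℤ) ^ 200) :
    Regs U n (Function.update ρ v x) := by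
  obtain ⟨h0, h1, h2, h3, h4⟩ := hv
  refine ⟨h.bounded.update hx, ?_, ?_, ?_, ?_, ?_⟩
  · rw [Function.update_of_ne h0.symm, h.r0]
  · rw [Function.update_of_ne h1.symm, h.r1]
  · rw [Function.update_of_ne h2.symm, h.r2]
  · rw [Function.update_of_ne h3.symm, h.r13]
  · rw [Function.update_of_ne h4.symm, h.r14]

/-! ### Size bounds, and the computation of the parameters -/

section Template

variable {B : Problem} {w U n : ℕ}

theorem safe_of_deg (hU : 2 ≤ U) (hw : U ^ 3000 ≤ 2 ^ w) {e : Expr} (h1 : e.VarsBelow 16 = true)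
    (h2 : e.deg 200 < 3000) : e.Safe U 200 w :=
  ⟨h1, (Nat.pow_lt_pow_right (by omega) h2).trans_le hw⟩

theorem abs_le_pow {x : ℤ} {d : ℕ} (hU : 2 ≤ U) (hd : d ≤ 200) (h0 : 0 ≤ x)
    (h : x ≤ ((U ^ d : ℕ) : ℤ)) : |x| ≤ (U : ℤ) ^ 200 := by
  rw [abs_of_nonneg h0]
  refine h.trans ?_
  push_cast
  exact pow_le_pow_right₀ (by exact_mod_cast (by omega : 1 ≤ U)) hd

/-- The exponents of `q`, `K` and `K ^ 7` are `5`, `6 + 4 * 5 = 26` and `7 * 26 = 182`; the last one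
dictates the bound `U ^ 200` on variables. -/
theorem two_pow_bits_le_pow (hU : 2 ≤ U) (hn : n < U) : 2 ^ bits n ≤ U ^ 5 := by
  have h1 := two_pow_bits_le n
  have h2 : (n + 1) ^ 3 ≤ U ^ 3 := Nat.pow_le_pow_left hn 3
  have h3 : 2 ^ 2 ≤ U ^ 2 := Nat.pow_le_pow_left hU 2
  calc 2 ^ bits n ≤ 4 * n ^ 3 + 1 := h1
    _ ≤ 2 ^ 2 * (n + 1) ^ 3 := by ring_nf; nlinarith
    _ ≤ U ^ 2 * U ^ 3 := Nat.mul_le_mul h3 h2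
    _ = U ^ 5 := by ring

theorem base_le_pow (hU : 2 ≤ U) (hn : n < U) : base n ≤ U ^ 26 := by
  have h1 := Nat.pow_le_pow_left (two_pow_bits_le_pow hU hn) 4
  have h2 : 2 ^ 6 ≤ U ^ 6 := Nat.pow_le_pow_left hU 6
  calc base n = 2 ^ 6 * (2 ^ bits n) ^ 4 := rfl
    _ ≤ U ^ 6 * (U ^ 5) ^ 4 := Nat.mul_le_mul h2 h1
    _ = U ^ 26 := by ring

theorem base_pow_le_pow (hU : 2 ≤ U) (hn : n < U) : base n ^ 7 ≤ U ^ 182 :=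
  (Nat.pow_le_pow_left (base_le_pow hU hn) 7).trans_eq (by ring)

/-- After `i` rounds registers `2` and `3` hold `2 ^ i` and `2 ^ (i * i)`; the update rests on `(i +
1) ^ 2 = i ^ 2 + 2 i + 1`, and the loop stops exactly at `bits n`. -/
theorem wp_setup (hU : 2 ≤ U) (hn : n < U) (hw : U ^ 3000 ≤ 2 ^ w) {ρ μ : ℕ → ℤ}
    (h0 : ρ 0 = n) (hz : ∀ r, r ≠ 0 → ρ r = 0) {Q : (ℕ → ℤ) → (ℕ → ℤ) → Prop}
    (hQ : ∀ ρ', Regs U n ρ' → ρ' 4 = 0 → ρ' 5 = 0 → ρ' 11 = 0 → Q ρ' μ) :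
    WP B w setup (1000 * (bits n + 1)) [] Q ρ μ := by
  have hU1 : 1 ≤ U := by omega
  have hn1 : n ≤ U ^ 1 := by simpa using hn.le
  have hq := two_pow_bits_le_pow hU hn
  have hbq : bits n ≤ 2 ^ bits n := Nat.lt_two_pow_self.le
  have hb0 : Bounded U 200 ρ := by
    intro r hr
    rcases eq_or_ne r 0 with rfl | h
    · rw [h0]; exact abs_le_pow hU (d := 1) (by norm_num) (by positivity) (by exact_mod_cast hn1)
    · rw [hz r h]; simp
  have h1b : |(1 : ℤ)| ≤ (U : ℤ) ^ 200 :=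
    abs_le_pow hU (d := 0) (by norm_num) (by norm_num) (by simp)
  have hb1 := (hb0.update (v := 2) h1b).update (v := 3) h1b
  refine WP.then (WP.assign hU (safe_of_deg hU hw (by decide) (by decide)) hb0 (by norm_num) ?_)
    (by simp; omega)
  refine WP.then (WP.assign hU (safe_of_deg hU hw (by decide) (by decide))
    (hb0.update (v := 2) h1b) (by norm_num) ?_) (by simp; omega)
  refine WP.then (τ' := 100 * (bits n + 1)) (WP.mono (WP.while_ (τ := 50) (q := []) hU
    (safe_of_deg hU hw (by decide) (by decide))
    (fun i ρ' μ' => i ≤ bits n ∧ Bounded U 200 ρ' ∧ ρ' 0 = n ∧ ρ' 1 = i ∧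
      ρ' 2 = ((2 ^ i : ℕ) : ℤ) ∧ ρ' 3 = ((2 ^ (i * i) : ℕ) : ℤ) ∧ ρ' 4 = 0 ∧ ρ' 5 = 0 ∧
      ρ' 11 = 0 ∧ μ' = μ) (bits n) (fun i ρ' μ' h => h.2.1) ?_ ?_ ?_ ?_) ?_ (by simp) ?_) ?_
  · rintro i hi ρ' μ' ⟨-, -, e0, -, -, e3, -⟩
    have h := two_pow_le_of_lt_bits hi
    have h' : ¬ (2 * ((n : ℤ) * (n * n)) < ((2 ^ (i * i) : ℕ) : ℤ)) := by
      rw [not_lt, show 2 * ((n : ℤ) * (n * n)) = ((2 * n ^ 3 : ℕ) : ℤ) by push_cast; ring]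
      exact_mod_cast h
    simp [e0, e3] at h' ⊢
    omega
  · rintro ρ' μ' ⟨-, -, e0, -, -, e3, -⟩
    have h := lt_two_pow_bits n
    have h' : (2 * ((n : ℤ) * (n * n)) < ((2 ^ (bits n * bits n) : ℕ) : ℤ)) := by
      rw [show 2 * ((n : ℤ) * (n * n)) = ((2 * n ^ 3 : ℕ) : ℤ) by push_cast; ring]
      exact_mod_cast h
    simp only [Expr.eval_sub, Expr.eval_lt, Expr.eval_mul, Expr.eval_const, Expr.eval_var, e0, e3,
      if_pos h', sub_self]
  · rintro i hi ρ' μ' ⟨-, bd, e0, e1, e2, e3, e4, e5, e11, em⟩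
    -- Even the final value is polynomial: the previous one is at most `2 n ^ 3`, and one step
    -- multiplies it by `2 ^ (2 i + 1)`.
    have hP : 2 ^ ((i + 1) * (i + 1)) ≤ U ^ 20 := by
      have h := two_pow_le_of_lt_bits hi
      have h2 : 2 ^ (i + 1) ≤ 2 ^ bits n := Nat.pow_le_pow_right (by norm_num) hi
      have h3 : n ^ 3 ≤ U ^ 3 := Nat.pow_le_pow_left hn.le 3
      have h4 : (2 ^ (i + 1)) ^ 2 ≤ (U ^ 5) ^ 2 := Nat.pow_le_pow_left (h2.trans hq) 2
      calc 2 ^ ((i + 1) * (i + 1)) ≤ 2 ^ (i * i) * (2 ^ (i + 1)) ^ 2 := by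
            rw [← pow_mul, ← pow_add]; exact Nat.pow_le_pow_right (by norm_num) (by ring_nf; omega)
        _ ≤ (U ^ 1 * U ^ 3) * (U ^ 5) ^ 2 := Nat.mul_le_mul (h.trans
            (Nat.mul_le_mul (by simpa using hU) h3)) h4
        _ = U ^ 14 := by ring
        _ ≤ U ^ 20 := Nat.pow_le_pow_right hU1 (by norm_num)
    have v3 : (2 : ℤ) * (((2 ^ (i * i) : ℕ) : ℤ) * (((2 ^ i : ℕ) : ℤ) * ((2 ^ i : ℕ) : ℤ))) =
        ((2 ^ ((i + 1) * (i + 1)) : ℕ) : ℤ) := by push_cast; ring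
    have v2 : (2 : ℤ) * ((2 ^ i : ℕ) : ℤ) = ((2 ^ (i + 1) : ℕ) : ℤ) := by push_cast; ring
    have b3 : Bounded U 200 (Function.update ρ' 3 ((2 ^ ((i + 1) * (i + 1)) : ℕ) : ℤ)) :=
      bd.update (abs_le_pow hU (d := 20) (by norm_num) (by positivity) (by exact_mod_cast hP))
    have b2 := b3.update (v := 2) (x := ((2 ^ (i + 1) : ℕ) : ℤ))
      (abs_le_pow hU (d := 5) (by norm_num) (by positivity)
        (by exact_mod_cast (Nat.pow_le_pow_right (by norm_num) hi).trans hq))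
    have b1 := b2.update (v := 1) (x := ((i + 1 : ℕ) : ℤ))
      (abs_le_pow hU (d := 5) (by norm_num) (by positivity)
        (by exact_mod_cast (Nat.succ_le_of_lt hi).trans (hbq.trans hq)))
    refine WP.then (WP.assign hU (safe_of_deg hU hw (by decide) (by decide)) bd (by norm_num) ?_)
      (by simp)
    simp only [Expr.eval_mul, Expr.eval_const, Expr.eval_var, e2, e3, v3]
    refine WP.then (WP.assign hU (safe_of_deg hU hw (by decide) (by decide)) b3 (by norm_num) ?_)
      (by simp)
    simp only [Expr.eval_mul, Expr.eval_const, Expr.eval_var,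
      Function.update_of_ne (show (2 : ℕ) ≠ 3 by decide), e2, v2]
    refine WP.mono (WP.assign hU (safe_of_deg hU hw (by decide) (by decide)) b2 (by norm_num)
      (Q := fun ρ' μ' => i + 1 ≤ bits n ∧ Bounded U 200 ρ' ∧ ρ' 0 = n ∧ ρ' 1 = ((i + 1 : ℕ) : ℤ) ∧
      ρ' 2 = ((2 ^ (i + 1) : ℕ) : ℤ) ∧ ρ' 3 = ((2 ^ ((i + 1) * (i + 1)) : ℕ) : ℤ) ∧ ρ' 4 = 0 ∧
      ρ' 5 = 0 ∧ ρ' 11 = 0 ∧ μ' = μ) ?_) (by simp) rfl fun _ _ h => h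
    refine ⟨hi, ?_, ?_, ?_, ?_, ?_, ?_, ?_, ?_, em⟩
    · simpa [e1] using b1
    all_goals simp [e0, e1, e4, e5, e11]
  · refine ⟨Nat.zero_le _, hb1, ?_, ?_, ?_, ?_, ?_, ?_, ?_, rfl⟩ <;> simp [h0, hz]
  · simp; omega
  rotate_left
  · simp; omega
  rintro ρ' μ' ⟨-, bd, e0, e1, e2, e3, e4, e5, e11, rfl⟩
  have vK : (64 : ℤ) * (((2 ^ bits n : ℕ) : ℤ) * (((2 ^ bits n : ℕ) : ℤ) *
      (((2 ^ bits n : ℕ) : ℤ) * ((2 ^ bits n : ℕ) : ℤ)))) = base n := by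
    unfold base; push_cast; ring
  have vQ : (base n : ℤ) * (base n * (base n * (base n * (base n * (base n * base n))))) =
      ((base n ^ 7 : ℕ) : ℤ) := by push_cast; ring
  have b13 := bd.update (v := 13) (abs_le_pow hU (d := 26) (by norm_num)
    (by positivity : (0 : ℤ) ≤ base n) (by exact_mod_cast base_le_pow hU hn))
  have b14 := b13.update (v := 14) (abs_le_pow hU (d := 182) (by norm_num)
    (by positivity : (0 : ℤ) ≤ ((base n ^ 7 : ℕ) : ℤ)) (by exact_mod_cast base_pow_le_pow hU hn))
  refine WP.then (WP.assign hU (safe_of_deg hU hw (by decide) (by decide)) bd (by norm_num) ?_)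
    (by simp; omega)
  simp only [Expr.eval_mul, Expr.eval_const, Expr.eval_var, e2, vK]
  refine WP.mono (WP.assign hU (safe_of_deg hU hw (by decide) (by decide)) b13 (by norm_num)
    (Q := Q) ?_) (by simp; omega) rfl fun _ _ h => h
  simp only [Expr.eval_mul, Expr.eval_var, Function.update_self, vQ]
  refine hQ _ ⟨b14, ?_, ?_, ?_, ?_, ?_⟩ ?_ ?_ ?_ <;> simp [*]

end Template

/-! ### Filling the table and computing colours on the machine -/

section Template

variable {B : Problem} {w U n : ℕ}

theorem lt_two_pow_word (hU : 2 ≤ U) (hw : U ^ 3000 ≤ 2 ^ w) {x : ℤ}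
    (h : |x| ≤ (U : ℤ) ^ 200) : |x| < 2 ^ w := by
  refine h.trans_lt ?_
  exact_mod_cast (Nat.pow_lt_pow_right (by omega : 1 < U) (by norm_num : 200 < 3000)).trans_le hw

theorem ternary_le_pow (hU : 2 ≤ U) (hn : n < U) {j : ℕ} (hj : j ≤ 48 * n) :
    ternary j ≤ U ^ 14 := by
  have h1 : j ≤ U ^ 7 := by
    calc j ≤ 2 ^ 6 * n := by omega
      _ ≤ U ^ 6 * U := Nat.mul_le_mul (Nat.pow_le_pow_left hU 6) hn.le
      _ = U ^ 7 := by ring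
  calc ternary j ≤ j ^ 2 := ternary_le j
    _ ≤ (U ^ 7) ^ 2 := Nat.pow_le_pow_left h1 2
    _ = U ^ 14 := by ring

theorem index_le_pow (hU : 2 ≤ U) (hn : n < U) {j : ℕ} (hj : j ≤ 51 * n + 2) : j ≤ U ^ 7 := by
  have h1 : 2 ^ 6 ≤ U ^ 6 := Nat.pow_le_pow_left hU 6
  calc j ≤ 2 ^ 6 * (n + 1) := by omega
    _ ≤ U ^ 6 * U := Nat.mul_le_mul h1 hn
    _ = U ^ 7 := by ring

/-- Entry `i + 1` comes by `ternary_eq` from entry `(i + 1) / 2 ≤ i`, already present; entry `0` is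
correct because its cell initially holds `0`. -/
theorem wp_fillTable (hU : 2 ≤ U) (hn : n < U) (hw : U ^ 3000 ≤ 2 ^ w) {ρ μ : ℕ → ℤ}
    (hρ : Regs U n ρ) (h5 : ρ 5 = 0) (hμ : μ (3 * n) = 0) {Q : (ℕ → ℤ) → (ℕ → ℤ) → Prop}
    (hQ : ∀ ρ' μ', Regs U n ρ' → ρ' 4 = ρ 4 → ρ' 11 = ρ 11 → (∀ j < 3 * n, μ' j = μ j) →
      (∀ j ≤ 48 * n, μ' (3 * n + j) = (ternary j : ℤ)) → Q ρ' μ') :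
    WP B w fillTable (5000 * (n + 1)) [] Q ρ μ := by
  refine WP.mono (WP.while_ (τ := 60) (q := []) hU (safe_of_deg hU hw (by decide) (by decide))
    (fun i ρ' μ' => i ≤ 48 * n ∧ Regs U n ρ' ∧ ρ' 5 = i ∧ ρ' 4 = ρ 4 ∧ ρ' 11 = ρ 11 ∧
      (∀ j < 3 * n, μ' j = μ j) ∧ ∀ j ≤ i, μ' (3 * n + j) = (ternary j : ℤ)) (48 * n)
    (fun i ρ' μ' h => h.2.1.bounded) ?_ ?_ ?_ ?_) ?_ (by simp) ?_
  · rintro i hi ρ' μ' ⟨-, hr, e5, -⟩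
    have : (i : ℤ) < 48 * n := by exact_mod_cast hi
    simp [hr.r0, e5, this]
  · rintro ρ' μ' ⟨-, hr, e5, -⟩
    simp [hr.r0, e5]
  · rintro i hi ρ' μ' ⟨-, hr, e5, e4, e11, em, et⟩
    have hh : (i + 1) / 2 ≤ i := by omega
    have b1 : Regs U n (Function.update ρ' 15 (μ' (3 * n + (i + 1) / 2))) :=
      hr.update (by decide) (by
        rw [et _ hh]
        exact abs_le_pow hU (d := 14) (by norm_num) (by positivity)
          (by exact_mod_cast ternary_le_pow hU hn (by omega)))
    refine WP.then (WP.fetch hU (safe_of_deg hU hw (by decide) (by decide)) hr.bounded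
      (x := 3 * n + (i + 1) / 2) (by norm_num) (by simp [hr.r0, e5]) ?_ ?_) (by simp)
    · rw [et _ hh]
      exact lt_two_pow_word hU hw (abs_le_pow hU (d := 14) (by norm_num) (by positivity)
        (by exact_mod_cast ternary_le_pow hU hn (by omega)))
    refine WP.then (WP.put hU (safe_of_deg hU hw (by decide) (by decide))
      (safe_of_deg hU hw (by decide) (by decide)) b1.bounded (x := 3 * n + (i + 1))
      (by simp [hr.r0, e5]) ?_) (by simp)
    have b2 := b1.update (v := 5) (x := ((i + 1 : ℕ) : ℤ)) (by decide)
      (abs_le_pow hU (d := 7) (by norm_num) (by positivity)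
        (by exact_mod_cast index_le_pow hU hn (by omega)))
    refine WP.mono (WP.assign hU (safe_of_deg hU hw (by decide) (by decide)) b1.bounded
      (by norm_num) (Q := fun ρ' μ' => i + 1 ≤ 48 * n ∧ Regs U n ρ' ∧ ρ' 5 = ((i + 1 : ℕ) : ℤ) ∧
        ρ' 4 = ρ 4 ∧ ρ' 11 = ρ 11 ∧ (∀ j < 3 * n, μ' j = μ j) ∧
        ∀ j ≤ i + 1, μ' (3 * n + j) = (ternary j : ℤ)) ?_) (by simp) rfl fun _ _ h => h
    refine ⟨hi, ?_, ?_, ?_, ?_, ?_, ?_⟩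
    · simpa [e5] using b2
    · simp [e5]
    · simp [e4]
    · simp [e11]
    · intro j hj
      rw [Function.update_of_ne (by omega), em j hj]
    · intro j hj
      rcases Nat.lt_or_ge i j with h | h
      · obtain rfl : j = i + 1 := by omega
        rw [Function.update_self, ternary_eq (i + 1)]
        simp [e5, et _ hh]
      · rw [Function.update_of_ne (by omega), et j h]
  · refine ⟨Nat.zero_le _, hρ, by simpa using h5, rfl, rfl, fun _ _ => rfl, fun j hj => ?_⟩
    obtain rfl : j = 0 := by omega
    simp [hμ, ternary_zero]
  · simp; omega
  · rintro ρ' μ' ⟨-, hr, -, e4, e11, em, et⟩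
    exact hQ ρ' μ' hr e4 e11 em et

/-- The pattern and the square sum stay in registers `9` and `10`; their combination into the colour
is left to the expression that uses it. -/
theorem wp_computeColor (hU : 2 ≤ U) (hn : n < U) (hw : U ^ 3000 ≤ 2 ^ w) {ρ μ : ℕ → ℤ} {x : ℤ}
    (hρ : Regs U n ρ) (h6 : ρ 6 = x) (hx : |x| ≤ (n : ℤ) ^ 3) {Q : (ℕ → ℤ) → (ℕ → ℤ) → Prop}
    (hQ : ∀ ρ', Regs U n ρ' → (∀ r, r < 7 ∨ 10 < r → ρ' r = ρ r) →
      ρ' 9 + ρ' 2 * ρ' 10 = color n (bits n) (2 ^ bits n) x → Q ρ' μ) :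
    WP B w computeColor (200 * (bits n + 1)) [] Q ρ μ := by
  set b := bits n with hb
  have hq0 : (0 : ℤ) < ((2 ^ b : ℕ) : ℤ) := by positivity
  have hq := two_pow_bits_le_pow hU hn
  have hbq : b ≤ 2 ^ b := Nat.lt_two_pow_self.le
  have hy0 : 0 ≤ x + (n : ℤ) ^ 3 := by have := (abs_le.mp hx).1; linarith
  have hn3 : ((n : ℤ) ^ 3) ≤ (U : ℤ) ^ 3 := pow_le_pow_left₀ (by positivity) (by exact_mod_cast hn.le) 3
  have hyU : x + (n : ℤ) ^ 3 ≤ ((U ^ 4 : ℕ) : ℤ) := by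
    have := (abs_le.mp hx).2
    have h2 : (2 : ℤ) * (U : ℤ) ^ 3 ≤ U * (U : ℤ) ^ 3 :=
      mul_le_mul_of_nonneg_right (by exact_mod_cast hU) (by positivity)
    have h3 : ((U ^ 4 : ℕ) : ℤ) = U * (U : ℤ) ^ 3 := by push_cast; ring
    linarith
  have bnd : ∀ k ≤ b, |((colorStep (2 ^ b : ℕ))^[k] (x + (n : ℤ) ^ 3, 0, 0)).1| ≤ (U : ℤ) ^ 200 ∧
      |((colorStep (2 ^ b : ℕ))^[k] (x + (n : ℤ) ^ 3, 0, 0)).2.1| ≤ (U : ℤ) ^ 200 ∧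
      |((colorStep (2 ^ b : ℕ))^[k] (x + (n : ℤ) ^ 3, 0, 0)).2.2| ≤ (U : ℤ) ^ 200 := by
    intro k hk
    obtain ⟨c1, c2, c3, c4, c5, c6⟩ := color_bounds hq0 k hy0
    refine ⟨abs_le_pow hU (d := 4) (by norm_num) c1 (c2.trans hyU),
      abs_le_pow hU (d := 5) (by norm_num) c3 (c4.le.trans ?_),
      abs_le_pow hU (d := 15) (by norm_num) c5 (c6.trans ?_)⟩
    · exact_mod_cast (Nat.pow_le_pow_right (by norm_num) hk).trans hq
    · have h1 : ((2 ^ b : ℕ) - 1 : ℤ) ^ 2 ≤ ((2 ^ b : ℕ) : ℤ) ^ 2 :=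
        pow_le_pow_left₀ (by omega) (by omega) 2
      have h2 : (k : ℤ) ≤ ((2 ^ b : ℕ) : ℤ) := by exact_mod_cast hk.trans hbq
      have h3 : (2 ^ b) * (2 ^ b) ^ 2 ≤ U ^ 15 := by
        calc (2 ^ b) * (2 ^ b) ^ 2 ≤ U ^ 5 * (U ^ 5) ^ 2 :=
              Nat.mul_le_mul hq (Nat.pow_le_pow_left hq 2)
          _ = U ^ 15 := by ring
      calc (k : ℤ) * ((2 ^ b : ℕ) - 1 : ℤ) ^ 2 ≤ ((2 ^ b : ℕ) : ℤ) * ((2 ^ b : ℕ) : ℤ) ^ 2 :=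
            mul_le_mul h2 h1 (by positivity) (by positivity)
        _ ≤ _ := by exact_mod_cast h3
  have bcnt : ∀ k ≤ b, |(k : ℤ)| ≤ (U : ℤ) ^ 200 := fun k hk =>
    abs_le_pow hU (d := 5) (by norm_num) (by positivity) (by exact_mod_cast hk.trans (hbq.trans hq))
  have hzero : |(0 : ℤ)| ≤ (U : ℤ) ^ 200 := by simp
  have r7 := hρ.update (v := 7) (by decide) (bcnt b le_rfl)
  have r8 := r7.update (v := 8) (by decide) (bnd 0 (Nat.zero_le _)).1
  have r9 := r8.update (v := 9) (by decide) hzero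
  have r10 := r9.update (v := 10) (by decide) hzero
  refine WP.then (WP.assign hU (safe_of_deg hU hw (by decide) (by decide)) hρ.bounded
    (by norm_num) ?_) (by simp; omega)
  simp only [Expr.eval_var, hρ.r1, ← hb]
  refine WP.then (WP.assign hU (safe_of_deg hU hw (by decide) (by decide)) r7.bounded
    (by norm_num) ?_) (by simp; omega)
  have v8 : (var 6 + var 0 * (var 0 * var 0)).eval (Function.update ρ 7 (b : ℤ)) =
      ((colorStep (2 ^ b : ℕ))^[0] (x + (n : ℤ) ^ 3, 0, 0)).1 := by
    simp [h6, hρ.r0]; ring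
  rw [v8]
  refine WP.then (WP.assign hU (safe_of_deg hU hw (by decide) (by decide)) r8.bounded
    (by norm_num) ?_) (by simp; omega)
  refine WP.then (WP.assign hU (safe_of_deg hU hw (by decide) (by decide)) r9.bounded
    (by norm_num) ?_) (by simp; omega)
  refine WP.mono (WP.while_ (τ := 120) (q := []) hU (safe_of_deg hU hw (by decide) (by decide))
    (fun i ρ' μ' => i ≤ b ∧ Regs U n ρ' ∧ (∀ r, r < 7 ∨ 10 < r → ρ' r = ρ r) ∧
      ρ' 7 = ((b - i : ℕ) : ℤ) ∧
      (ρ' 8, ρ' 9, ρ' 10) = (colorStep (2 ^ b : ℕ))^[i] (x + (n : ℤ) ^ 3, 0, 0) ∧ μ' = μ) b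
    (fun i ρ' μ' h => h.2.1.bounded) ?_ ?_ ?_ ?_) ?_ (by simp) ?_
  · rintro i hi ρ' μ' ⟨-, -, -, e7, -⟩
    simp [e7]; omega
  · rintro ρ' μ' ⟨-, -, -, e7, -⟩
    simp [e7]
  · rintro i hi ρ' μ' ⟨-, hr, ho, e7, ez, em⟩
    obtain ⟨n1, n2, n3⟩ := bnd (i + 1) hi
    rw [Function.iterate_succ_apply', ← ez] at n1 n2 n3
    simp only [colorStep] at n1 n2 n3
    have s10 := hr.update (v := 10) (by decide) n3
    have s9 := s10.update (v := 9) (by decide) n2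
    have s8 := s9.update (v := 8) (by decide) n1
    have s7 := s8.update (v := 7) (by decide) (bcnt (b - (i + 1)) (by omega))
    -- The order of updates `10`, `9`, `8` matters: the first two still read the undivided number in
    -- register `8`.
    refine WP.then (WP.assign hU (safe_of_deg hU hw (by decide) (by decide)) hr.bounded
      (by norm_num) ?_) (by simp)
    simp only [Expr.eval_add, Expr.eval_mul, Expr.eval_mod, Expr.eval_const, Expr.eval_var, hr.r2,
      ← sq]
    refine WP.then (WP.assign hU (safe_of_deg hU hw (by decide) (by decide)) s10.bounded
      (by norm_num) ?_) (by simp)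
    simp only [Expr.eval_add, Expr.eval_mul, Expr.eval_mod, Expr.eval_div, Expr.eval_const,
      Expr.eval_var, s10.r2, Function.update_of_ne (show (8 : ℕ) ≠ 10 by decide),
      Function.update_of_ne (show (9 : ℕ) ≠ 10 by decide)]
    refine WP.then (WP.assign hU (safe_of_deg hU hw (by decide) (by decide)) s9.bounded
      (by norm_num) ?_) (by simp)
    simp only [Expr.eval_mul, Expr.eval_div, Expr.eval_const,
      Expr.eval_var, s9.r2, Function.update_of_ne (show (8 : ℕ) ≠ 10 by decide),
      Function.update_of_ne (show (8 : ℕ) ≠ 9 by decide)]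
    refine WP.mono (WP.assign hU (safe_of_deg hU hw (by decide) (by decide)) s8.bounded
      (by norm_num) (Q := fun ρ' μ' => i + 1 ≤ b ∧ Regs U n ρ' ∧
        (∀ r, r < 7 ∨ 10 < r → ρ' r = ρ r) ∧ ρ' 7 = ((b - (i + 1) : ℕ) : ℤ) ∧
      (ρ' 8, ρ' 9, ρ' 10) = (colorStep (2 ^ b : ℕ))^[i + 1] (x + (n : ℤ) ^ 3, 0, 0) ∧ μ' = μ) ?_)
      (by simp) rfl fun _ _ h => h
    have v7 : ((b - i : ℕ) : ℤ) - 1 = ((b - (i + 1) : ℕ) : ℤ) := by omega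
    refine ⟨hi, ?_, ?_, ?_, ?_, em⟩
    · simpa only [Expr.eval_sub, Expr.eval_const, Expr.eval_var,
        Function.update_of_ne (show (7 : ℕ) ≠ 8 by decide),
        Function.update_of_ne (show (7 : ℕ) ≠ 9 by decide),
        Function.update_of_ne (show (7 : ℕ) ≠ 10 by decide), e7, v7] using s7
    · intro r hr'
      rw [Function.update_of_ne (by omega), Function.update_of_ne (by omega),
        Function.update_of_ne (by omega), Function.update_of_ne (by omega), ho r hr']
    · simp only [Expr.eval_sub, Expr.eval_const, Expr.eval_var, Function.update_self,
        Function.update_of_ne (show (7 : ℕ) ≠ 8 by decide),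
        Function.update_of_ne (show (7 : ℕ) ≠ 9 by decide),
        Function.update_of_ne (show (7 : ℕ) ≠ 10 by decide), e7, v7]
    · rw [Function.iterate_succ_apply', ← ez]
      simp [colorStep]
  · refine ⟨Nat.zero_le _, ?_, ?_, ?_, ?_, rfl⟩
    · exact r10
    · intro r hr'
      rw [Function.update_of_ne (by omega), Function.update_of_ne (by omega),
        Function.update_of_ne (by omega), Function.update_of_ne (by omega)]
    · simp
    · simp
  · simp; omega
  · rintro ρ' μ' ⟨-, hr, ho, -, ez, rfl⟩
    refine hQ ρ' hr ho ?_
    rw [hr.r2]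
    unfold color
    rw [← ez]

end Template

/-! ### Writing and asking the queries, and the whole program -/

section Template

variable {B : Problem} {w U n : ℕ}

/-- The memory holds the numbers `xs` and the table of `ternary`. -/
structure Stored (n : ℕ) (xs : ℕ → ℤ) (μ : ℕ → ℤ) : Prop where
  input : ∀ j < 3 * n, μ j = xs j
  table : ∀ j ≤ 48 * n, μ (3 * n + j) = (ternary j : ℤ)

/-- The expression `E` computes the entry `i` of query `t`. -/
def Computes (U n src : ℕ) (xs : ℕ → ℤ) (E : Expr) (t i : ℕ) (v : ℤ) : Prop :=
  ∀ ρ, Regs U n ρ → ρ 4 = t → ρ 5 = i → ρ 6 = xs (i % (src * n)) → ρ 15 = ternary i →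
    ρ 9 + ρ 2 * ρ 10 = color n (bits n) (2 ^ bits n) (xs (i % (src * n))) → E.eval ρ = v

variable {src tgt : ℕ} {xs : ℕ → ℤ} {E : Expr}

/-- Reading the input at `i % (src * n)` makes a single source set (`src = 1`) appear as repeated
blocks of length `n`, so one source can serve all three roles. -/
theorem wp_writeEntry (hU : 2 ≤ U) (hn : n < U) (hw : U ^ 3000 ≤ 2 ^ w) (hs0 : 0 < src)
    (hs : src ≤ 3) (hxs : ∀ j < 3 * n, |xs j| ≤ (n : ℤ) ^ 3) (hE : E.Safe U 200 w) {t i : ℕ}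
    (hi : i < 48 * n) {v : ℤ} (hv : Computes U n src xs E t i v) {ρ μ : ℕ → ℤ}
    (hρ : Regs U n ρ) (h4 : ρ 4 = t) (h5 : ρ 5 = i) (hμ : Stored n xs μ)
    {Q : (ℕ → ℤ) → (ℕ → ℤ) → Prop}
    (hQ : ∀ ρ', Regs U n ρ' → ρ' 4 = t → ρ' 5 = ((i + 1 : ℕ) : ℤ) → ρ' 11 = ρ 11 →
      Q ρ' (Function.update μ (51 * n + (1 + i)) v)) :
    WP B w (writeEntry src E) ((E.cost + 500) * (bits n + 1)) [] Q ρ μ := by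
  have hn0 : 0 < n := by omega
  have hlt : i % (src * n) < 3 * n :=
    (Nat.mod_lt _ (by positivity)).trans_le (Nat.mul_le_mul_right n hs)
  have hb6 := hxs _ hlt
  have hn3 : ((n : ℤ) ^ 3) ≤ (U : ℤ) ^ 200 :=
    (pow_le_pow_left₀ (by positivity) (by exact_mod_cast hn.le) 3).trans
      (pow_le_pow_right₀ (by exact_mod_cast (by omega : 1 ≤ U)) (by norm_num))
  have hb15 : |(ternary i : ℤ)| ≤ (U : ℤ) ^ 200 :=
    abs_le_pow hU (d := 14) (by norm_num) (by positivity)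
      (by exact_mod_cast ternary_le_pow hU hn hi.le)
  have r6 := hρ.update (v := 6) (by decide) (hb6.trans hn3)
  have r15 := r6.update (v := 15) (by decide) hb15
  have hτ : E.cost + 500 + 500 * bits n ≤ (E.cost + 500) * (bits n + 1) := by
    nlinarith [Nat.zero_le (E.cost * bits n)]
  have hsafe : (var 5 % (const src * var 0)).Safe U 200 w :=
    safe_of_deg hU hw (by simp) (by simp; omega)
  refine WP.then (WP.fetch hU hsafe hρ.bounded (x := i % (src * n)) (by norm_num)
    (by simp [hρ.r0, h5]) ?_ ?_) (by simp; omega)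
  · rw [hμ.input _ hlt]; exact lt_two_pow_word hU hw (hb6.trans hn3)
  rw [hμ.input _ hlt]
  refine WP.then (WP.fetch hU (safe_of_deg hU hw (by decide) (by decide)) r6.bounded
    (x := 3 * n + i) (by norm_num) (by simp [hρ.r0, h5]) ?_ ?_) (by simp; omega)
  · rw [hμ.table _ hi.le]; exact lt_two_pow_word hU hw hb15
  rw [hμ.table _ hi.le]
  refine WP.then (wp_computeColor hU hn hw r15 (x := xs (i % (src * n))) (by simp) hb6 ?_)
    (by simp; omega)
  intro ρ' hr ho hc
  have e4 : ρ' 4 = t := by rw [ho 4 (by norm_num)]; simp [h4]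
  have e5 : ρ' 5 = i := by rw [ho 5 (by norm_num)]; simp [h5]
  have e6 : ρ' 6 = xs (i % (src * n)) := by rw [ho 6 (by norm_num)]; simp
  have e11 : ρ' 11 = ρ 11 := by rw [ho 11 (by norm_num)]; simp
  have e15 : ρ' 15 = ternary i := by rw [ho 15 (by norm_num)]; simp
  refine WP.then (WP.put hU (safe_of_deg hU hw (by decide) (by decide)) hE hr.bounded
    (x := 51 * n + (1 + i)) (by simp [hr.r0, e5]) ?_) (by simp; omega)
  rw [hv ρ' hr e4 e5 e6 e15 hc]
  have f5 := hr.update (v := 5) (x := ((i + 1 : ℕ) : ℤ)) (by decide)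
    (abs_le_pow hU (d := 7) (by norm_num) (by positivity)
      (by exact_mod_cast index_le_pow hU hn (by omega)))
  refine WP.mono (WP.assign hU (safe_of_deg hU hw (by decide) (by decide)) hr.bounded
    (by norm_num) (Q := Q) ?_) (by simp; omega) rfl fun _ _ h => h
  have e5' : (var 5 + const 1).eval ρ' = ((i + 1 : ℕ) : ℤ) := by simp [e5]
  rw [e5']
  exact hQ _ f5 (by simp [e4]) (by simp) (by simp [e11])

/-- `P` stands for a positive answer to some earlier query; register `11` carries its indicator and
is updated to a disjunction. -/
theorem wp_oneQuery (hU : 2 ≤ U) (hn : n < U) (hw : U ^ 3000 ≤ 2 ^ w) (hs0 : 0 < src)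
    (hs : src ≤ 3) (ht : tgt ≤ 48) (hB : B.words (16 * n) = tgt * n)
    (hxs : ∀ j < 3 * n, |xs j| ≤ (n : ℤ) ^ 3) (hE : E.Safe U 200 w) {t : ℕ}
    (htQ : t < base n ^ 7) {v : ℕ → ℤ} (hv : ∀ i < tgt * n, Computes U n src xs E t i (v i))
    (I : B.Inst (16 * n)) (hI : B.Encodes ((List.range (tgt * n)).map v) I) {P : Prop}
    [Decidable P] [Decidable (P ∨ B.Yes I)] {ρ μ : ℕ → ℤ}
    (hρ : Regs U n ρ) (h4 : ρ 4 = t) (h11 : ρ 11 = if P then 1 else 0) (hμ : Stored n xs μ)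
    {Q : (ℕ → ℤ) → (ℕ → ℤ) → Prop}
    (hQ : ∀ ρ' μ', Regs U n ρ' → ρ' 4 = ((t + 1 : ℕ) : ℤ) →
      ρ' 11 = (if P ∨ B.Yes I then 1 else 0) → Stored n xs μ' → Q ρ' μ') :
    WP B w (oneQuery src tgt E) ((E.cost + 600) * (bits n + 1) * (48 * n + 1)) [16 * n] Q ρ μ := by
  have hw0 : 0 < w := by
    rcases Nat.eq_zero_or_pos w with rfl | h
    · have : 1 < U ^ 3000 := Nat.one_lt_pow (by norm_num) (by omega)
      omega
    · exact h
  have htn : tgt * n ≤ 48 * n := Nat.mul_le_mul_right n ht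
  have hzero : |(0 : ℤ)| ≤ (U : ℤ) ^ 200 := by simp
  have hone : |(1 : ℤ)| ≤ (U : ℤ) ^ 200 :=
    abs_le_pow hU (d := 0) (by norm_num) (by norm_num) (by simp)
  obtain ⟨c, hc⟩ : ∃ c, c = (E.cost + 500) * (bits n + 1) := ⟨_, rfl⟩
  have hcb : c + 100 ≤ (E.cost + 600) * (bits n + 1) := by
    rw [hc]; nlinarith [Nat.zero_le (bits n)]
  have hτ : (c + 100) * (48 * n + 1) ≤ (E.cost + 600) * (bits n + 1) * (48 * n + 1) :=
    Nat.mul_le_mul_right _ hcb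
  have hτ' : tgt * n * (c + 8) ≤ 48 * n * (c + 8) := Nat.mul_le_mul_right _ htn
  have hτ'' : (c + 100) * (48 * n + 1) = 48 * n * (c + 8) + 92 * (48 * n) + c + 100 := by ring
  have hc1 : 500 ≤ c := by
    rw [hc]
    nlinarith [Nat.zero_le (bits n), Nat.zero_le E.cost, Nat.zero_le (E.cost * bits n)]
  have hB' : B.words (16 * n) ≤ 48 * n := by omega
  have r5 := hρ.update (v := 5) (by decide) hzero
  refine WP.then (WP.assign hU (safe_of_deg hU hw (by decide) (by decide)) hρ.bounded
    (by norm_num) ?_) (by simp; omega)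
  refine WP.then (τ' := tgt * n * (c + 8) + 8) (WP.mono (WP.while_ (τ := c) (q := []) hU
    (safe_of_deg hU hw (by simp) (by simp; omega))
    (fun i ρ' μ' => i ≤ tgt * n ∧ Regs U n ρ' ∧ ρ' 4 = t ∧ ρ' 5 = i ∧ ρ' 11 = ρ 11 ∧
      Stored n xs μ' ∧ ∀ j < i, μ' (51 * n + 1 + j) = v j) (tgt * n)
    (fun i ρ' μ' h => h.2.1.bounded) ?_ ?_ ?_ ?_) ?_ (by simp) ?_) ?_
  · rintro i hi ρ' μ' ⟨-, hr, -, e5, -⟩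
    have : (i : ℤ) < tgt * n := by exact_mod_cast hi
    simp [hr.r0, e5, this]
  · rintro ρ' μ' ⟨-, hr, -, e5, -⟩
    simp [hr.r0, e5]
  · rintro i hi ρ' μ' ⟨-, hr, e4, e5, e11, em, ev⟩
    refine hc ▸ wp_writeEntry hU hn hw hs0 hs hxs hE (by omega) (hv i hi) hr e4 e5 em ?_
    intro ρ'' hr' f4 f5 f11
    refine ⟨hi, hr', f4, f5, f11.trans e11, ⟨?_, ?_⟩, ?_⟩
    · intro j hj
      rw [Function.update_of_ne (by omega), em.input j hj]
    · intro j hj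
      rw [Function.update_of_ne (by omega), em.table j hj]
    · intro j hj
      rcases Nat.lt_or_ge j i with h | h
      · rw [Function.update_of_ne (by omega), ev j h]
      · obtain rfl : j = i := by omega
        rw [show 51 * n + 1 + j = 51 * n + (1 + j) by ring, Function.update_self]
  · refine ⟨Nat.zero_le _, r5, by simp [h4], by simp, by simp, hμ, fun j hj => by omega⟩
  · simp
    have : tgt * n * (1 + (c + 7)) = tgt * n * (c + 8) := by ring
    omega
  rotate_left
  · clear hw; simp; omega
  rintro ρ' μ' ⟨-, hr, e4, e5, e11, em, ev⟩
  have hI' : B.Encodes ((List.range (B.words (16 * n))).map fun i => μ' (51 * n + 1 + i)) I := by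
    rw [hB, List.map_congr_left fun j hj => ev j (List.mem_range.mp hj)]
    exact hI
  classical
  -- Treats both possible answers `c` of the oracle at once.
  have finish : ∀ c : ℤ, c = (if B.Yes I then 1 else 0) →
      WP B w (.seq (assign 11 (bin .lt (const 0) (var 11 + var 12))) (assign 4 (var 4 + const 1)))
        40 [] Q (Function.update ρ' 12 c) μ' := by
    intro c hc
    have hc1 : |c| ≤ (U : ℤ) ^ 200 := by rw [hc]; split_ifs <;> assumption
    have r12 := hr.update (v := 12) (by decide) hc1
    refine WP.then (WP.assign hU (safe_of_deg hU hw (by decide) (by decide)) r12.bounded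
      (by norm_num) ?_) (by simp)
    have hval : (bin .lt (const 0) (var 11 + var 12)).eval (Function.update ρ' 12 c) =
        if P ∨ B.Yes I then 1 else 0 := by
      simp only [Expr.eval_lt, Expr.eval_const, Expr.eval_add, Expr.eval_var,
        Function.update_self, Function.update_of_ne (show (11 : ℕ) ≠ 12 by decide), e11, h11, hc]
      by_cases h1 : P <;> by_cases h2 : B.Yes I <;> simp [h1, h2]
    rw [hval]
    have r11 := r12.update (v := 11) (x := if P ∨ B.Yes I then 1 else 0) (by decide)
      (by split_ifs <;> assumption)
    have r4 := r11.update (v := 4) (x := ((t + 1 : ℕ) : ℤ)) (by decide)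
      (abs_le_pow hU (d := 182) (by norm_num) (by positivity)
        (by exact_mod_cast (Nat.succ_le_of_lt htQ).trans (base_pow_le_pow hU hn)))
    refine WP.mono (WP.assign hU (safe_of_deg hU hw (by decide) (by decide)) r11.bounded
      (by norm_num) (Q := Q) ?_) (by simp) rfl fun _ _ h => h
    have e4' : (var 4 + const 1).eval
        (Function.update (Function.update ρ' 12 c) 11 (if P ∨ B.Yes I then 1 else 0)) =
        ((t + 1 : ℕ) : ℤ) := by simp [e4]
    rw [e4']
    exact hQ _ _ r4 (by simp) (by simp) em
  refine WP.mono (WP.seq (τ' := 40) (q' := []) (Q := Q) (WP.ask hU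
    (safe_of_deg hU hw (by decide) (by decide)) (safe_of_deg hU hw (by decide) (by decide))
    hr.bounded (by norm_num) (x := 51 * n + 1) (n := 16 * n) (by simp [hr.r0]) (by simp [hr.r0])
    ?_ hw0 I hI' ?_ ?_)) ?_ rfl fun _ _ h => h
  · have h1 : 51 * n + 1 + B.words (16 * n) ≤ U ^ 8 := by
      have h2 := index_le_pow hU hn (j := 51 * n + 2) le_rfl
      have h3 : 2 * U ^ 7 ≤ U ^ 8 := by
        rw [pow_succ U 7, mul_comm]; exact Nat.mul_le_mul_left _ hU
      omega
    exact h1.trans ((Nat.pow_le_pow_right (by omega) (by norm_num)).trans hw)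
  · intro h; exact finish 1 (by simp [h])
  · intro h; exact finish 0 (by simp [h])
  · simp; omega

open Classical in
-- Each query has `O(n)` entries, and each entry costs `O(bits n + 1)` for the colour; setup and
-- table are dominated by this.
theorem exec_manyQueries (hU : 2 ≤ U) (hn : n < U) (hw : U ^ 3000 ≤ 2 ^ w) (hs0 : 0 < src)
    (hs : src ≤ 3) (ht : tgt ≤ 48) (hB : B.words (16 * n) = tgt * n) {l : List ℤ}
    (hl : l.length ≤ 3 * n) (hxs : ∀ x ∈ l, |x| ≤ (n : ℤ) ^ 3) (hE : E.Safe U 200 w)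
    {v : ℕ → ℕ → ℤ}
    (hv : ∀ t < base n ^ 7, ∀ i < tgt * n,
      Computes U n src (fun j => l.getD j 0) E t i (v t i))
    (I : ℕ → B.Inst (16 * n))
    (hI : ∀ t < base n ^ 7, B.Encodes ((List.range (tgt * n)).map (v t)) (I t)) :
    ∃ s T, Exec B w (manyQueries src tgt E) (State.init n l) s T
        (List.replicate (base n ^ 7) (16 * n)) ∧
      s.reg 0 = (if ∃ t < base n ^ 7, B.Yes (I t) then 1 else 0) ∧
      T ≤ (48 * E.cost + 100000) * (bits n + 1) * (n + 1) * (base n ^ 7 + 1) := by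
  have hxs' : ∀ j < 3 * n, |l.getD j 0| ≤ (n : ℤ) ^ 3 := by
    intro j _
    rcases Nat.lt_or_ge j l.length with h | h
    · rw [List.getD_eq_getElem _ _ h]; exact hxs _ (List.getElem_mem h)
    · rw [List.getD_eq_default _ _ h]; simp
  obtain ⟨c, hc⟩ : ∃ c, c = (E.cost + 600) * (bits n + 1) * (48 * n + 1) := ⟨_, rfl⟩
  have main : WP B w (manyQueries src tgt E)
      (1000 * (bits n + 1) + (5000 * (n + 1) + ((base n ^ 7) * (c + 20) + 20)))
      (List.replicate (base n ^ 7) (16 * n))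
      (fun ρ μ => ρ 0 = if ∃ t < base n ^ 7, B.Yes (I t) then 1 else 0)
      (Function.update (fun _ => 0) 0 (n : ℤ)) (fun i => l.getD i 0) := by
    refine WP.then (wp_setup hU hn hw (by simp) (fun r hr => by simp [hr]) ?_) (by omega)
    intro ρ hr e4 e5 e11
    refine WP.then (wp_fillTable hU hn hw hr e5 (List.getD_eq_default _ _ hl) ?_) (by omega)
    intro ρ1 μ1 hr1 f4 f11 hin htab
    have loop : WP B w (while_ (bin .lt (var 4) (var 14)) (oneQuery src tgt E)) _ _ _ ρ1 μ1 :=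
      WP.while_ (τ := c) (q := [16 * n]) hU (safe_of_deg hU hw (by decide) (by decide))
        (fun i ρ' μ' => i ≤ base n ^ 7 ∧ Regs U n ρ' ∧ ρ' 4 = i ∧
          ρ' 11 = (if ∃ t < i, B.Yes (I t) then 1 else 0) ∧
          Stored n (fun j => l.getD j 0) μ') (base n ^ 7)
        (fun i ρ' μ' h => h.2.1.bounded)
        (by
          rintro i hi ρ' μ' ⟨-, hr, e4, -⟩
          have : (i : ℤ) < (base n : ℤ) ^ 7 := by exact_mod_cast hi
          simp [hr.r14, e4, this])
        (by
          rintro ρ' μ' ⟨-, hr, e4, -⟩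
          simp [hr.r14, e4])
        (by
          rintro i hi ρ' μ' ⟨-, hr, e4, e11, em⟩
          refine hc ▸ wp_oneQuery hU hn hw hs0 hs ht hB hxs' hE hi (hv i hi) (I i) (hI i hi) hr e4 e11
            em ?_
          intro ρ'' μ'' hr' g4 g11 gm
          refine ⟨hi, hr', g4, ?_, gm⟩
          rw [g11]
          refine if_congr ⟨?_, ?_⟩ rfl rfl
          · rintro (⟨t, ht, h⟩ | h)
            · exact ⟨t, by omega, h⟩
            · exact ⟨i, by omega, h⟩
          · rintro ⟨t, ht, h⟩
            rcases Nat.lt_succ_iff_lt_or_eq.mp ht with h1 | rfl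
            · exact .inl ⟨t, h1, h⟩
            · exact .inr h)
        ⟨Nat.zero_le _, hr1, by rw [f4, e4]; rfl, by rw [f11, e11]; simp, hin, htab⟩
    refine (WP.seq (τ' := 5) (q' := []) (loop.mono le_rfl rfl ?_)).mono ?_ ?_
      (Q := fun ρ _ => ρ 0 = if ∃ t < base n ^ 7, B.Yes (I t) then 1 else 0) fun _ _ h => h
    · rintro ρ' μ' ⟨-, hr, -, e11, -⟩
      exact (WP.assign hU (safe_of_deg hU hw (by decide) (by decide)) hr.bounded (by norm_num)
        (Q := fun ρ _ => ρ 0 = if ∃ t < base n ^ 7, B.Yes (I t) then 1 else 0)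
        (by simpa using e11)).mono (by simp) rfl fun _ _ h => h
    · simp
      have : base n ^ 7 * (1 + (c + 5)) ≤ base n ^ 7 * (c + 20) :=
        Nat.mul_le_mul_left _ (by omega)
      omega
    · simp
  obtain ⟨s, T, h1, h2, ρ', h3, h4⟩ := main (State.init n l) (fun _ _ => rfl) rfl
  refine ⟨s, T, h1, by rw [h3 0 (by norm_num), h4], h2.trans ?_⟩
  clear hw main
  generalize base n ^ 7 = K at *
  generalize bits n = b at *
  have e1 : 1000 * (b + 1) ≤ 1000 * ((b + 1) * (n + 1) * (K + 1)) := by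
    apply Nat.mul_le_mul_left
    rw [mul_assoc]
    exact Nat.le_mul_of_pos_right _ (by positivity)
  have e2 : 5000 * (n + 1) ≤ 5000 * ((b + 1) * (n + 1) * (K + 1)) := by
    apply Nat.mul_le_mul_left
    rw [show (b + 1) * (n + 1) * (K + 1) = (n + 1) * ((b + 1) * (K + 1)) by ring]
    exact Nat.le_mul_of_pos_right _ (by positivity)
  have e3 : K * (c + 20) + 20 ≤ (48 * E.cost + 30000) * ((b + 1) * (n + 1) * (K + 1)) := by
    have h1 : c + 20 ≤ (48 * E.cost + 30000) * ((b + 1) * (n + 1)) := by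
      have h0 : 1 ≤ (b + 1) * (n + 1) := Nat.succ_le_of_lt (by positivity)
      have h2 : c ≤ (48 * E.cost + 28800) * ((b + 1) * (n + 1)) := by
        calc c = (E.cost + 600) * (b + 1) * (48 * n + 1) := hc
          _ ≤ (E.cost + 600) * (b + 1) * (48 * (n + 1)) := Nat.mul_le_mul_left _ (by omega)
          _ = _ := by ring
      calc c + 20 ≤ (48 * E.cost + 28800) * ((b + 1) * (n + 1)) + 1200 * ((b + 1) * (n + 1)) := by
            omega
        _ = _ := by ring
    calc K * (c + 20) + 20 ≤ (K + 1) * (c + 20) := by nlinarith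
      _ ≤ (K + 1) * ((48 * E.cost + 30000) * ((b + 1) * (n + 1))) := Nat.mul_le_mul_left _ h1
      _ = _ := by ring
  calc _ ≤ 1000 * ((b + 1) * (n + 1) * (K + 1)) + (5000 * ((b + 1) * (n + 1) * (K + 1)) +
        (48 * E.cost + 30000) * ((b + 1) * (n + 1) * (K + 1))) :=
        add_le_add e1 (add_le_add e2 e3)
    _ = (48 * E.cost + 36000) * ((b + 1) * (n + 1) * (K + 1)) := by ring
    _ ≤ (48 * E.cost + 100000) * ((b + 1) * (n + 1) * (K + 1)) := Nat.mul_le_mul_right _ (by omega)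
    _ = _ := by ring

end Template

/-! ### The queries -/

/-- The set of the values `f 0, …, f (M - 1)`. -/
def IntSet.ofFun (M : ℕ) (f : ℕ → ℤ) (hf : ∀ i < M, ∀ j < M, f i = f j → i = j)
    (hb : ∀ i < M, |f i| ≤ (M : ℤ) ^ 3) : IntSet M :=
  ⟨(Finset.range M).image f, by
    rw [Finset.card_image_of_injOn, Finset.card_range]
    intro i hi j hj h
    exact hf i (by simpa using hi) j (by simpa using hj) h, by
    intro y hy
    obtain ⟨i, hi, rfl⟩ := Finset.mem_image.mp hy
    have := abs_le.mp (hb i (Finset.mem_range.mp hi))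
    exact Finset.mem_Icc.mpr (by simpa using this)⟩

theorem IntSet.mem_ofFun {M : ℕ} {f : ℕ → ℤ} {hf hb} {y : ℤ} :
    y ∈ (IntSet.ofFun M f hf hb).1 ↔ ∃ i < M, f i = y := by
  simp [IntSet.ofFun]

theorem IntSet.lists_ofFun {M : ℕ} {f : ℕ → ℤ} {hf hb} :
    IntSet.Lists ((List.range M).map f) (IntSet.ofFun M f hf hb) := by
  refine ⟨?_, ?_⟩
  · refine List.Nodup.map_on ?_ List.nodup_range
    intro i hi j hj h
    exact hf i (List.mem_range.mp hi) j (List.mem_range.mp hj) h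
  · ext y
    simp [IntSet.ofFun]

/-- The number `y` is among those in block `a` of `x`, where each block has length `n`. -/
def Occurs (n : ℕ) (x : ℕ → ℤ) (a : ℕ) (y : ℤ) : Prop := ∃ i < 3 * n, i / n = a ∧ x i = y

theorem div_of_lt_three_mul {n i : ℕ} (hi : i < 3 * n) : i / n = 0 ∨ i / n = 1 ∨ i / n = 2 := by
  have : i / n < 3 := Nat.div_lt_of_lt_mul (by rwa [mul_comm])
  generalize i / n = k at this
  omega

theorem cast_le_cube (n : ℕ) : (n : ℤ) ≤ (n : ℤ) ^ 3 := by
  exact_mod_cast Nat.le_self_pow (by norm_num) n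

open Classical in
/-- Entry `i` of a query to AVERAGE. -/
noncomputable def averageEntry (n : ℕ) (x : ℕ → ℤ) (S : ℕ → ℤ → Prop) (i : ℕ) : ℤ :=
  if i < 3 * n ∧ S (i / n) (x i) then
    if i / n = 0 then 32 * x i else if i / n = 1 then 32 * x i + 2 else 1 - 16 * x i
  else 16 * ternary i + 7

open Classical in
/-- Entry `i` of a query to 3-SUM on one set. -/
noncomputable def threeSum1Entry (n : ℕ) (x : ℕ → ℤ) (S : ℕ → ℤ → Prop) (i : ℕ) : ℤ :=
  if i < 3 * n ∧ S (i / n) (x i) then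
    if i / n = 0 then 7 * x i + 1 else if i / n = 1 then 7 * x i + 2 else -14 * x i - 3
  else 40 * (n : ℤ) ^ 3 + i

open Classical in
/-- Entry `i` of a query to 3-SUM on three sets. -/
noncomputable def threeSum3Entry (n : ℕ) (x : ℕ → ℤ) (S : ℕ → ℤ → Prop) (i : ℕ) : ℤ :=
  if i % (16 * n) < n ∧ S (i / (16 * n)) (x (i % n)) then
    if i / (16 * n) = 2 then -2 * x (i % n) else x (i % n)
  else 40 * (n : ℤ) ^ 3 + i

/-! ### Correctness of a single query for each target problem -/

section Targets

variable {n : ℕ} {x : ℕ → ℤ} {S : ℕ → ℤ → Prop}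

theorem averageEntry_cases (n : ℕ) (x : ℕ → ℤ) (S : ℕ → ℤ → Prop) (i : ℕ) :
    (i < 3 * n ∧ i / n = 0 ∧ S 0 (x i) ∧ averageEntry n x S i = 32 * x i) ∨
    (i < 3 * n ∧ i / n = 1 ∧ S 1 (x i) ∧ averageEntry n x S i = 32 * x i + 2) ∨
    (i < 3 * n ∧ i / n = 2 ∧ S 2 (x i) ∧ averageEntry n x S i = 1 - 16 * x i) ∨
    averageEntry n x S i = 16 * ternary i + 7 := by
  unfold averageEntry
  by_cases h : i < 3 * n ∧ S (i / n) (x i)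
  · rw [if_pos h]
    obtain ⟨h1, h2⟩ := h
    rcases div_of_lt_three_mul h1 with h0 | h0 | h0 <;> rw [h0] at h2 ⊢ <;> simp [h1, h2]
  · rw [if_neg h]; simp

theorem threeSum1Entry_cases (n : ℕ) (x : ℕ → ℤ) (S : ℕ → ℤ → Prop) (i : ℕ) :
    (i < 3 * n ∧ i / n = 0 ∧ S 0 (x i) ∧ threeSum1Entry n x S i = 7 * x i + 1) ∨
    (i < 3 * n ∧ i / n = 1 ∧ S 1 (x i) ∧ threeSum1Entry n x S i = 7 * x i + 2) ∨
    (i < 3 * n ∧ i / n = 2 ∧ S 2 (x i) ∧ threeSum1Entry n x S i = -14 * x i - 3) ∨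
    threeSum1Entry n x S i = 40 * (n : ℤ) ^ 3 + i := by
  unfold threeSum1Entry
  by_cases h : i < 3 * n ∧ S (i / n) (x i)
  · rw [if_pos h]
    obtain ⟨h1, h2⟩ := h
    rcases div_of_lt_three_mul h1 with h0 | h0 | h0 <;> rw [h0] at h2 ⊢ <;> simp [h1, h2]
  · rw [if_neg h]; simp

/-- The four kinds of entries are `0`, `2` modulo `32` and `1`, `7` modulo `16`. In `u + v = 2 w`
these residues leave only two cases: `32 x + (32 y + 2) = 2 (1 - 16 z)`, which says `x + y + z = 0`,
or all three of the same kind. The latter is excluded by `hS` within a role and by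
`ternary_no_progression` within the padding. -/
theorem query_average (hinj : ∀ i < 3 * n, ∀ j < 3 * n, i / n = j / n → x i = x j → i = j)
    (hb : ∀ i < 3 * n, |x i| ≤ (n : ℤ) ^ 3)
    (hS : ∀ a y z u, |y| ≤ (n : ℤ) ^ 3 → |z| ≤ (n : ℤ) ^ 3 → |u| ≤ (n : ℤ) ^ 3 → S a y → S a z →
      S a u → y + z = 2 * u → y = z) :
    ∃ I : average.Inst (16 * n),
      average.Encodes ((List.range (16 * n)).map (averageEntry n x S)) I ∧
      (average.Yes I ↔ ∃ y : Fin 3 → ℤ, (∀ a : Fin 3, Occurs n x a (y a) ∧ S a (y a)) ∧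
        y 0 + y 1 + y 2 = 0) := by
  set f := averageEntry n x S with hf
  have hcase := averageEntry_cases n x S
  rw [← hf] at hcase
  refine ⟨IntSet.ofFun (16 * n) f ?_ ?_, IntSet.lists_ofFun, ?_⟩
  · intro i _ j _ h
    rcases hcase i with ⟨a1, a2, -, a3⟩ | ⟨a1, a2, -, a3⟩ | ⟨a1, a2, -, a3⟩ | a3 <;>
    rcases hcase j with ⟨b1, b2, -, b3⟩ | ⟨b1, b2, -, b3⟩ | ⟨b1, b2, -, b3⟩ | b3 <;>
    first
    | exact ternary_injective (by omega)
    | exact hinj i a1 j b1 (by omega) (by omega)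
  · intro i hi
    have hn : 1 ≤ n := by omega
    have hn3 : (1 : ℤ) ≤ (n : ℤ) ^ 3 := by have := cast_le_cube n; omega
    have hM : ((16 * n : ℕ) : ℤ) ^ 3 = 4096 * (n : ℤ) ^ 3 := by push_cast; ring
    rw [hM]
    rcases hcase i with ⟨a1, -, -, a3⟩ | ⟨a1, -, -, a3⟩ | ⟨a1, -, -, a3⟩ | a3
    · have := abs_le.mp (hb i a1); rw [a3, abs_le]; constructor <;> linarith
    · have := abs_le.mp (hb i a1); rw [a3, abs_le]; constructor <;> linarith
    · have := abs_le.mp (hb i a1); rw [a3, abs_le]; constructor <;> linarith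
    -- Here the size `16 n` is needed: the padding reaches up to `16 (16 n - 1) ^ 2 + 7`, which must
    -- not exceed `(16 n) ^ 3`.
    · have h1 : (ternary i : ℤ) ≤ (i : ℤ) ^ 2 := by exact_mod_cast ternary_le i
      have h2 : (i : ℤ) ^ 2 ≤ (16 * (n : ℤ) - 1) ^ 2 := pow_le_pow_left₀ (by positivity) (by omega) 2
      have h3 : (n : ℤ) ^ 2 ≤ (n : ℤ) ^ 3 := pow_le_pow_right₀ (by exact_mod_cast hn) (by norm_num)
      rw [a3, abs_of_nonneg (by positivity)]
      nlinarith [show (1 : ℤ) ≤ n by exact_mod_cast hn]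
  · constructor
    · rintro ⟨z, hz, hmem, hsum⟩
      simp only [IntSet.mem_ofFun] at hmem
      obtain ⟨i, -, hi⟩ := hmem 0
      obtain ⟨j, -, hj⟩ := hmem 1
      obtain ⟨k, -, hk⟩ := hmem 2
      have hij : f i ≠ f j := by rw [hi, hj]; exact hz.ne (by decide)
      simp [Fin.sum_univ_three, ← hi, ← hj, ← hk] at hsum
      have done : ∀ i' j' k', i' < 3 * n → i' / n = 0 → S 0 (x i') → j' < 3 * n → j' / n = 1 →
          S 1 (x j') → k' < 3 * n → k' / n = 2 → S 2 (x k') → x i' + x j' + x k' = 0 →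
          ∃ y : Fin 3 → ℤ, (∀ a : Fin 3, Occurs n x a (y a) ∧ S a (y a)) ∧
            y 0 + y 1 + y 2 = 0 := by
        intro i' j' k' p1 p2 p3 q1 q2 q3 r1 r2 r3 h
        refine ⟨![x i', x j', x k'], ?_, h⟩
        intro a
        fin_cases a
        · exact ⟨⟨i', p1, p2, rfl⟩, p3⟩
        · exact ⟨⟨j', q1, q2, rfl⟩, q3⟩
        · exact ⟨⟨k', r1, r2, rfl⟩, r3⟩
      rcases hcase i with ⟨a1, a2, a4, a3⟩ | ⟨a1, a2, a4, a3⟩ | ⟨a1, a2, a4, a3⟩ | a3 <;>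
      rcases hcase j with ⟨b1, b2, b4, b3⟩ | ⟨b1, b2, b4, b3⟩ | ⟨b1, b2, b4, b3⟩ | b3 <;>
      rcases hcase k with ⟨c1, c2, c4, c3⟩ | ⟨c1, c2, c4, c3⟩ | ⟨c1, c2, c4, c3⟩ | c3 <;>
      first
      | (exfalso; omega)
      | exact done i j k a1 a2 a4 b1 b2 b4 c1 c2 c4 (by omega)
      | exact done j i k b1 b2 b4 a1 a2 a4 c1 c2 c4 (by omega)
      -- Three entries of one role: a progression among selected elements.
      | (exfalso
         have := hS _ _ _ _ (hb i a1) (hb j b1) (hb k c1) a4 b4 c4 (by omega)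
         omega)
      -- Three padding entries.
      | (exfalso
         have := ternary_no_progression i j k (by omega)
         exact hij (by rw [this.1, this.2]))
    · rintro ⟨y, hy, hsum⟩
      obtain ⟨⟨i, i1, i2, i3⟩, i4⟩ := hy 0
      obtain ⟨⟨j, j1, j2, j3⟩, j4⟩ := hy 1
      obtain ⟨⟨k, k1, k2, k3⟩, k4⟩ := hy 2
      simp only [Fin.val_zero, Fin.val_one, Fin.val_two] at i2 i4 j2 j4 k2 k4
      rw [← i3] at i4
      rw [← j3] at j4
      rw [← k3] at k4
      have fi : f i = 32 * x i := by simp [hf, averageEntry, i1, i2, i4]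
      have fj : f j = 32 * x j + 2 := by simp [hf, averageEntry, j1, j2, j4]
      have fk : f k = 1 - 16 * x k := by simp [hf, averageEntry, k1, k2, k4]
      refine ⟨![f i, f j, f k], ?_, ?_, ?_⟩
      · intro a b hab
        fin_cases a <;> fin_cases b <;> simp at hab ⊢ <;> omega
      · intro a
        rw [IntSet.mem_ofFun]
        fin_cases a
        · exact ⟨i, by omega, rfl⟩
        · exact ⟨j, by omega, rfl⟩
        · exact ⟨k, by omega, rfl⟩
      · simp [Fin.sum_univ_three]; omega

/-- Modulo `7` the roles are `1`, `2`, `4`, and the only three of these residues, with repetition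
allowed, that sum to `0` are `1 + 2 + 4`. So the roles are all different, in any order, and the
equation becomes `x + y = 2 z`. No progression-freeness is required. -/
theorem query_threeSum1 (hinj : ∀ i < 3 * n, ∀ j < 3 * n, i / n = j / n → x i = x j → i = j)
    (hb : ∀ i < 3 * n, |x i| ≤ (n : ℤ) ^ 3) :
    ∃ I : threeSum1.Inst (16 * n),
      threeSum1.Encodes ((List.range (16 * n)).map (threeSum1Entry n x S)) I ∧
      (threeSum1.Yes I ↔ ∃ y : Fin 3 → ℤ, (∀ a : Fin 3, Occurs n x a (y a) ∧ S a (y a)) ∧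
        y 0 + y 1 - 2 * y 2 = 0) := by
  set f := threeSum1Entry n x S with hf
  have hcase := threeSum1Entry_cases n x S
  rw [← hf] at hcase
  have hN := cast_le_cube n
  have hM : ((16 * n : ℕ) : ℤ) ^ 3 = 4096 * (n : ℤ) ^ 3 := by push_cast; ring
  have hb' : ∀ i < 3 * n, -(n : ℤ) ^ 3 ≤ x i ∧ x i ≤ (n : ℤ) ^ 3 := fun i hi => abs_le.mp (hb i hi)
  obtain ⟨N, hNdef⟩ : ∃ N, N = (n : ℤ) ^ 3 := ⟨_, rfl⟩
  rw [← hNdef] at hcase hN hM hb'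
  -- The least role entry is at least `-14 N - 3 ≥ -17 N`, as `N ≥ 1` when an index exists. Two such
  -- entries cannot cancel a padding entry, which is at least `40 N`.
  have hlow : ∀ i < 16 * n, -17 * N ≤ f i := by
    intro i hi
    rcases hcase i with ⟨a1, a2, -, a3⟩ | ⟨a1, a2, -, a3⟩ | ⟨a1, a2, -, a3⟩ | a3
    · have := hb' i a1; omega
    · have := hb' i a1; omega
    · have := hb' i a1; omega
    · omega
  refine ⟨IntSet.ofFun (16 * n) f ?_ ?_, IntSet.lists_ofFun, ?_⟩
  · intro i _ j _ h
    rcases hcase i with ⟨a1, a2, -, a3⟩ | ⟨a1, a2, -, a3⟩ | ⟨a1, a2, -, a3⟩ | a3 <;>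
    rcases hcase j with ⟨b1, b2, -, b3⟩ | ⟨b1, b2, -, b3⟩ | ⟨b1, b2, -, b3⟩ | b3 <;>
    first
    | omega
    | exact hinj i a1 j b1 (by omega) (by omega)
    | (have := hb' i a1; omega)
    | (have := hb' j b1; omega)
  · intro i hi
    have := hlow i hi
    rw [hM]
    rcases hcase i with ⟨a1, -, -, a3⟩ | ⟨a1, -, -, a3⟩ | ⟨a1, -, -, a3⟩ | a3
    · have := hb' i a1; rw [abs_le]; omega
    · have := hb' i a1; rw [abs_le]; omega
    · have := hb' i a1; rw [abs_le]; omega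
    · rw [abs_le]; omega
  · constructor
    · rintro ⟨z, hz, hmem, hsum⟩
      simp only [IntSet.mem_ofFun] at hmem
      obtain ⟨i, iM, hi⟩ := hmem 0
      obtain ⟨j, jM, hj⟩ := hmem 1
      obtain ⟨k, kM, hk⟩ := hmem 2
      simp [Fin.sum_univ_three, ← hi, ← hj, ← hk] at hsum
      have done : ∀ i' j' k', i' < 3 * n → i' / n = 0 → S 0 (x i') → j' < 3 * n → j' / n = 1 →
          S 1 (x j') → k' < 3 * n → k' / n = 2 → S 2 (x k') → x i' + x j' - 2 * x k' = 0 →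
          ∃ y : Fin 3 → ℤ, (∀ a : Fin 3, Occurs n x a (y a) ∧ S a (y a)) ∧
            y 0 + y 1 - 2 * y 2 = 0 := by
        intro i' j' k' p1 p2 p3 q1 q2 q3 r1 r2 r3 h
        refine ⟨![x i', x j', x k'], ?_, h⟩
        intro a
        fin_cases a
        · exact ⟨⟨i', p1, p2, rfl⟩, p3⟩
        · exact ⟨⟨j', q1, q2, rfl⟩, q3⟩
        · exact ⟨⟨k', r1, r2, rfl⟩, r3⟩
      have hi' := hlow i iM
      have hj' := hlow j jM
      have hk' := hlow k kM
      rcases hcase i with ⟨a1, a2, a4, a3⟩ | ⟨a1, a2, a4, a3⟩ | ⟨a1, a2, a4, a3⟩ | a3 <;>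
      rcases hcase j with ⟨b1, b2, b4, b3⟩ | ⟨b1, b2, b4, b3⟩ | ⟨b1, b2, b4, b3⟩ | b3 <;>
      rcases hcase k with ⟨c1, c2, c4, c3⟩ | ⟨c1, c2, c4, c3⟩ | ⟨c1, c2, c4, c3⟩ | c3 <;>
      first
      | (exfalso; omega)
      | exact done i j k a1 a2 a4 b1 b2 b4 c1 c2 c4 (by omega)
      | exact done j i k b1 b2 b4 a1 a2 a4 c1 c2 c4 (by omega)
      | exact done i k j a1 a2 a4 c1 c2 c4 b1 b2 b4 (by omega)
      | exact done k i j c1 c2 c4 a1 a2 a4 b1 b2 b4 (by omega)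
      | exact done j k i b1 b2 b4 c1 c2 c4 a1 a2 a4 (by omega)
      | exact done k j i c1 c2 c4 b1 b2 b4 a1 a2 a4 (by omega)
    · rintro ⟨y, hy, hsum⟩
      obtain ⟨⟨i, i1, i2, i3⟩, i4⟩ := hy 0
      obtain ⟨⟨j, j1, j2, j3⟩, j4⟩ := hy 1
      obtain ⟨⟨k, k1, k2, k3⟩, k4⟩ := hy 2
      simp only [Fin.val_zero, Fin.val_one, Fin.val_two] at i2 i4 j2 j4 k2 k4
      rw [← i3] at i4
      rw [← j3] at j4
      rw [← k3] at k4
      have fi : f i = 7 * x i + 1 := by simp [hf, threeSum1Entry, i1, i2, i4]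
      have fj : f j = 7 * x j + 2 := by simp [hf, threeSum1Entry, j1, j2, j4]
      have fk : f k = -14 * x k - 3 := by simp [hf, threeSum1Entry, k1, k2, k4]
      refine ⟨![f i, f j, f k], ?_, ?_, ?_⟩
      · intro a b hab
        fin_cases a <;> fin_cases b <;> simp at hab ⊢ <;> omega
      · intro a
        rw [IntSet.mem_ofFun]
        fin_cases a
        · exact ⟨i, by omega, rfl⟩
        · exact ⟨j, by omega, rfl⟩
        · exact ⟨k, by omega, rfl⟩
      · simp [Fin.sum_univ_three]; omega

/-- The three sets already fix the roles, so no residues are needed: `-2` is absorbed into the third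
set, and padding of size at least `40 n ^ 3` cannot be cancelled by entries that are at least `-2 n
^ 3`. -/
theorem query_threeSum3 (hinj : ∀ i < n, ∀ j < n, x i = x j → i = j)
    (hb : ∀ i < n, |x i| ≤ (n : ℤ) ^ 3) :
    ∃ I : threeSum3.Inst (16 * n),
      threeSum3.Encodes ((List.range (48 * n)).map (threeSum3Entry n x S)) I ∧
      (threeSum3.Yes I ↔ ∃ y : Fin 3 → ℤ,
        (∀ a : Fin 3, Occurs n (fun i => x (i % n)) a (y a) ∧ S a (y a)) ∧
        y 0 + y 1 - 2 * y 2 = 0) := by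
  have hN := cast_le_cube n
  have hM : ((16 * n : ℕ) : ℤ) ^ 3 = 4096 * (n : ℤ) ^ 3 := by push_cast; ring
  have hb' : ∀ i < n, -(n : ℤ) ^ 3 ≤ x i ∧ x i ≤ (n : ℤ) ^ 3 := fun i hi => abs_le.mp (hb i hi)
  set f : Fin 3 → ℕ → ℤ := fun a j => threeSum3Entry n x S (a * (16 * n) + j) with hf
  have hcase : ∀ (a : Fin 3), ∀ j < 16 * n,
      (j < n ∧ S a (x j) ∧ f a j = if (a : ℕ) = 2 then -2 * x j else x j) ∨
      (¬ (j < n ∧ S a (x j)) ∧ f a j = 40 * (n : ℤ) ^ 3 + ((a * (16 * n) + j : ℕ) : ℤ)) := by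
    intro a j hj
    have h1 : (a * (16 * n) + j) % (16 * n) = j := by
      rw [add_comm, Nat.add_mul_mod_self_right, Nat.mod_eq_of_lt hj]
    have h2 : (a * (16 * n) + j) / (16 * n) = a := by
      rw [add_comm, Nat.add_mul_div_right _ _ (by omega), Nat.div_eq_of_lt hj, zero_add]
    by_cases hjn : j < n
    · have h3 : (a * (16 * n) + j) % n = j := by
        rw [show (a : ℕ) * (16 * n) + j = j + (a * 16) * n by ring, Nat.add_mul_mod_self_right,
          Nat.mod_eq_of_lt hjn]
      by_cases hs : S a (x j)
      · left
        refine ⟨hjn, hs, ?_⟩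
        simp only [hf, threeSum3Entry]
        rw [if_pos (by rw [h1, h2, h3]; exact ⟨hjn, hs⟩), h2, h3]
      · right
        refine ⟨fun h => hs h.2, ?_⟩
        simp only [hf, threeSum3Entry]
        rw [if_neg (by rw [h1, h2, h3]; exact fun h => hs h.2)]
    · right
      refine ⟨fun h => hjn h.1, ?_⟩
      simp only [hf, threeSum3Entry]
      rw [if_neg (by rw [h1]; exact fun h => hjn h.1)]
  have hI : ∀ a : Fin 3, (∀ i < 16 * n, ∀ j < 16 * n, f a i = f a j → i = j) ∧
      ∀ i < 16 * n, |f a i| ≤ ((16 * n : ℕ) : ℤ) ^ 3 := by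
    intro a
    have ha : (a : ℕ) * (16 * n) ≤ 2 * (16 * n) := Nat.mul_le_mul_right _ (by omega)
    refine ⟨?_, ?_⟩
    · intro i hi j hj h
      rcases hcase a i hi with ⟨a1, -, a3⟩ | ⟨-, a3⟩ <;>
      rcases hcase a j hj with ⟨b1, -, b3⟩ | ⟨-, b3⟩
      · exact hinj i a1 j b1 (by split_ifs at a3 b3 <;> omega)
      · have := hb' i a1; split_ifs at a3 b3 <;> omega
      · have := hb' j b1; split_ifs at a3 b3 <;> omega
      · omega
    · intro i hi
      rw [hM, abs_le]
      rcases hcase a i hi with ⟨a1, -, a3⟩ | ⟨-, a3⟩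
      · have := hb' i a1; split_ifs at a3 <;> omega
      · omega
  refine ⟨fun a => IntSet.ofFun (16 * n) (f a) (hI a).1 (hI a).2,
    ⟨fun a => (List.range (16 * n)).map (f a), ?_, fun a => IntSet.lists_ofFun⟩, ?_⟩
  · rw [show 48 * n = 16 * n + 16 * n + 16 * n by ring, List.range_add, List.range_add]
    simp only [List.map_append, List.map_map]
    congr 1
    · congr 1
      · refine List.map_congr_left fun j _ => ?_
        simp [hf]
      · refine List.map_congr_left fun j _ => ?_
        simp [hf]
    · refine List.map_congr_left fun j _ => ?_
      simp only [hf, Function.comp, Fin.val_two]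
      congr 1; ring
  · constructor
    · rintro ⟨z, hmem, hsum⟩
      simp only [IntSet.mem_ofFun] at hmem
      obtain ⟨i, iM, hi⟩ := hmem 0
      obtain ⟨j, jM, hj⟩ := hmem 1
      obtain ⟨k, kM, hk⟩ := hmem 2
      simp [Fin.sum_univ_three, ← hi, ← hj, ← hk] at hsum
      have ci := hcase 0 i iM
      have cj := hcase 1 j jM
      have ck := hcase 2 k kM
      simp only [Fin.val_zero, Fin.val_one, Fin.val_two, zero_mul, zero_add, if_true,
        if_neg (show ¬ (0 : ℕ) = 2 by decide), if_neg (show ¬ (1 : ℕ) = 2 by decide)] at ci cj ck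
      have key : i < n ∧ j < n ∧ k < n ∧ S 0 (x i) ∧ S 1 (x j) ∧ S 2 (x k) ∧
          x i + x j - 2 * x k = 0 := by
        rcases ci with ⟨a1, a2, a3⟩ | ⟨-, a3⟩ <;> rcases cj with ⟨b1, b2, b3⟩ | ⟨-, b3⟩ <;>
        rcases ck with ⟨c1, c2, c3⟩ | ⟨-, c3⟩
        · exact ⟨a1, b1, c1, a2, b2, c2, by omega⟩
        · have := hb' i a1; have := hb' j b1; omega
        · have := hb' i a1; have := hb' k c1; omega
        · have := hb' i a1; omega
        · have := hb' j b1; have := hb' k c1; omega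
        · have := hb' j b1; omega
        · have := hb' k c1; omega
        · omega
      obtain ⟨a1, b1, c1, a2, b2, c2, h⟩ := key
      refine ⟨![x i, x j, x k], ?_, h⟩
      have hocc : ∀ (a : ℕ), a < 3 → ∀ j < n, Occurs n (fun i => x (i % n)) a (x j) := by
        intro a ha j hj
        refine ⟨j + a * n, ?_, ?_, ?_⟩
        · have : a * n ≤ 2 * n := Nat.mul_le_mul_right _ (by omega)
          omega
        · rw [Nat.add_mul_div_right _ _ (by omega), Nat.div_eq_of_lt hj, zero_add]
        · simp [Nat.mod_eq_of_lt hj]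
      intro a
      fin_cases a
      · exact ⟨hocc 0 (by norm_num) i a1, a2⟩
      · exact ⟨hocc 1 (by norm_num) j b1, b2⟩
      · exact ⟨hocc 2 (by norm_num) k c1, c2⟩
    · rintro ⟨y, hy, hsum⟩
      have hval : ∀ a : Fin 3, ∃ j < n, x j = y a ∧
          f a j = if (a : ℕ) = 2 then -2 * y a else y a := by
        intro a
        obtain ⟨⟨i, i1, -, i3⟩, i4⟩ := hy a
        have hin : i % n < n := Nat.mod_lt _ (by omega)
        refine ⟨i % n, hin, i3, ?_⟩
        simp only at i3
        rcases hcase a (i % n) (by omega) with ⟨-, -, h⟩ | ⟨h, -⟩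
        · rw [h, i3]
        · exact absurd ⟨hin, by rw [i3]; exact i4⟩ h
      choose j hj _ hfj using hval
      refine ⟨fun a => f a (j a), fun a => ?_, ?_⟩
      · rw [IntSet.mem_ofFun]
        exact ⟨j a, by have := hj a; omega, rfl⟩
      · have h0 := hfj 0
        have h1 := hfj 1
        have h2 := hfj 2
        simp only [Fin.val_zero, Fin.val_one, Fin.val_two, if_true,
          if_neg (show ¬ (0 : ℕ) = 2 by decide), if_neg (show ¬ (1 : ℕ) = 2 by decide)] at h0 h1 h2
        simp [Fin.sum_univ_three]; omega

end Targets

/-! ### Expressions for the entries of the queries -/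

/-- The digit number `e` of `a` in base `K`. -/
def digitExpr : ℕ → Expr → Expr
  | 0, a => a % var 13
  | e + 1, a => digitExpr e (a / var 13)

/-- If `c = 1` then `a`, if `c = 0` then `b`. -/
def condExpr (c a b : Expr) : Expr := b + c * (a - b)

/-- The digit number `k + min role 2` of the number of the query. -/
def selectExpr (role : Expr) (k : ℕ) : Expr :=
  condExpr (bin .eq role (const 0)) (digitExpr k (var 4))
    (condExpr (bin .eq role (const 1)) (digitExpr (k + 1) (var 4)) (digitExpr (k + 2) (var 4)))

theorem eval_digitExpr {ρ : ℕ → ℤ} {K : ℕ} (hK : ρ 13 = K) (e : ℕ) {a : Expr} {t : ℕ}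
    (ha : a.eval ρ = t) : (digitExpr e a).eval ρ = digit K e t := by
  induction e generalizing a t with
  | zero => simp [digitExpr, digit, ha, hK]
  | succ e ih => exact ih (by simp [ha, hK])

theorem eval_condExpr {ρ : ℕ → ℤ} {c a b : Expr} {P : Prop} [Decidable P]
    (hc : c.eval ρ = if P then 1 else 0) :
    (condExpr c a b).eval ρ = if P then a.eval ρ else b.eval ρ := by
  simp only [condExpr, eval_add, eval_mul, eval_sub, hc]
  split_ifs <;> ring

/-- `min a 2` reflects the fall-through of the nested conditional. Roles above `2` arise only at
padding positions of one-set targets, where the test `i < 3 n` overrides the selection. -/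
theorem eval_selectExpr {ρ : ℕ → ℤ} {K t a : ℕ} (hK : ρ 13 = K) (ht : ρ 4 = t) {role : Expr}
    (hr : role.eval ρ = a) (k : ℕ) :
    (selectExpr role k).eval ρ = digit K (k + min a 2) t := by
  have h0 : (bin .eq role (const 0)).eval ρ = if a = 0 then 1 else 0 := by simp [hr]
  have h1 : (bin .eq role (const 1)).eval ρ = if a = 1 then 1 else 0 := by simp [hr]
  have hd : ∀ e, (digitExpr e (var 4)).eval ρ = digit K e t := fun e => eval_digitExpr hK e ht
  rw [selectExpr, eval_condExpr h0, eval_condExpr h1, hd, hd, hd]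
  rcases a with _ | _ | a <;> simp

/-- Element `y` takes part in query `t` in role `a`, for sources consisting of one set: the digits
of `t` prescribe the colour of `y` and the residue of `y` for some modulus. -/
def Selected1 (n t a : ℕ) (y : ℤ) : Prop :=
  y % (digit (base n) 0 t : ℤ) = digit (base n) (1 + min a 2) t ∧
  color n (bits n) (2 ^ bits n) y = digit (base n) (4 + min a 2) t ∧
  digit (base n) 1 t ≠ digit (base n) 2 t ∧ digit (base n) 1 t ≠ digit (base n) 3 t ∧
  digit (base n) 2 t ≠ digit (base n) 3 t

/-- Element `y` takes part in query `t` in role `a`, for sources consisting of three sets: the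
digits of `t` prescribe the colour of `y`. -/
def Selected3 (n t a : ℕ) (y : ℤ) : Prop :=
  color n (bits n) (2 ^ bits n) y = digit (base n) (4 + min a 2) t

/-- The indicator of `Selected1`. -/
def selected1Expr (role : Expr) : Expr :=
  bin .eq (var 6 % digitExpr 0 (var 4)) (selectExpr role 1) *
  (bin .eq (var 9 + var 2 * var 10) (selectExpr role 4) *
  ((const 1 - bin .eq (digitExpr 1 (var 4)) (digitExpr 2 (var 4))) *
  ((const 1 - bin .eq (digitExpr 1 (var 4)) (digitExpr 3 (var 4))) *
  (const 1 - bin .eq (digitExpr 2 (var 4)) (digitExpr 3 (var 4))))))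

/-- The indicator of `Selected3`. -/
def selected3Expr (role : Expr) : Expr :=
  bin .eq (var 9 + var 2 * var 10) (selectExpr role 4)

/-- The entries of queries to AVERAGE. -/
def averageExpr (sel : Expr → Expr) : Expr :=
  condExpr (bin .lt (var 5) (const 3 * var 0) * sel (var 5 / var 0))
    (condExpr (bin .eq (var 5 / var 0) (const 0)) (const 32 * var 6)
      (condExpr (bin .eq (var 5 / var 0) (const 1)) (const 32 * var 6 + const 2)
        (const 1 - const 16 * var 6)))
    (const 16 * var 15 + const 7)

/-- The entries of queries to 3-SUM on one set. -/
def threeSum1Expr : Expr :=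
  condExpr (bin .lt (var 5) (const 3 * var 0) * selected1Expr (var 5 / var 0))
    (condExpr (bin .eq (var 5 / var 0) (const 0)) (const 7 * var 6 + const 1)
      (condExpr (bin .eq (var 5 / var 0) (const 1)) (const 7 * var 6 + const 2)
        (const (-14) * var 6 - const 3)))
    (const 40 * (var 0 * (var 0 * var 0)) + var 5)

/-- The entries of queries to 3-SUM on three sets. -/
def threeSum3Expr : Expr :=
  condExpr (bin .lt (var 5 % (const 16 * var 0)) (var 0) *
      selected1Expr (var 5 / (const 16 * var 0)))
    (condExpr (bin .eq (var 5 / (const 16 * var 0)) (const 2)) (const (-2) * var 6) (var 6))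
    (const 40 * (var 0 * (var 0 * var 0)) + var 5)

/-! ### The expressions compute the intended entries -/

section

variable {U n t i : ℕ} {ρ : ℕ → ℤ}

open Classical in
theorem eval_selected1Expr (hρ : Regs U n ρ) (h4 : ρ 4 = t) {y : ℤ} (h6 : ρ 6 = y)
    (hc : ρ 9 + ρ 2 * ρ 10 = color n (bits n) (2 ^ bits n) y) {role : Expr} {a : ℕ}
    (hr : role.eval ρ = a) :
    (selected1Expr role).eval ρ = if Selected1 n t a y then 1 else 0 := by
  have hd : ∀ e, (digitExpr e (var 4)).eval ρ = digit (base n) e t :=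
    fun e => eval_digitExpr hρ.r13 e h4
  have hs : ∀ k, (selectExpr role k).eval ρ = digit (base n) (k + min a 2) t :=
    fun k => eval_selectExpr hρ.r13 h4 hr k
  simp only [selected1Expr, eval_mul, eval_eq, eval_sub, eval_const, eval_mod, eval_add, eval_var,
    hd, hs, hc, h6, Nat.cast_inj]
  unfold Selected1
  by_cases h1 : y % (digit (base n) 0 t : ℤ) = digit (base n) (1 + min a 2) t <;>
  by_cases h2 : color n (bits n) (2 ^ bits n) y = digit (base n) (4 + min a 2) t <;>
  by_cases h3 : digit (base n) 1 t = digit (base n) 2 t <;>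
  by_cases h4 : digit (base n) 1 t = digit (base n) 3 t <;>
  by_cases h5 : digit (base n) 2 t = digit (base n) 3 t <;> simp [h1, h2, h3, h4, h5]

open Classical in
theorem eval_selected3Expr (hρ : Regs U n ρ) (h4 : ρ 4 = t) {y : ℤ}
    (hc : ρ 9 + ρ 2 * ρ 10 = color n (bits n) (2 ^ bits n) y) {role : Expr} {a : ℕ}
    (hr : role.eval ρ = a) :
    (selected3Expr role).eval ρ = if Selected3 n t a y then 1 else 0 := by
  simp only [selected3Expr, eval_eq, eval_add, eval_mul, eval_var, hc,
    eval_selectExpr hρ.r13 h4 hr 4]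
  exact if_congr Iff.rfl rfl rfl

/-- The selection is a parameter because AVERAGE is the target for both 3-SUM problems, which select
differently. -/
theorem computes_averageExpr {src : ℕ} {xs : ℕ → ℤ} {sel : Expr → Expr} {S : ℕ → ℤ → Prop}
    (hsel : open Classical in ∀ (ρ : ℕ → ℤ) (y : ℤ) (role : Expr) (a : ℕ), Regs U n ρ → ρ 4 = t → ρ 6 = y →
      ρ 9 + ρ 2 * ρ 10 = color n (bits n) (2 ^ bits n) y → role.eval ρ = (a : ℤ) →
      (sel role).eval ρ = if S a y then 1 else 0) :
    Computes U n src xs (averageExpr sel) t i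
      (averageEntry n (fun i => xs (i % (src * n))) S i) := by
  classical
  intro ρ hρ h4 h5 h6 h15 hc
  have hrole : (var 5 / var 0).eval ρ = ((i / n : ℕ) : ℤ) := by simp [h5, hρ.r0]
  have e0 : (bin .eq (var 5 / var 0) (const 0)).eval ρ = if i / n = 0 then 1 else 0 := by
    rw [eval_eq, hrole, eval_const]; norm_cast
  have e1 : (bin .eq (var 5 / var 0) (const 1)).eval ρ = if i / n = 1 then 1 else 0 := by
    rw [eval_eq, hrole, eval_const]; norm_cast
  have e2 : (bin .lt (var 5) (const 3 * var 0) * sel (var 5 / var 0)).eval ρ =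
      if i < 3 * n ∧ S (i / n) (xs (i % (src * n))) then 1 else 0 := by
    rw [eval_mul, hsel ρ _ _ _ hρ h4 h6 hc hrole]
    have : (bin .lt (var 5) (const 3 * var 0)).eval ρ = if i < 3 * n then 1 else 0 := by
      simp only [eval_lt, eval_var, eval_mul, eval_const, h5, hρ.r0]; norm_cast
    rw [this]
    by_cases a1 : i < 3 * n <;> by_cases a2 : S (i / n) (xs (i % (src * n))) <;> simp [a1, a2]
  rw [averageExpr, eval_condExpr e2, eval_condExpr e0, eval_condExpr e1]
  simp only [averageEntry, eval_mul, eval_const, eval_var, eval_add, eval_sub, h6, h15]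

theorem computes_threeSum1Expr {src : ℕ} {xs : ℕ → ℤ} :
    Computes U n src xs threeSum1Expr t i
      (threeSum1Entry n (fun i => xs (i % (src * n))) (Selected1 n t) i) := by
  classical
  intro ρ hρ h4 h5 h6 h15 hc
  have hrole : (var 5 / var 0).eval ρ = ((i / n : ℕ) : ℤ) := by simp [h5, hρ.r0]
  have e0 : (bin .eq (var 5 / var 0) (const 0)).eval ρ = if i / n = 0 then 1 else 0 := by
    rw [eval_eq, hrole, eval_const]; norm_cast
  have e1 : (bin .eq (var 5 / var 0) (const 1)).eval ρ = if i / n = 1 then 1 else 0 := by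
    rw [eval_eq, hrole, eval_const]; norm_cast
  have e2 : (bin .lt (var 5) (const 3 * var 0) * selected1Expr (var 5 / var 0)).eval ρ =
      if i < 3 * n ∧ Selected1 n t (i / n) (xs (i % (src * n))) then 1 else 0 := by
    rw [eval_mul, eval_selected1Expr hρ h4 h6 hc hrole]
    have : (bin .lt (var 5) (const 3 * var 0)).eval ρ = if i < 3 * n then 1 else 0 := by
      simp only [eval_lt, eval_var, eval_mul, eval_const, h5, hρ.r0]; norm_cast
    rw [this]
    by_cases a1 : i < 3 * n <;> by_cases a2 : Selected1 n t (i / n) (xs (i % (src * n))) <;>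
      simp [a1, a2]
  rw [threeSum1Expr, eval_condExpr e2, eval_condExpr e0, eval_condExpr e1]
  simp only [threeSum1Entry, eval_mul, eval_const, eval_var, eval_add, eval_sub, h6, h5, hρ.r0]
  rw [show (n : ℤ) * (n * n) = (n : ℤ) ^ 3 by ring]

theorem computes_threeSum3Expr {xs : ℕ → ℤ} :
    Computes U n 1 xs threeSum3Expr t i (threeSum3Entry n xs (Selected1 n t) i) := by
  classical
  intro ρ hρ h4 h5 h6 h15 hc
  rw [one_mul] at h6 hc
  have hrole : (var 5 / (const 16 * var 0)).eval ρ = ((i / (16 * n) : ℕ) : ℤ) := by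
    simp [h5, hρ.r0]
  have e0 : (bin .eq (var 5 / (const 16 * var 0)) (const 2)).eval ρ =
      if i / (16 * n) = 2 then 1 else 0 := by
    rw [eval_eq, hrole, eval_const]; norm_cast
  have e2 : (bin .lt (var 5 % (const 16 * var 0)) (var 0) *
      selected1Expr (var 5 / (const 16 * var 0))).eval ρ =
      if i % (16 * n) < n ∧ Selected1 n t (i / (16 * n)) (xs (i % n)) then 1 else 0 := by
    rw [eval_mul, eval_selected1Expr hρ h4 h6 hc hrole]
    have : (bin .lt (var 5 % (const 16 * var 0)) (var 0)).eval ρ =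
        if i % (16 * n) < n then 1 else 0 := by
      simp only [eval_lt, eval_var, eval_mul, eval_mod, eval_const, h5, hρ.r0]; norm_cast
    rw [this]
    by_cases a1 : i % (16 * n) < n <;>
    by_cases a2 : Selected1 n t (i / (16 * n)) (xs (i % n)) <;> simp [a1, a2]
  rw [threeSum3Expr, eval_condExpr e2, eval_condExpr e0]
  simp only [threeSum3Entry, eval_mul, eval_const, eval_var, eval_add, h6, h5, hρ.r0]
  rw [show (n : ℤ) * (n * n) = (n : ℤ) ^ 3 by ring]

end

/-! ### The queries find exactly the solutions -/

section Sources

variable {n : ℕ}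

theorem IntSet.Lists.length_eq {l : List ℤ} {X : IntSet n} (h : X.Lists l) : l.length = n := by
  rw [← List.toFinset_card_of_nodup h.1, h.2, X.2.1]

theorem IntSet.abs_le (X : IntSet n) {y : ℤ} (hy : y ∈ X.1) : |y| ≤ (n : ℤ) ^ 3 :=
  _root_.abs_le.mpr (Finset.mem_Icc.mp (X.2.2 hy))

theorem IntSet.Lists.mem_iff {l : List ℤ} {X : IntSet n} (h : X.Lists l) {y : ℤ} :
    y ∈ X.1 ↔ y ∈ l := by
  rw [← h.2, List.mem_toFinset]

theorem IntSet.Lists.mem_iff_getD {l : List ℤ} {X : IntSet n} (h : X.Lists l) {y : ℤ} :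
    y ∈ X.1 ↔ ∃ j < n, l.getD j 0 = y := by
  rw [h.mem_iff, List.mem_iff_getElem]
  constructor
  · rintro ⟨j, hj, rfl⟩
    exact ⟨j, h.length_eq ▸ hj, List.getD_eq_getElem _ _ hj⟩
  · rintro ⟨j, hj, rfl⟩
    have hj' : j < l.length := by rw [h.length_eq]; exact hj
    exact ⟨j, hj', (List.getD_eq_getElem _ _ hj').symm⟩

theorem IntSet.Lists.getD_inj {l : List ℤ} {X : IntSet n} (h : X.Lists l) {i j : ℕ} (hi : i < n)
    (hj : j < n) (hij : l.getD i 0 = l.getD j 0) : i = j := by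
  have hi' : i < l.length := by rw [h.length_eq]; exact hi
  have hj' : j < l.length := by rw [h.length_eq]; exact hj
  rw [List.getD_eq_getElem _ _ hi', List.getD_eq_getElem _ _ hj'] at hij
  exact (h.1.getElem_inj_iff).mp hij

theorem selected1_no_progression {t a : ℕ} {y z u : ℤ} (hy : |y| ≤ (n : ℤ) ^ 3)
    (hz : |z| ≤ (n : ℤ) ^ 3) (hu : |u| ≤ (n : ℤ) ^ 3) (sy : Selected1 n t a y)
    (sz : Selected1 n t a z) (su : Selected1 n t a u) (h : y + z = 2 * u) : y = z :=
  color_no_progression n hy hz hu (sy.2.1.trans su.2.1.symm) (sz.2.1.trans su.2.1.symm) h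

theorem selected3_no_progression {t a : ℕ} {y z u : ℤ} (hy : |y| ≤ (n : ℤ) ^ 3)
    (hz : |z| ≤ (n : ℤ) ^ 3) (hu : |u| ≤ (n : ℤ) ^ 3) (sy : Selected3 n t a y)
    (sz : Selected3 n t a z) (su : Selected3 n t a u) (h : y + z = 2 * u) : y = z :=
  color_no_progression n hy hz hu (sy.trans su.symm) (sz.trans su.symm) h

theorem base_pos (n : ℕ) : 0 < base n := by unfold base; positivity

theorem color_toNat (n : ℕ) {y : ℤ} (hy : |y| ≤ (n : ℤ) ^ 3) :
    ((color n (bits n) (2 ^ bits n) y).toNat : ℤ) = color n (bits n) (2 ^ bits n) y ∧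
      (color n (bits n) (2 ^ bits n) y).toNat < base n := by
  obtain ⟨h1, h2⟩ := color_mem n hy
  refine ⟨Int.toNat_of_nonneg h1, ?_⟩
  have : 0 < (2 ^ bits n) ^ 4 := by positivity
  unfold base
  omega

theorem exists_selected3 {y : Fin 3 → ℤ} (hy : ∀ a, |y a| ≤ (n : ℤ) ^ 3) :
    ∃ t < base n ^ 7, ∀ a : Fin 3, Selected3 n t a (y a) := by
  obtain ⟨t, ht, h⟩ := exists_digits (K := base n) (fun e =>
    match e with
    | 4 => (color n (bits n) (2 ^ bits n) (y 0)).toNat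
    | 5 => (color n (bits n) (2 ^ bits n) (y 1)).toNat
    | 6 => (color n (bits n) (2 ^ bits n) (y 2)).toNat
    | _ => 0) (by
      intro e
      split
      exacts [(color_toNat n (hy 0)).2, (color_toNat n (hy 1)).2, (color_toNat n (hy 2)).2,
        base_pos n]) 7
  refine ⟨t, ht, fun a => ?_⟩
  unfold Selected3
  rw [← (color_toNat n (hy a)).1]
  fin_cases a
  · exact_mod_cast (h 4 (by norm_num)).symm
  · exact_mod_cast (h 5 (by norm_num)).symm
  · exact_mod_cast (h 6 (by norm_num)).symm

/-- Completeness: a separating modulus, the residues and the colours of the `y a` are all below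
`base n`, so they are the digits of some query number. -/
theorem exists_selected1 {y : Fin 3 → ℤ} (hy : ∀ a, |y a| ≤ (n : ℤ) ^ 3)
    (hinj : Function.Injective y) : ∃ t < base n ^ 7, ∀ a : Fin 3, Selected1 n t a (y a) := by
  obtain ⟨p, hp0, hp, hpi⟩ := exists_separating_modulus n hinj hy
  have hp0' : (0 : ℤ) < p := by exact_mod_cast hp0
  have hr : ∀ a, ((y a % (p : ℤ)).toNat : ℤ) = y a % (p : ℤ) := fun a =>
    Int.toNat_of_nonneg (Int.emod_nonneg _ hp0'.ne')
  have hr' : ∀ a, (y a % (p : ℤ)).toNat < base n := fun a => by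
    have h1 := Int.emod_lt_of_pos (y a) hp0'
    have h2 := hr a
    have h3 : p < base n := hp
    omega
  obtain ⟨t, ht, h⟩ := exists_digits (K := base n) (fun e =>
    match e with
    | 0 => p
    | 1 => (y 0 % (p : ℤ)).toNat
    | 2 => (y 1 % (p : ℤ)).toNat
    | 3 => (y 2 % (p : ℤ)).toNat
    | 4 => (color n (bits n) (2 ^ bits n) (y 0)).toNat
    | 5 => (color n (bits n) (2 ^ bits n) (y 1)).toNat
    | 6 => (color n (bits n) (2 ^ bits n) (y 2)).toNat
    | _ => 0) (by
      intro e
      split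
      exacts [hp, hr' 0, hr' 1, hr' 2, (color_toNat n (hy 0)).2, (color_toNat n (hy 1)).2,
        (color_toNat n (hy 2)).2, base_pos n]) 7
  have h0 : digit (base n) 0 t = p := h 0 (by norm_num)
  have h1 : digit (base n) 1 t = (y 0 % (p : ℤ)).toNat := h 1 (by norm_num)
  have h2 : digit (base n) 2 t = (y 1 % (p : ℤ)).toNat := h 2 (by norm_num)
  have h3 : digit (base n) 3 t = (y 2 % (p : ℤ)).toNat := h 3 (by norm_num)
  have h4 : digit (base n) 4 t = (color n (bits n) (2 ^ bits n) (y 0)).toNat := h 4 (by norm_num)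
  have h5 : digit (base n) 5 t = (color n (bits n) (2 ^ bits n) (y 1)).toNat := h 5 (by norm_num)
  have h6 : digit (base n) 6 t = (color n (bits n) (2 ^ bits n) (y 2)).toNat := h 6 (by norm_num)
  have hne : ∀ a b : Fin 3, a ≠ b → (y a % (p : ℤ)).toNat ≠ (y b % (p : ℤ)).toNat := by
    intro a b hab e
    exact hpi.ne hab ((hr a).symm.trans ((congrArg (Nat.cast : ℕ → ℤ) e).trans (hr b)))
  refine ⟨t, ht, fun a => ⟨?_, ?_, ?_, ?_, ?_⟩⟩
  · rw [h0, ← hr a]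
    fin_cases a
    · exact_mod_cast h1.symm
    · exact_mod_cast h2.symm
    · exact_mod_cast h3.symm
  · rw [← (color_toNat n (hy a)).1]
    fin_cases a
    · exact_mod_cast h4.symm
    · exact_mod_cast h5.symm
    · exact_mod_cast h6.symm
  · rw [h1, h2]; exact hne 0 1 (by decide)
  · rw [h1, h3]; exact hne 0 2 (by decide)
  · rw [h2, h3]; exact hne 1 2 (by decide)

/-- Soundness: the prescribed residues are pairwise different, whatever the modulus digit is, and
equal elements would have equal residues. -/
theorem injective_of_selected1 {t : ℕ} {y : Fin 3 → ℤ} (h : ∀ a : Fin 3, Selected1 n t a (y a)) :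
    Function.Injective y := by
  have h0 := (h 0).1
  have h1 := (h 1).1
  have h2 := (h 2).1
  obtain ⟨-, -, d1, d2, d3⟩ := h 0
  simp only [Fin.val_zero, Fin.val_one, Fin.val_two, Nat.zero_min, min_self, Nat.reduceAdd,
    Nat.one_le_ofNat, inf_of_le_left, Nat.add_zero] at h0 h1 h2
  have e01 : y 0 ≠ y 1 := fun e => d1 (by rw [e, h1] at h0; exact_mod_cast h0.symm)
  have e02 : y 0 ≠ y 2 := fun e => d2 (by rw [e, h2] at h0; exact_mod_cast h0.symm)
  have e12 : y 1 ≠ y 2 := fun e => d3 (by rw [e, h2] at h1; exact_mod_cast h1.symm)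
  intro a b hab
  fin_cases a <;> fin_cases b <;> simp_all

theorem IntSet.Lists.occurs_iff {l : List ℤ} {X : IntSet n} (h : X.Lists l) {a : ℕ} (ha : a < 3)
    {y : ℤ} : Occurs n (fun i => l.getD (i % (1 * n)) 0) a y ↔ y ∈ X.1 := by
  rw [h.mem_iff_getD, one_mul]
  constructor
  · rintro ⟨i, hi, -, rfl⟩
    exact ⟨i % n, Nat.mod_lt _ (by omega), rfl⟩
  · rintro ⟨j, hj, rfl⟩
    refine ⟨j + a * n, ?_, ?_, ?_⟩
    · have : a * n ≤ 2 * n := Nat.mul_le_mul_right _ (by omega)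
      omega
    · rw [Nat.add_mul_div_right _ _ (by omega), Nat.div_eq_of_lt hj, zero_add]
    · simp [Nat.mod_eq_of_lt hj]

theorem selected1_iff {l : List ℤ} {X : IntSet n} (h : X.Lists l) (P : (Fin 3 → ℤ) → Prop) :
    (∃ t < base n ^ 7, ∃ y : Fin 3 → ℤ,
      (∀ a : Fin 3, Occurs n (fun i => l.getD (i % (1 * n)) 0) a (y a) ∧ Selected1 n t a (y a)) ∧
        P y) ↔ ∃ y : Fin 3 → ℤ, Function.Injective y ∧ (∀ a, y a ∈ X.1) ∧ P y := by
  constructor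
  · rintro ⟨t, -, y, hy, hP⟩
    exact ⟨y, injective_of_selected1 fun a => (hy a).2,
      fun a => (h.occurs_iff a.2).mp (hy a).1, hP⟩
  · rintro ⟨y, hinj, hy, hP⟩
    obtain ⟨t, ht, hsel⟩ := exists_selected1 (fun a => X.abs_le (hy a)) hinj
    exact ⟨t, ht, y, fun a => ⟨(h.occurs_iff a.2).mpr (hy a), hsel a⟩, hP⟩

theorem getD_blocks {L : Fin 3 → List ℤ} (hL : ∀ a, (L a).length = n) (a : Fin 3) {j : ℕ}
    (hj : j < n) : (L 0 ++ L 1 ++ L 2).getD (j + a * n) 0 = (L a).getD j 0 := by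
  have h0 := hL 0
  have h1 := hL 1
  have h2 := hL 2
  fin_cases a
  · simp only [Fin.zero_eta, zero_mul, add_zero]
    rw [List.getD_append _ _ _ _ (by rw [List.length_append]; omega),
      List.getD_append _ _ _ _ (by omega)]
  · simp only [Fin.mk_one, one_mul]
    rw [List.getD_append _ _ _ _ (by rw [List.length_append]; omega),
      List.getD_append_right _ _ _ _ (by omega), h0, Nat.add_sub_cancel]
  · simp only [Fin.reduceFinMk]
    rw [List.getD_append_right _ _ _ _ (by rw [List.length_append]; omega), List.length_append,
      h0, h1, ← two_mul, Nat.add_sub_cancel]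

theorem index_eq {n i : ℕ} (hi : i < 3 * n) : ∃ a : Fin 3, ∃ j < n, i / n = a ∧ i = j + a * n :=
  ⟨⟨i / n, Nat.div_lt_of_lt_mul (by rwa [mul_comm])⟩, i % n, Nat.mod_lt _ (by omega), rfl,
    by simp only [Nat.mod_add_div']⟩

theorem occurs_blocks_iff {L : Fin 3 → List ℤ} {A : Fin 3 → IntSet n} (h : ∀ a, (A a).Lists (L a))
    {a : Fin 3} {y : ℤ} :
    Occurs n (fun i => (L 0 ++ L 1 ++ L 2).getD (i % (3 * n)) 0) a y ↔ y ∈ (A a).1 := by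
  rw [(h a).mem_iff_getD]
  have hL : ∀ a, (L a).length = n := fun a => (h a).length_eq
  constructor
  · rintro ⟨i, hi, ha, rfl⟩
    obtain ⟨a', j, hj, h1, h2⟩ := index_eq hi
    obtain rfl : a' = a := Fin.ext (h1.symm.trans ha)
    refine ⟨j, hj, ?_⟩
    simp only
    rw [Nat.mod_eq_of_lt hi, h2, getD_blocks hL a' hj]
  · rintro ⟨j, hj, rfl⟩
    have : (a : ℕ) * n ≤ 2 * n := Nat.mul_le_mul_right _ (by omega)
    have hlt : j + a * n < 3 * n := by omega
    refine ⟨j + a * n, hlt, ?_, ?_⟩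
    · rw [Nat.add_mul_div_right _ _ (by omega), Nat.div_eq_of_lt hj, zero_add]
    · simp only
      rw [Nat.mod_eq_of_lt hlt, getD_blocks hL a hj]

theorem selected3_iff {L : Fin 3 → List ℤ} {A : Fin 3 → IntSet n} (h : ∀ a, (A a).Lists (L a))
    (P : (Fin 3 → ℤ) → Prop) :
    (∃ t < base n ^ 7, ∃ y : Fin 3 → ℤ,
      (∀ a : Fin 3, Occurs n (fun i => (L 0 ++ L 1 ++ L 2).getD (i % (3 * n)) 0) a (y a) ∧
        Selected3 n t a (y a)) ∧ P y) ↔ ∃ y : Fin 3 → ℤ, (∀ a, y a ∈ (A a).1) ∧ P y := by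
  constructor
  · rintro ⟨t, -, y, hy, hP⟩
    exact ⟨y, fun a => (occurs_blocks_iff h).mp (hy a).1, hP⟩
  · rintro ⟨y, hy, hP⟩
    obtain ⟨t, ht, hsel⟩ := exists_selected3 (fun a => (A a).abs_le (hy a))
    exact ⟨t, ht, y, fun a => ⟨(occurs_blocks_iff h).mpr (hy a), hsel a⟩, hP⟩

theorem getD_mod_injOn {l : List ℤ} {X : IntSet n} (h : X.Lists l) :
    ∀ i < 3 * n, ∀ j < 3 * n, i / n = j / n →
      l.getD (i % (1 * n)) 0 = l.getD (j % (1 * n)) 0 → i = j := by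
  intro i hi j hj hij he
  rw [one_mul] at he
  have := h.getD_inj (Nat.mod_lt _ (by omega)) (Nat.mod_lt _ (by omega)) he
  rw [← Nat.mod_add_div i n, ← Nat.mod_add_div j n, this, hij]

theorem abs_getD_le {l : List ℤ} (h : ∀ x ∈ l, |x| ≤ (n : ℤ) ^ 3) (j : ℕ) :
    |l.getD j 0| ≤ (n : ℤ) ^ 3 := by
  rcases Nat.lt_or_ge j l.length with hj | hj
  · rw [List.getD_eq_getElem _ _ hj]; exact h _ (List.getElem_mem hj)
  · rw [List.getD_eq_default _ _ hj]; simp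

theorem getD_blocks_injOn {L : Fin 3 → List ℤ} {A : Fin 3 → IntSet n}
    (h : ∀ a, (A a).Lists (L a)) : ∀ i < 3 * n, ∀ j < 3 * n, i / n = j / n →
      (L 0 ++ L 1 ++ L 2).getD (i % (3 * n)) 0 = (L 0 ++ L 1 ++ L 2).getD (j % (3 * n)) 0 →
      i = j := by
  intro i hi j hj hij he
  have hL : ∀ a, (L a).length = n := fun a => (h a).length_eq
  obtain ⟨a, i', hi', a1, a2⟩ := index_eq hi
  obtain ⟨b, j', hj', b1, b2⟩ := index_eq hj
  obtain rfl : a = b := Fin.ext (by rw [← a1, ← b1, hij])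
  rw [Nat.mod_eq_of_lt hi, Nat.mod_eq_of_lt hj, a2, b2, getD_blocks hL a hi',
    getD_blocks hL a hj'] at he
  rw [a2, b2, (h a).getD_inj hi' hj' he]

end Sources

/-! ### Asymptotics -/

/-- With `c = bits n - 1`, minimality gives `2 ^ (c * c) ≤ 2 n ^ 3`, and any linear function of `c`
is at most `θ c ^ 2` plus a constant. The choice `θ = η / 3` cancels the cube. -/
theorem exists_two_pow_bits_le {η : ℝ} (hη : 0 < η) :
    ∃ C : ℝ, 0 < C ∧ ∀ n : ℕ, 1 ≤ n → ((2 : ℝ) ^ bits n) ^ 29 ≤ C * (n : ℝ) ^ η := by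
  set θ := η / 3 with hθ
  have hθ0 : 0 < θ := by positivity
  set D : ℝ := 29 + 29 ^ 2 / (4 * θ) with hD
  have hD0 : 0 ≤ D := by positivity
  refine ⟨2 ^ D * 2 ^ θ, by positivity, fun n hn => ?_⟩
  have hn1 : (1 : ℝ) ≤ n := by exact_mod_cast hn
  rcases Nat.eq_zero_or_pos (bits n) with hb | hb
  · rw [hb, pow_zero, one_pow]
    have h1 : (1 : ℝ) ≤ 2 ^ D := Real.one_le_rpow (by norm_num) hD0
    have h2 : (1 : ℝ) ≤ 2 ^ θ := Real.one_le_rpow (by norm_num) hθ0.le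
    have h3 : (1 : ℝ) ≤ (n : ℝ) ^ η := Real.one_le_rpow hn1 hη.le
    exact one_le_mul_of_one_le_of_one_le (one_le_mul_of_one_le_of_one_le h1 h2) h3
  · obtain ⟨c, hc⟩ : ∃ c, bits n = c + 1 := ⟨bits n - 1, by omega⟩
    have hle : ((2 : ℝ) ^ (c * c)) ≤ 2 * (n : ℝ) ^ 3 := by
      exact_mod_cast two_pow_le_of_lt_bits (n := n) (i := c) (by omega)
    have h1 : ((2 : ℝ) ^ (c * c)) ^ θ ≤ (2 * (n : ℝ) ^ 3) ^ θ :=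
      Real.rpow_le_rpow (by positivity) hle hθ0.le
    have h2 : (2 * (n : ℝ) ^ 3) ^ θ = 2 ^ θ * (n : ℝ) ^ η := by
      rw [Real.mul_rpow (by norm_num) (by positivity), ← Real.rpow_natCast (n : ℝ) 3,
        ← Real.rpow_mul (by positivity)]
      congr 2
      rw [hθ]; push_cast; ring
    have h3 : ((2 : ℝ) ^ (c * c)) ^ θ = 2 ^ ((c : ℝ) * c * θ) := by
      rw [← Real.rpow_natCast (2 : ℝ) (c * c), ← Real.rpow_mul (by norm_num)]
      push_cast; rfl
    have h4 : ((2 : ℝ) ^ bits n) ^ 29 = 2 ^ (29 * ((c : ℝ) + 1)) := by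
      rw [hc, ← pow_mul, ← Real.rpow_natCast]
      congr 1; push_cast; ring
    -- Completing the square; this determines `D`.
    have h5 : 29 * ((c : ℝ) + 1) ≤ D + (c : ℝ) * c * θ := by
      have hsq : 0 ≤ (2 * θ * c - 29) ^ 2 / (4 * θ) := by positivity
      have : (2 * θ * c - 29) ^ 2 / (4 * θ) = θ * c * c - 29 * c + 29 ^ 2 / (4 * θ) := by
        field_simp; ring
      rw [hD]; linarith
    calc ((2 : ℝ) ^ bits n) ^ 29 = 2 ^ (29 * ((c : ℝ) + 1)) := h4
      _ ≤ 2 ^ (D + (c : ℝ) * c * θ) := Real.rpow_le_rpow_of_exponent_le (by norm_num) h5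
      _ = 2 ^ D * ((2 : ℝ) ^ (c * c)) ^ θ := by rw [h3, Real.rpow_add (by norm_num)]
      _ ≤ 2 ^ D * (2 ^ θ * (n : ℝ) ^ η) := by rw [← h2]; gcongr
      _ = _ := by ring

/-- `base n ^ 7` contributes `q ^ 28`, and `bits n + 1 ≤ q` one more factor; hence the exponent
`29`. -/
theorem exists_base_pow_le {η : ℝ} (hη : 0 < η) :
    ∃ C : ℝ, 0 < C ∧ ∀ n : ℕ, 1 ≤ n →
      ((bits n : ℝ) + 1) * ((base n : ℝ) ^ 7 + 1) ≤ C * (n : ℝ) ^ η := by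
  obtain ⟨C, hC, h⟩ := exists_two_pow_bits_le hη
  refine ⟨2 * 64 ^ 7 * C, by positivity, fun n hn => ?_⟩
  have h1 : (bits n : ℝ) + 1 ≤ 2 ^ bits n := by
    exact_mod_cast Nat.succ_le_of_lt Nat.lt_two_pow_self
  have h2 : (1 : ℝ) ≤ 2 ^ bits n := one_le_pow₀ (by norm_num)
  have h3 : (base n : ℝ) = 64 * (2 ^ bits n) ^ 4 := by unfold base; push_cast; rfl
  have hn' := h n hn
  generalize (2 : ℝ) ^ bits n = q at *
  have h4 : (base n : ℝ) ^ 7 + 1 ≤ 2 * 64 ^ 7 * q ^ 28 := by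
    have : (1 : ℝ) ≤ q ^ 28 := one_le_pow₀ h2
    rw [h3, mul_pow, ← pow_mul]
    norm_num
    linarith
  calc ((bits n : ℝ) + 1) * ((base n : ℝ) ^ 7 + 1) ≤ q * (2 * 64 ^ 7 * q ^ 28) :=
        mul_le_mul h1 h4 (by positivity) (by linarith)
    _ = 2 * 64 ^ 7 * q ^ 29 := by ring
    _ ≤ 2 * 64 ^ 7 * (C * (n : ℝ) ^ η) := by gcongr
    _ = _ := by ring

open Classical in
theorem subquadraticReduction_of_queries {A B : Problem} (src tgt : ℕ) (E : Expr) (hs0 : 0 < src)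
    (hs : src ≤ 3) (ht : tgt ≤ 48) (hB : ∀ n, B.words (16 * n) = tgt * n)
    (hE : E.VarsBelow 16 = true) (hdeg : E.deg 200 < 10000)
    (h : ∀ (n : ℕ) (I : A.Inst n) (l : List ℤ), A.Encodes l I →
      l.length ≤ 3 * n ∧ (∀ x ∈ l, |x| ≤ (n : ℤ) ^ 3) ∧
      ∃ (v : ℕ → ℕ → ℤ) (J : ℕ → B.Inst (16 * n)),
        (∀ U t i, Computes U n src (fun j => l.getD j 0) E t i (v t i)) ∧
        (∀ t, B.Encodes ((List.range (tgt * n)).map (v t)) (J t)) ∧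
        ((∃ t < base n ^ 7, B.Yes (J t)) ↔ A.Yes I)) :
    SubquadraticReduction A B := by
  refine ⟨manyQueries src tgt E, 10000, fun ε hε => ?_⟩
  -- With `n ^ δ` as allowance for the number of queries, the time needs `1 + δ ≤ 2 - δ`, and the
  -- query sum needs `ε - 2 δ > 0` so that `n ^ (ε - 2 δ)` absorbs the constants.
  set δ := min ε 1 / 4 with hδ
  have hδ0 : 0 < δ := by positivity
  have hδε : 4 * δ ≤ ε := by rw [hδ]; linarith [min_le_left ε 1]
  have hδ1 : 4 * δ ≤ 1 := by rw [hδ]; linarith [min_le_right ε 1]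
  obtain ⟨C, hC, hbound⟩ := exists_base_pow_le hδ0
  have hev : ∀ᶠ m : ℕ in Filter.atTop, C * (16 : ℝ) ^ (2 - ε) ≤ (m : ℝ) ^ (ε - 2 * δ) :=
    ((tendsto_rpow_atTop (by linarith : 0 < ε - 2 * δ)).comp
      tendsto_natCast_atTop_atTop).eventually_ge_atTop _
  obtain ⟨m₀, hm₀⟩ := Filter.eventually_atTop.mp hev
  refine ⟨δ, hδ0, (48 * E.cost + 100000) * 2 * C, max m₀ 1, fun n I l hl => ?_⟩
  obtain ⟨hlen, habs, v, J, hv, hJ, hyes⟩ := h n I l hl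
  -- The least power of two above `n` when `n ≥ 1`, chosen so that words of `wordSize 10000 n` bits
  -- have the exact range `U ^ 10000`.
  set U := 2 ^ (Nat.log 2 n + 1) with hUdef
  have hU : 2 ≤ U := by rw [hUdef, pow_succ]; have := Nat.one_le_two_pow (n := Nat.log 2 n); omega
  have hn : n < U := Nat.lt_pow_succ_log_self (by norm_num) n
  have hw : 2 ^ wordSize 10000 n = U ^ 10000 := by
    rw [wordSize, hUdef, mul_comm, pow_mul]
  obtain ⟨s, T, hexec, hans, hT⟩ := exec_manyQueries (B := B) (w := wordSize 10000 n) hU hn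
    (by rw [hw]; exact Nat.pow_le_pow_right (by omega) (by norm_num)) hs0 hs ht (hB n) hlen habs
    ⟨hE, by rw [hw]; exact Nat.pow_lt_pow_right (by omega) hdeg⟩
    (fun t _ i _ => hv U t i) J (fun t _ => hJ t)
  refine ⟨s, T, _, hexec, ?_, fun hmn => ⟨?_, ?_⟩⟩
  · by_cases hY : A.Yes I
    · exact .inl ⟨hY, by rw [hans, if_pos (hyes.mpr hY)]⟩
    · exact .inr ⟨hY, by rw [hans, if_neg fun hh => hY (hyes.mp hh)]⟩
  · clear hexec hw
    have hn1 : 1 ≤ n := (le_max_right _ _).trans hmn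
    have hnR : (1 : ℝ) ≤ n := by exact_mod_cast hn1
    have hn0 : (0 : ℝ) < n := by linarith
    have hT' : (T : ℝ) ≤ (48 * E.cost + 100000) * (bits n + 1) * (n + 1) * ((base n : ℝ) ^ 7 + 1) := by
      exact_mod_cast hT
    calc (T : ℝ) ≤ (48 * E.cost + 100000) * (n + 1) *
          (((bits n : ℝ) + 1) * ((base n : ℝ) ^ 7 + 1)) := hT'.trans_eq (by ring)
      _ ≤ (48 * E.cost + 100000) * (2 * n) * (C * (n : ℝ) ^ δ) := by
          have := hbound n hn1
          gcongr
          linarith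
      _ = (48 * E.cost + 100000) * 2 * C * (n : ℝ) ^ (1 + δ) := by
          rw [Real.rpow_add hn0, Real.rpow_one]; ring
      _ ≤ _ := by
          gcongr
          linarith
  · clear hexec hw
    have hn1 : 1 ≤ n := (le_max_right _ _).trans hmn
    have hnR : (1 : ℝ) ≤ n := by exact_mod_cast hn1
    have hn0 : (0 : ℝ) < n := by linarith
    have hK : (base n : ℝ) ^ 7 ≤ C * (n : ℝ) ^ δ := by
      refine le_trans ?_ (hbound n hn1)
      have h1 : (0 : ℝ) ≤ bits n := by positivity
      have h2 : (0 : ℝ) ≤ (base n : ℝ) ^ 7 := by positivity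
      nlinarith
    rw [List.map_replicate, List.sum_replicate, nsmul_eq_mul]
    push_cast
    rw [Real.mul_rpow (by norm_num) hn0.le]
    calc (base n : ℝ) ^ 7 * (16 ^ (2 - ε) * (n : ℝ) ^ (2 - ε))
        ≤ C * (n : ℝ) ^ δ * (16 ^ (2 - ε) * (n : ℝ) ^ (2 - ε)) := by gcongr
      _ = C * 16 ^ (2 - ε) * ((n : ℝ) ^ δ * (n : ℝ) ^ (2 - ε)) := by ring
      _ ≤ (n : ℝ) ^ (ε - 2 * δ) * ((n : ℝ) ^ δ * (n : ℝ) ^ (2 - ε)) := by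
          have := hm₀ n ((le_max_left _ _).trans hmn)
          gcongr
      _ = (n : ℝ) ^ (2 - δ) := by
          rw [← Real.rpow_add hn0, ← Real.rpow_add hn0]
          congr 1; ring

/-! ### The reductions -/

/-- Only the residues matter here, to make the three elements distinct; the colours are harmless,
since every triple is admitted by the query with its own colours. -/
theorem average_to_threeSum1 : SubquadraticReduction average threeSum1 := by
  refine subquadraticReduction_of_queries 1 16 threeSum1Expr (by norm_num) (by norm_num)
    (by norm_num) (fun n => rfl) (by decide) (by decide) fun n X l hl => ?_
  have hl' : IntSet.Lists l X := hl
  have habs : ∀ x ∈ l, |x| ≤ (n : ℤ) ^ 3 := fun x hx => IntSet.abs_le X (hl'.mem_iff.mpr hx)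
  have hlen := hl'.length_eq
  choose J hJ hY using fun t => query_threeSum1 (S := Selected1 n t) (getD_mod_injOn hl')
    (fun i _ => abs_getD_le habs _)
  refine ⟨by omega, habs, _, J, fun U t i => computes_threeSum1Expr, hJ, ?_⟩
  simp only [hY]
  rw [selected1_iff hl' fun y => y 0 + y 1 - 2 * y 2 = 0]
  simp [average, LDT1, Fin.sum_univ_three, sub_eq_add_neg]

theorem average_to_threeSum3 : SubquadraticReduction average threeSum3 := by
  refine subquadraticReduction_of_queries 1 48 threeSum3Expr (by norm_num) (by norm_num)
    (by norm_num) (fun n => by simp only [threeSum3, LDT3]; ring) (by decide) (by decide)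
    fun n X l hl => ?_
  have hl' : IntSet.Lists l X := hl
  have habs : ∀ x ∈ l, |x| ≤ (n : ℤ) ^ 3 := fun x hx => IntSet.abs_le X (hl'.mem_iff.mpr hx)
  have hlen := hl'.length_eq
  choose J hJ hY using fun t => query_threeSum3 (S := Selected1 n t) (x := fun j => l.getD j 0)
    (fun i hi j hj => hl'.getD_inj hi hj) (fun i _ => abs_getD_le habs _)
  refine ⟨by omega, habs, _, J, fun U t i => computes_threeSum3Expr, hJ, ?_⟩
  simp only [hY]
  have := selected1_iff hl' fun y => y 0 + y 1 - 2 * y 2 = 0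
  simp only [one_mul] at this
  rw [this]
  simp [average, LDT1, Fin.sum_univ_three, sub_eq_add_neg]

/-- Residues and colours are both needed: distinctness for the source, progression-free roles for
the target. -/
theorem threeSum1_to_average : SubquadraticReduction threeSum1 average := by
  refine subquadraticReduction_of_queries 1 16 (averageExpr selected1Expr) (by norm_num)
    (by norm_num) (by norm_num) (fun n => rfl) (by decide) (by decide) fun n X l hl => ?_
  have hl' : IntSet.Lists l X := hl
  have habs : ∀ x ∈ l, |x| ≤ (n : ℤ) ^ 3 := fun x hx => IntSet.abs_le X (hl'.mem_iff.mpr hx)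
  have hlen := hl'.length_eq
  choose J hJ hY using fun t => query_average (S := Selected1 n t) (getD_mod_injOn hl')
    (fun i _ => abs_getD_le habs _) (fun a y z u => selected1_no_progression)
  refine ⟨by omega, habs, _, J, fun U t i => computes_averageExpr
    fun ρ y role a hρ h4 h6 hc hr => eval_selected1Expr hρ h4 h6 hc hr, hJ, ?_⟩
  simp only [hY]
  rw [selected1_iff hl' fun y => y 0 + y 1 + y 2 = 0]
  simp [threeSum1, LDT1, Fin.sum_univ_three]

/-- A solution may use the same number in several sets, so residues must not be imposed; the colours
alone select. -/
theorem threeSum3_to_average : SubquadraticReduction threeSum3 average := by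
  refine subquadraticReduction_of_queries 3 16 (averageExpr selected3Expr) (by norm_num)
    (by norm_num) (by norm_num) (fun n => rfl) (by decide) (by decide) fun n A l hl => ?_
  obtain ⟨L, rfl, hL⟩ := hl
  have hlen : ∀ a, (L a).length = n := fun a => (hL a).length_eq
  have habs : ∀ x ∈ L 0 ++ L 1 ++ L 2, |x| ≤ (n : ℤ) ^ 3 := by
    intro x hx
    simp only [List.mem_append] at hx
    rcases hx with (hx | hx) | hx
    · exact (A 0).abs_le ((hL 0).mem_iff.mpr hx)
    · exact (A 1).abs_le ((hL 1).mem_iff.mpr hx)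
    · exact (A 2).abs_le ((hL 2).mem_iff.mpr hx)
  choose J hJ hY using fun t => query_average (S := Selected3 n t) (getD_blocks_injOn hL)
    (fun i _ => abs_getD_le habs _) (fun a y z u => selected3_no_progression)
  refine ⟨by simp [hlen]; omega, habs, _, J, fun U t i => computes_averageExpr
    fun ρ y role a hρ h4 h6 hc hr => eval_selected3Expr hρ h4 hc hr, hJ, ?_⟩
  simp only [hY]
  rw [selected3_iff hL fun y => y 0 + y 1 + y 2 = 0]
  simp [threeSum3, LDT3, Fin.sum_univ_three]

end FineGrained

theorem mainTheorem2 :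
    FineGrained.SubquadraticEquivalent FineGrained.average FineGrained.threeSum1 ∧
    FineGrained.SubquadraticEquivalent FineGrained.average FineGrained.threeSum3 :=
  ⟨⟨FineGrained.average_to_threeSum1, FineGrained.threeSum1_to_average⟩,
    ⟨FineGrained.average_to_threeSum3, FineGrained.threeSum3_to_average⟩⟩
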